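/- Let $\mathfrak g$ be a compact simple real Lie algebra with an invariant metric $\gamma$ (a positive definite symmetric bilinear form with $\gamma([x,y],z)=\gamma(x,[y,z])$). For a $\gamma$-orthonormal basis $(T^a)$ let $f^{abc}=\gamma([T^a,T^b],T^c)$ be the structure constants; repeated indices are summed. The Yangian $Y(\mathfrak g)$ is the complex unital associative algebra with generators $Q_0^a,Q_1^a$ and relations $$[Q_0^a,Q_0^b]=f^{abc}Q_0^c,\qquad [Q_0^a,Q_1^b]=f^{abc}Q_1^c,\qquad f^{d[ab}[Q_1^{c]},Q_1^d]=\tfrac1{12}f^{api}f^{bqj}f^{crk}f^{ijk}\,Q_0^{(p}Q_0^qQ_0^{r)},$$ where $(\,)$ and $[\,]$ on indices denote symmetrization and antisymmetrization of total weight one; when $\dim\mathfrak g=3$ (the case $\mathfrak{sl}(2)$) one also imposes Drinfeld's relation $$f^{cde}[[Q_1^a,Q_1^b],Q_1^e]+f^{abe}[[Q_1^c,Q_1^d],Q_1^e]=\tfrac14\big(f^{api}f^{bqj}f^{cde}+f^{cpi}f^{dqj}f^{abe}\big)f^{erk}f^{ijk}\,Q_0^{(p}Q_0^qQ_1^{r)}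 .$$ Let $(\mathfrak g,\mathfrak h)$ be a symmetric pair, $\mathfrak g=\mathfrak h\oplus\mathfrak k$: $\mathfrak h$ and $\mathfrak k$ are the eigenspaces, with eigenvalues $+1$ and $-1$, of an involutive automorphism of $\mathfrak g$. Choose the orthonormal basis adapted to $\mathfrak h\oplus\mathfrak k$, with indices $i$ for $\mathfrak h$ and $p$ for $\mathfrak k$. The twisted Yangian $Y(\mathfrak g,\mathfrak h)$ is the subalgebra of $Y(\mathfrak g)$ generated by all $Q_0^i$ and all $$\widetilde Q_1^p=Q_1^p+\tfrac14[C,Q_0^p],\qquad C=\sum_i Q_0^iQ_0^i .$$ 1. There is an algebra homomorphism $\Delta:Y(\mathfrak g)\to Y(\mathfrak g)\otimes Y(\mathfrak g)$ (necessarily unique), the coproduct, with $$\Delta(Q_0^a)=Q_0^a\otimes1+1\otimes Q_0^a,\qquad \Delta(Q_1^a)=Q_1^a\otimes1+1\otimes Q_1^a+\tfrac12f^{abc}Q_0^b\otimes Q_0^c .$$ It satisfies, for every $\mathfrak k$-index $p$, $$\Delta(\widetilde Q_1^p)=\widetilde Q_1^p\otimes1+1\otimes\widetilde Q_1^p+\tfrac12[\Delta(C)-C\otimes1-1\otimes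 C,\;Q_0^p\otimes1],$$ and $Y(\mathfrak g,\mathfrak h)$ is a left co-ideal subalgebra: $\Delta(Y(\mathfrak g,\mathfrak h))\subset Y(\mathfrak g)\otimes Y(\mathfrak g,\mathfrak h)$. 2. The co-ideal property fails for general subalgebras: there are a compact simple $\mathfrak g$ with an invariant metric and a Lie subalgebra $\mathfrak h\subset\mathfrak g$ such that, when $Y(\mathfrak g,\mathfrak h)$ is defined by the same formulas with $\mathfrak k=\mathfrak h^{\perp}$, one has $\Delta(Y(\mathfrak g,\mathfrak h))\not\subset Y(\mathfrak g)\otimes Y(\mathfrak g,\mathfrak h)$. -/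

import Mathlib

open scoped TensorProduct

noncomputable section

/-! ## Symmetric pairs and adapted bases -/

/-- An invariant metric on a real Lie algebra: a symmetric, positive definite bilinear form
with `γ([x, y], z) = γ(x, [y, z])`.  A finite-dimensional simple real Lie algebra is compact
exactly when it carries such a form. -/
structure IsInvariantMetric {g : Type*} [LieRing g] [LieAlgebra ℝ g]
    (γ : LinearMap.BilinForm ℝ g) : Prop where
  symm : ∀ x y, γ x y = γ y x
  pos : ∀ x, x ≠ 0 → 0 < γ x x
  invariant : ∀ x y z, γ ⁅x, y⁆ z = γ x ⁅y, z⁆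

/-- `(g, h)` is a symmetric pair with `g = h ⊕ k`: there is an involutive automorphism `σ`
of `g` whose `+1`-eigenspace is `h` and whose `-1`-eigenspace is `k`. -/
def IsSymmetricPair {g : Type*} [LieRing g] [LieAlgebra ℝ g]
    (h : LieSubalgebra ℝ g) (k : Submodule ℝ g) : Prop :=
  ∃ σ : g ≃ₗ⁅ℝ⁆ g, (∀ x, σ (σ x) = x) ∧ (∀ x, x ∈ h ↔ σ x = x) ∧ (∀ x, x ∈ k ↔ σ x = -x)

/-- A `γ`-orthonormal basis `T` of `g` adapted to a decomposition `g = h ⊕ k`: the vectors with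
index `Sum.inl i` lie in `h` (the `h`-indices), those with index `Sum.inr p` lie in `k`
(the `k`-indices). -/
structure IsAdaptedBasis {g : Type*} [LieRing g] [LieAlgebra ℝ g] {I P : Type*}
    (γ : LinearMap.BilinForm ℝ g) (h : LieSubalgebra ℝ g) (k : Submodule ℝ g)
    (T : Module.Basis (I ⊕ P) ℝ g) : Prop where
  norm_one : ∀ a, γ (T a) (T a) = 1
  ortho : ∀ a b, a ≠ b → γ (T a) (T b) = 0
  mem_h : ∀ i, T (Sum.inl i) ∈ h
  mem_k : ∀ p, T (Sum.inr p) ∈ k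

/-- The structure constants `f^{abc} = γ([T^a, T^b], T^c)`.  For an orthonormal basis they are
characterised by `[T^a, T^b] = ∑_c f^{abc} T^c`, and all indices may be raised and lowered
freely. -/
def structureConst {g : Type*} [LieRing g] [LieAlgebra ℝ g] {ι : Type*}
    (γ : LinearMap.BilinForm ℝ g) (T : Module.Basis ι ℝ g) (a b c : ι) : ℝ :=
  γ ⁅T a, T b⁆ (T c)

/-! ## The Yangian -/

/-- The generators `Q_0^a`, `Q_1^a` of the Yangian. -/
inductive YangianGen (ι : Type*) : Type _
  | q0 (a : ι) : YangianGen ι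
  | q1 (a : ι) : YangianGen ι

/-- The symmetrised product `x^{(1} x^2 x^{3)}`, of total weight one. -/
def symm3 {A : Type*} [Ring A] [Algebra ℂ A] (x y z : A) : A :=
  (1 / 6 : ℂ) • (x * y * z + x * z * y + y * x * z + y * z * x + z * x * y + z * y * x)

/-- The antisymmetrisation `F^{[abc]}`, of total weight one. -/
def alt3 {ι A : Type*} [Ring A] [Algebra ℂ A] (F : ι → ι → ι → A) (a b c : ι) : A :=
  (1 / 6 : ℂ) • (F a b c + F b c a + F c a b - F b a c - F a c b - F c b a)

/-- `Q_0^a` in the free algebra. -/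
def freeQ0 {ι : Type*} (a : ι) : FreeAlgebra ℂ (YangianGen ι) :=
  FreeAlgebra.ι ℂ (YangianGen.q0 a)

/-- `Q_1^a` in the free algebra. -/
def freeQ1 {ι : Type*} (a : ι) : FreeAlgebra ℂ (YangianGen ι) :=
  FreeAlgebra.ι ℂ (YangianGen.q1 a)

/-- The defining relations of the Yangian with structure constants `f` (with respect to an
orthonormal basis).  Here `⁅x, y⁆ = x * y - y * x`.  The last relation is Drinfeld's additional
relation, imposed when `g` has dimension three, that is, for `sl(2)`, where `serre` is vacuous;
for all other simple `g` it is a consequence of `serre`. -/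
inductive YangianRel {ι : Type*} [Fintype ι] (f : ι → ι → ι → ℝ) :
    FreeAlgebra ℂ (YangianGen ι) → FreeAlgebra ℂ (YangianGen ι) → Prop
  | q0_q0 (a b : ι) :
      YangianRel f ⁅freeQ0 a, freeQ0 b⁆ (∑ c, (f a b c : ℂ) • freeQ0 c)
  | q0_q1 (a b : ι) :
      YangianRel f ⁅freeQ0 a, freeQ1 b⁆ (∑ c, (f a b c : ℂ) • freeQ1 c)
  | serre (a b c : ι) :
      YangianRel f
        (alt3 (fun a b c => ∑ d, (f d a b : ℂ) • ⁅freeQ1 c, freeQ1 d⁆) a b c)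
        ((1 / 12 : ℂ) • ∑ p, ∑ q, ∑ r, ∑ i, ∑ j, ∑ k,
          ((f a p i * f b q j * f c r k * f i j k : ℝ) : ℂ) •
            symm3 (freeQ0 p) (freeQ0 q) (freeQ0 r))
  | sl2 (hdim : Fintype.card ι = 3) (a b c d : ι) :
      YangianRel f
        (∑ e, ((f c d e : ℂ) • ⁅⁅freeQ1 a, freeQ1 b⁆, freeQ1 e⁆
          + (f a b e : ℂ) • ⁅⁅freeQ1 c, freeQ1 d⁆, freeQ1 e⁆))
        ((1 / 4 : ℂ) • ∑ p, ∑ q, ∑ r, ∑ i, ∑ j, ∑ k, ∑ e,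
          (((f a p i * f b q j * f c d e + f c p i * f d q j * f a b e)
              * f e r k * f i j k : ℝ) : ℂ) •
            symm3 (freeQ0 p) (freeQ0 q) (freeQ1 r))

/-- The Yangian `Y(g)`: the complex unital associative algebra generated by the `Q_0^a` and
`Q_1^a` subject to `YangianRel`. -/
abbrev Yangian {ι : Type*} [Fintype ι] (f : ι → ι → ι → ℝ) : Type _ :=
  RingQuot (YangianRel f)

namespace Yangian

variable {ι : Type*} [Fintype ι] (f : ι → ι → ι → ℝ)

/-- The generator `Q_0^a` of the Yangian. -/
def Q0 (a : ι) : Yangian f := RingQuot.mkAlgHom ℂ (YangianRel f) (freeQ0 a)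

/-- The generator `Q_1^a` of the Yangian. -/
def Q1 (a : ι) : Yangian f := RingQuot.mkAlgHom ℂ (YangianRel f) (freeQ1 a)

/-- `Δ` is the coproduct of the Yangian: the algebra homomorphism `Y(g) → Y(g) ⊗ Y(g)` (unique,
since the `Q_0^a` and `Q_1^a` generate) with the prescribed values on the generators. -/
structure IsCoproduct (Δ : Yangian f →ₐ[ℂ] Yangian f ⊗[ℂ] Yangian f) : Prop where
  map_Q0 : ∀ a, Δ (Q0 f a) = Q0 f a ⊗ₜ[ℂ] 1 + 1 ⊗ₜ[ℂ] Q0 f a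
  map_Q1 : ∀ a, Δ (Q1 f a) = Q1 f a ⊗ₜ[ℂ] 1 + 1 ⊗ₜ[ℂ] Q1 f a
    + (1 / 2 : ℂ) • ∑ b, ∑ c, (f a b c : ℂ) • (Q0 f b ⊗ₜ[ℂ] Q0 f c)

end Yangian

/-! ## The twisted Yangian -/

namespace TwistedYangian

variable {I P : Type*} [Fintype I] [Fintype P] (f : I ⊕ P → I ⊕ P → I ⊕ P → ℝ)

/-- The quadratic Casimir of `g` restricted to `h`: `C = ∑_i Q_0^i Q_0^i`, the sum being over
the `h`-indices of an orthonormal basis. -/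
def casimir : Yangian f := ∑ i : I, Yangian.Q0 f (Sum.inl i) * Yangian.Q0 f (Sum.inl i)

/-- `Q̃_1^p = Q_1^p + ¼ [C, Q_0^p]` for a `k`-index `p`. -/
def Qtilde (p : P) : Yangian f :=
  Yangian.Q1 f (Sum.inr p) + (1 / 4 : ℂ) • ⁅casimir f, Yangian.Q0 f (Sum.inr p)⁆

end TwistedYangian

/-- The twisted Yangian `Y(g, h)`: the subalgebra of `Y(g)` generated by the `Q_0^i` and the
`Q̃_1^p`. -/
def twistedYangian {I P : Type*} [Fintype I] [Fintype P]
    (f : I ⊕ P → I ⊕ P → I ⊕ P → ℝ) : Subalgebra ℂ (Yangian f) :=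
  Algebra.adjoin ℂ
    (Set.range (fun i : I => Yangian.Q0 f (Sum.inl i)) ∪ Set.range (TwistedYangian.Qtilde f))

/-- `B` is a left co-ideal subalgebra of `A` with respect to `Δ`: `Δ(B) ⊆ A ⊗ B`, where `A ⊗ B`
is the image of `A ⊗ B` in `A ⊗ A`. -/
def IsLeftCoideal {A : Type*} [Ring A] [Algebra ℂ A] (Δ : A →ₐ[ℂ] A ⊗[ℂ] A)
    (B : Subalgebra ℂ A) : Prop :=
  B.map Δ ≤ (Algebra.TensorProduct.map (AlgHom.id ℂ A) B.val).range

end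

/-! Existence of the coproduct. The relations are first freed from the basis: images of the
generators in an algebra `B` are linear maps `q, J : g → B`, where `q` is a Lie homomorphism, `J` is
equivariant, and the cyclic sum of `[J x, J [y, z]]` is a quarter of a cubic in `q`
(`IsYangianPair`, `isYangianPair_iff`). Given two such pairs `(X, JX)`, `(Y, JY)` commuting with
each other, put `q = X + Y` and `J = JX + JY + ½ θ`, where `θ u = [Y u, Ω]` and `Ω = ∑ X(T_b)
Y(T_b)`. This must again be a Yangian pair; for the two inclusions into `Y(g) ⊗ Y(g)` it gives the
coproduct. The tool throughout is invariance of `Ω`, used as integration by parts (`contract_lie`).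
In `[J x, J w]` the terms linear in `JX` or `JY` depend only on `[x, w]` (`lie_coprodJ`), so the
Jacobi identity removes them from the cyclic sum. The terms `[θ, θ]` match the mixed terms of the
cubic (`serreCubic_add`) by another Jacobi computation (`lie_identity`).

In dimension three the bracket is a multiple of the cross product. Then there is a linear `K` with
`K [a, b] = [J a, J b]`, and Drinfeld's relation is the polarisation of `[K u, J u] = (r/8) q u [C,
J u]` with `C` the Casimir element of `g`. This one-variable identity is what gets checked for the
coproduct (`sl2Quadratic_coprod`).

Co-ideal property. The involution grades the structure constants, so `f^{pbc}` survives only with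
one of `b, c` in `h` and the other in `k`. With `Ω_h` the canonical tensor of `h`, the tail of
`Δ(Q_1^p)` is then `½([Ω_h, Q^p ⊗ 1] - [Ω_h, 1 ⊗ Q^p])`. The correction `¼[C, Q^p]`, now with `C`
the Casimir of `h`, contributes `½([Ω_h, Q^p ⊗ 1] + [Ω_h, 1 ⊗ Q^p])`. The sum is `[Ω_h, Q^p ⊗ 1]`,
whose right legs lie in `h`.

Failure in general. Take `su(3)` and its diagonal torus. The defining representation of `su(n)`
extends to the Yangian with `Q_1 ↦ 0`, because the cubic vanishes there (`serreCubic_suIncl`). The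
torus Casimir acts as a scalar, so every `Q̃` maps to zero and the twisted Yangian maps to diagonal
matrices. Hence an off-diagonal entry on the right leg annihilates `Y(g) ⊗ Y(g, h)`; yet the entries
`(k, j)` and `(i, k)` on the two legs send `Δ(Q̃^p)` to `-½ (T_p)_{ij}`, which cannot vanish for all
`p`. -/

/-- An orthonormal basis with respect to an invariant metric. -/
structure IsMetricBasis {g : Type*} [LieRing g] [LieAlgebra ℝ g] {ι : Type*}
    (γ : LinearMap.BilinForm ℝ g) (T : Module.Basis ι ℝ g) : Prop where
  metric : IsInvariantMetric γ
  norm_one : ∀ a, γ (T a) (T a) = 1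
  ortho : ∀ a b, a ≠ b → γ (T a) (T b) = 0

/-! ### Contractions over an orthonormal basis -/

namespace IsMetricBasis

variable {g : Type*} [LieRing g] [LieAlgebra ℝ g] {ι : Type*} [Fintype ι]
  {γ : LinearMap.BilinForm ℝ g} {T : Module.Basis ι ℝ g}

theorem apply_eq_repr (h : IsMetricBasis γ T) (w : g) (b : ι) : γ w (T b) = T.repr w b := by
  classical
  conv_lhs => rw [← T.sum_repr w]
  rw [map_sum, LinearMap.sum_apply, Finset.sum_eq_single b]
  · simp [h.norm_one]
  · intro c _ hc
    simp [h.ortho c b hc]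
  · simp

theorem sum_smul (h : IsMetricBasis γ T) (w : g) : ∑ b, γ w (T b) • T b = w := by
  simp_rw [h.apply_eq_repr]
  exact T.sum_repr w

theorem sum_smul_map (h : IsMetricBasis γ T) {M : Type*} [AddCommGroup M] [Module ℝ M]
    (A : g →ₗ[ℝ] M) (w : g) : ∑ b, γ w (T b) • A (T b) = A w := by
  conv_rhs => rw [← h.sum_smul w]
  simp

theorem sum_mul (h : IsMetricBasis γ T) (v w : g) : ∑ b, γ v (T b) * γ w (T b) = γ v w := by
  conv_rhs => rw [← h.sum_smul w]
  simp [mul_comm]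

omit [Fintype ι] in
theorem lie_skew_left (h : IsMetricBasis γ T) (u v w : g) : γ ⁅u, v⁆ w = - γ v ⁅u, w⁆ := by
  rw [← lie_skew, map_neg, LinearMap.neg_apply, h.metric.invariant]

/-- Invariance of the canonical tensor, in the form of integration by parts. -/
theorem contract_lie (h : IsMetricBasis γ T) {M : Type*} [AddCommGroup M] [Module ℝ M]
    (F : g → g → M) (h1 : ∀ s s' t, F (s + s') t = F s t + F s' t)
    (h2 : ∀ (c : ℝ) s t, F (c • s) t = c • F s t)
    (h3 : ∀ s t t', F s (t + t') = F s t + F s t')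
    (h4 : ∀ (c : ℝ) s t, F s (c • t) = c • F s t) (u : g) :
    ∑ b, F (T b) ⁅u, T b⁆ = - ∑ b, F ⁅u, T b⁆ (T b) := by
  let β : g →ₗ[ℝ] g →ₗ[ℝ] M := LinearMap.mk₂ ℝ F h1 h2 h3 h4
  have e (s t : g) : F s t = β s t := rfl
  simp_rw [e]
  have l : ∀ b, β (T b) ⁅u, T b⁆ = ∑ c, γ ⁅u, T b⁆ (T c) • β (T b) (T c) := fun b => by
    rw [h.sum_smul_map (β (T b))]
  have r : ∀ b, β ⁅u, T b⁆ (T b) = ∑ c, γ ⁅u, T b⁆ (T c) • β (T c) (T b) := fun b => by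
    exact (h.sum_smul_map (β.flip (T b)) ⁅u, T b⁆).symm
  simp_rw [l, r]
  rw [Finset.sum_comm, ← Finset.sum_neg_distrib]
  refine Finset.sum_congr rfl fun c _ => ?_
  rw [← Finset.sum_neg_distrib]
  refine Finset.sum_congr rfl fun b _ => ?_
  -- This is the sign: the matrix of `ad u` in an orthonormal basis is skew.
  rw [h.lie_skew_left, h.metric.symm, neg_smul]

theorem contract_mul (h : IsMetricBasis γ T) {B : Type*} [Ring B] [Algebra ℂ B]
    (A A' : g →ₗ[ℝ] B) (u : g) :
    ∑ b, A (T b) * A' ⁅u, T b⁆ = - ∑ b, A ⁅u, T b⁆ * A' (T b) :=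
  h.contract_lie (fun s t => A s * A' t) (by simp [add_mul]) (by simp)
    (by simp [mul_add]) (by simp) u

end IsMetricBasis

/-! ### Equivariant pairs, and the ingredients of the coproduct -/

/-- A Lie homomorphism `q` to an associative algebra, and a linear map `J` equivariant for it. -/
structure IsEquivariantPair {g : Type*} [LieRing g] [LieAlgebra ℝ g] {B : Type*} [Ring B]
    [Algebra ℂ B] (q J : g →ₗ[ℝ] B) : Prop where
  lie_q : ∀ x y, q ⁅x, y⁆ = q x * q y - q y * q x
  lie_J : ∀ x y, J ⁅x, y⁆ = q x * J y - J y * q x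

/-- Two equivariant pairs which commute with each other. -/
structure IsCommutingPair {g : Type*} [LieRing g] [LieAlgebra ℝ g] {B : Type*} [Ring B]
    [Algebra ℂ B] (X JX Y JY : g →ₗ[ℝ] B) : Prop where
  left : IsEquivariantPair X JX
  right : IsEquivariantPair Y JY
  comm_q : ∀ x y, Y y * X x = X x * Y y
  comm_qJ : ∀ x y, JY y * X x = X x * JY y
  comm_Jq : ∀ x y, Y y * JX x = JX x * Y y
  comm_J : ∀ x y, JY y * JX x = JX x * JY y

section Coproduct

variable {g : Type*} [LieRing g] [LieAlgebra ℝ g] {B : Type*} [Ring B] [Algebra ℂ B]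
  {ι : Type*} [Fintype ι]

/-- The cubic expression on the right of the Serre relation. -/
noncomputable def serreCubic (γ : LinearMap.BilinForm ℝ g) (T : Module.Basis ι ℝ g)
    (q : g →ₗ[ℝ] B) (x y z : g) : B :=
  ∑ a, ∑ b, ∑ c, γ ⁅x, T a⁆ ⁅⁅y, T b⁆, ⁅z, T c⁆⁆ • symm3 (q (T a)) (q (T b)) (q (T c))

/-- `u ↦ [1 ⊗ u, Ω]` for the canonical tensor `Ω`. -/
noncomputable def omegaBracket (T : Module.Basis ι ℝ g) (X Y : g →ₗ[ℝ] B) : g →ₗ[ℝ] B where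
  toFun u := ∑ b, X (T b) * Y ⁅u, T b⁆
  map_add' u v := by simp [mul_add, Finset.sum_add_distrib]
  map_smul' r u := by simp [Finset.smul_sum]

theorem omegaBracket_apply (T : Module.Basis ι ℝ g) (X Y : g →ₗ[ℝ] B) (u : g) :
    omegaBracket T X Y u = ∑ b, X (T b) * Y ⁅u, T b⁆ := rfl

/-- The coproduct of `J`. -/
noncomputable def coprodJ (T : Module.Basis ι ℝ g) (X JX Y JY : g →ₗ[ℝ] B) : g →ₗ[ℝ] B :=
  JX + JY + (1 / 2 : ℝ) • omegaBracket T X Y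

/-- A double contraction with a Jordan product of `A` and one `A'`. -/
noncomputable def jordanContract (T : Module.Basis ι ℝ g) (A A' : g →ₗ[ℝ] B)
    (φ : g → g → g) : B :=
  ∑ b, ∑ c, (A (T b) * A (T c) + A (T c) * A (T b)) * A' (φ (T b) (T c))

/-- The Jordan product is symmetric in `b` and `c`, so it only sees the symmetric part of `φ`. -/
theorem jordanContract_congr (T : Module.Basis ι ℝ g) (A A' : g →ₗ[ℝ] B) (φ ψ : g → g → g)
    (h : ∀ b c, φ b c + φ c b = ψ b c + ψ c b) :
    jordanContract T A A' φ = jordanContract T A A' ψ := by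
  have key (φ : g → g → g) : (2 : ℝ) • jordanContract T A A' φ =
      ∑ b, ∑ c, (A (T b) * A (T c) + A (T c) * A (T b)) *
        A' (φ (T b) (T c) + φ (T c) (T b)) := by
    rw [two_smul]
    nth_rewrite 2 [jordanContract]
    rw [Finset.sum_comm, jordanContract]
    simp_rw [← Finset.sum_add_distrib, map_add, mul_add]
    refine Finset.sum_congr rfl fun b _ => Finset.sum_congr rfl fun c _ => ?_
    rw [add_comm (A (T c) * A (T b))]
  have := (key φ).trans ((by simp_rw [h]) : _ = _) |>.trans (key ψ).symm
  exact smul_right_injective B (two_ne_zero (α := ℝ)) this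

theorem jordanContract_add (T : Module.Basis ι ℝ g) (A A' : g →ₗ[ℝ] B) (φ ψ : g → g → g) :
    jordanContract T A A' (fun b c => φ b c + ψ b c) =
      jordanContract T A A' φ + jordanContract T A A' ψ := by
  simp [jordanContract, mul_add, Finset.sum_add_distrib]

/-- The left side arises from the cyclic sum of `[θ x, θ [y, z]]`, the right side from the mixed
terms of the cubic. The proof matches them after symmetrising in `b` and `c`, which is all that
`jordanContract_congr` needs: Jacobi turns every term into a bracket of some `[·, ·]` with some `[·,
[·, ·]]`. -/
theorem lie_identity (x y z b c : g) :
    let L := fun b c : g => ⁅⁅x, b⁆, ⁅⁅y, z⁆, c⁆⁆ + ⁅⁅y, b⁆, ⁅⁅z, x⁆, c⁆⁆ + ⁅⁅z, b⁆, ⁅⁅x, y⁆, c⁆⁆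
    let R := fun b c : g => ⁅⁅⁅x, b⁆, ⁅y, c⁆⁆, z⁆ + -⁅⁅⁅x, b⁆, ⁅z, c⁆⁆, y⁆ + ⁅⁅⁅y, b⁆, ⁅z, c⁆⁆, x⁆
    L b c + L c b = R b c + R c b := by
  intro L R
  have e (y z c : g) : ⁅⁅y, z⁆, c⁆ = ⁅y, ⁅z, c⁆⁆ - ⁅z, ⁅y, c⁆⁆ := lie_lie y z c
  have s (u v w : g) : ⁅⁅u, v⁆, w⁆ = ⁅u, ⁅v, w⁆⁆ - ⁅v, ⁅u, w⁆⁆ := lie_lie u v w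
  simp only [L, R]
  rw [e y z c, e z x c, e x y c, e y z b, e z x b, e x y b]
  rw [s ⁅x, b⁆ ⁅y, c⁆ z, s ⁅x, b⁆ ⁅z, c⁆ y, s ⁅y, b⁆ ⁅z, c⁆ x,
    s ⁅x, c⁆ ⁅y, b⁆ z, s ⁅x, c⁆ ⁅z, b⁆ y, s ⁅y, c⁆ ⁅z, b⁆ x]
  have k (u v w : g) : ⁅u, ⁅w, v⁆⁆ = - ⁅u, ⁅v, w⁆⁆ := by rw [← lie_skew v w, lie_neg, neg_neg]
  simp only [lie_sub, k _ z ⁅x, b⁆, k _ z ⁅x, c⁆, k _ z ⁅y, b⁆, k _ z ⁅y, c⁆, k _ y ⁅x, b⁆,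
    k _ y ⁅x, c⁆, k _ y ⁅z, b⁆, k _ y ⁅z, c⁆, k _ x ⁅z, b⁆, k _ x ⁅z, c⁆, k _ x ⁅y, b⁆,
    k _ x ⁅y, c⁆]
  abel

/-- When the lone factor of a mixed term is moved to the end, each order of the other two occurs in
three of the six permutations; hence the coefficient `3/6 = 1/2`. -/
theorem symm3_add (x₁ x₂ x₃ y₁ y₂ y₃ : B)
    (h : ∀ x ∈ ({x₁, x₂, x₃} : Set B), ∀ y ∈ ({y₁, y₂, y₃} : Set B), y * x = x * y) :
    symm3 (x₁ + y₁) (x₂ + y₂) (x₃ + y₃) = symm3 x₁ x₂ x₃ + symm3 y₁ y₂ y₃ + (1 / 2 : ℝ) •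
      ((x₁ * x₂ + x₂ * x₁) * y₃ + (x₁ * x₃ + x₃ * x₁) * y₂ + (x₂ * x₃ + x₃ * x₂) * y₁
        + ((y₁ * y₂ + y₂ * y₁) * x₃ + (y₁ * y₃ + y₃ * y₁) * x₂ + (y₂ * y₃ + y₃ * y₂) * x₁)) := by
  simp only [Set.mem_insert_iff, Set.mem_singleton_iff, forall_eq_or_imp, forall_eq] at h
  obtain ⟨⟨a1, a2, a3⟩, ⟨b1, b2, b3⟩, c1, c2, c3⟩ := h
  have r (a b c d : B) (h : a * b = c * d) (m : B) : a * (b * m) = c * (d * m) := by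
    rw [← mul_assoc, h, mul_assoc]
  have hs (m : B) : (1 / 2 : ℝ) • m = (1 / 6 : ℂ) • (3 • m) := by
    rw [← Complex.coe_smul, ← Nat.cast_smul_eq_nsmul ℂ, smul_smul]; norm_num
  rw [symm3, symm3, symm3, hs, ← smul_add, ← smul_add]
  congr 1
  simp only [mul_add, add_mul, mul_assoc, a1, a2, a3, b1, b2, b3, c1, c2, c3, r _ _ _ _ a1,
    r _ _ _ _ a2, r _ _ _ _ a3, r _ _ _ _ b1, r _ _ _ _ b2, r _ _ _ _ b3, r _ _ _ _ c1,
    r _ _ _ _ c2, r _ _ _ _ c3]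
  abel

end Coproduct
-- The Serre relation for the coproduct
section Serre

variable {g : Type*} [LieRing g] [LieAlgebra ℝ g] {B : Type*} [Ring B] [Algebra ℂ B]
  {ι : Type*} [Fintype ι] {γ : LinearMap.BilinForm ℝ g} {T : Module.Basis ι ℝ g}
  {X JX Y JY : g →ₗ[ℝ] B}

theorem IsCommutingPair.comm_q' (h : IsCommutingPair X JX Y JY) (x y : g) (m : B) :
    Y y * (X x * m) = X x * (Y y * m) := by
  rw [← mul_assoc, h.comm_q, mul_assoc]

/-- Invariance of `Ω`: bracketing it with `X u` instead of `Y u` reverses the sign. -/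
theorem IsCommutingPair.omegaBracket_swap (h : IsCommutingPair X JX Y JY)
    (hT : IsMetricBasis γ T) (u : g) : omegaBracket T Y X u = - omegaBracket T X Y u := by
  rw [omegaBracket_apply, omegaBracket_apply, hT.contract_mul, neg_inj]
  exact Finset.sum_congr rfl fun b _ => h.comm_q _ _

theorem IsCommutingPair.swap (h : IsCommutingPair X JX Y JY) : IsCommutingPair Y JY X JX where
  left := h.right
  right := h.left
  comm_q x y := (h.comm_q y x).symm
  comm_qJ x y := (h.comm_Jq y x).symm
  comm_Jq x y := (h.comm_qJ y x).symm
  comm_J x y := (h.comm_J y x).symm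

/-- Twice the commutator `[θ x, θ w]`. -/
theorem two_smul_lie_omegaBracket (hT : IsMetricBasis γ T) (h : IsCommutingPair X JX Y JY)
    (x w : g) : (2 : ℝ) • ⁅omegaBracket T X Y x, omegaBracket T X Y w⁆ =
      jordanContract T X Y (fun b c => ⁅⁅x, b⁆, ⁅w, c⁆⁆) +
      jordanContract T Y X (fun b c => ⁅⁅x, b⁆, ⁅w, c⁆⁆) := by
  -- Tensor form of the identity `2(ab·cd - ba·dc) = (ab + ba)[c, d] + [a, b](cd + dc)`, where `a,
  -- b` commute with `c, d`.
  have step : (2 : ℝ) • ⁅omegaBracket T X Y x, omegaBracket T X Y w⁆ =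
      jordanContract T X Y (fun b c => ⁅⁅x, b⁆, ⁅w, c⁆⁆) +
      ∑ b, ∑ c, (Y ⁅x, T b⁆ * Y ⁅w, T c⁆ + Y ⁅w, T c⁆ * Y ⁅x, T b⁆) * X ⁅T b, T c⁆ := by
    simp only [omegaBracket_apply, Ring.lie_def, Finset.sum_mul_sum, jordanContract]
    rw [Finset.sum_comm (s := Finset.univ (α := ι))
      (f := fun i j => X (T i) * Y ⁅w, T i⁆ * (X (T j) * Y ⁅x, T j⁆))]
    simp only [← Finset.sum_sub_distrib, ← Finset.sum_add_distrib, Finset.smul_sum]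
    refine Finset.sum_congr rfl fun b _ => Finset.sum_congr rfl fun c _ => ?_
    rw [h.left.lie_q, h.right.lie_q ⁅x, T b⁆]
    simp only [mul_add, mul_sub, add_mul, sub_mul, mul_assoc, h.comm_q, h.comm_q', two_smul]
    abel
  rw [step, add_right_inj]
  -- Two integrations by parts, along `x` here and along `w` in `c2`, move the brackets off the
  -- symmetrised `Y`-factors onto the arguments of `X`; the two signs cancel.
  have c1 (c : ι) := hT.contract_lie
    (fun s t => (Y t * Y ⁅w, T c⁆ + Y ⁅w, T c⁆ * Y t) * X ⁅s, T c⁆)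
    (by intros; simp [add_lie, mul_add])
    (by intros; simp) (by intros; simp [mul_add, add_mul]; abel) (by intros; simp [mul_add, add_mul]) x
  rw [Finset.sum_comm]
  simp_rw [c1]
  rw [Finset.sum_neg_distrib, Finset.sum_comm, jordanContract]
  have c2 (b : ι) := hT.contract_lie
    (fun s t => (Y (T b) * Y t + Y t * Y (T b)) * X ⁅⁅x, T b⁆, s⁆)
    (by intros; simp [lie_add, mul_add])
    (by intros; simp) (by intros; simp [mul_add, add_mul]; abel) (by intros; simp [mul_add, add_mul]) w
  simp_rw [c2]
  simp

/-- The coproduct of the cubic expression. -/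
theorem serreCubic_add (hT : IsMetricBasis γ T) (h : IsCommutingPair X JX Y JY) (x y z : g) :
    let R := fun b c : g => ⁅⁅⁅x, b⁆, ⁅y, c⁆⁆, z⁆ + -⁅⁅⁅x, b⁆, ⁅z, c⁆⁆, y⁆ + ⁅⁅⁅y, b⁆, ⁅z, c⁆⁆, x⁆
    serreCubic γ T (X + Y) x y z = serreCubic γ T X x y z + serreCubic γ T Y x y z +
      (1 / 2 : ℝ) • (jordanContract T X Y R + jordanContract T Y X R) := by
  intro R
  -- The three terms of `R` come from the lone `Y` carrying the index `c`, `b` or `a`. Contracting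
  -- that index and using invariance puts the remaining brackets inside `Y`.
  have mixed (X Y : g →ₗ[ℝ] B) : jordanContract T X Y R = ∑ a, ∑ b, ∑ c,
      γ ⁅x, T a⁆ ⁅⁅y, T b⁆, ⁅z, T c⁆⁆ • ((X (T a) * X (T b) + X (T b) * X (T a)) * Y (T c)
        + (X (T a) * X (T c) + X (T c) * X (T a)) * Y (T b)
        + (X (T b) * X (T c) + X (T c) * X (T b)) * Y (T a)) := by
    simp only [R, jordanContract_add, smul_add, Finset.sum_add_distrib]
    congr 1
    · congr 1
      · refine Finset.sum_congr rfl fun a _ => Finset.sum_congr rfl fun b _ => ?_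
        rw [← hT.sum_smul_map Y, Finset.mul_sum]
        refine Finset.sum_congr rfl fun c _ => ?_
        rw [mul_smul_comm, hT.metric.invariant ⁅⁅x, T a⁆, ⁅y, T b⁆⁆, hT.metric.invariant ⁅x, T a⁆]
      · refine Finset.sum_congr rfl fun a _ => ?_
        rw [Finset.sum_comm]
        refine Finset.sum_congr rfl fun c _ => ?_
        rw [← hT.sum_smul_map Y, Finset.mul_sum]
        refine Finset.sum_congr rfl fun b _ => ?_
        rw [mul_smul_comm, map_neg, LinearMap.neg_apply, hT.metric.invariant ⁅⁅x, T a⁆, ⁅z, T c⁆⁆,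
          hT.metric.invariant ⁅x, T a⁆, ← lie_skew ⁅y, T b⁆, map_neg]
    · rw [Finset.sum_comm]
      refine Finset.sum_congr rfl fun b _ => ?_
      rw [Finset.sum_comm]
      refine Finset.sum_congr rfl fun c _ => ?_
      rw [← hT.sum_smul_map Y, Finset.mul_sum]
      refine Finset.sum_congr rfl fun a _ => ?_
      rw [mul_smul_comm, hT.metric.invariant _ x, hT.metric.symm]
  rw [mixed, mixed]
  simp only [serreCubic, Finset.smul_sum, ← Finset.sum_add_distrib, ← smul_add]
  refine Finset.sum_congr rfl fun a _ => Finset.sum_congr rfl fun b _ =>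
    Finset.sum_congr rfl fun c _ => ?_
  rw [LinearMap.add_apply, LinearMap.add_apply, LinearMap.add_apply, symm3_add, smul_add,
    smul_comm (1 / 2 : ℝ)]
  intro u hu v hv
  simp only [Set.mem_insert_iff, Set.mem_singleton_iff] at hu hv
  rcases hu with rfl | rfl | rfl <;> rcases hv with rfl | rfl | rfl <;> exact h.comm_q _ _

/-- Only `θ` needs an argument: it is equivariant because `Ω` is invariant under the diagonal
action. -/
theorem IsCommutingPair.add_equivariant (hT : IsMetricBasis γ T)
    (h : IsCommutingPair X JX Y JY) :
    IsEquivariantPair (X + Y) (coprodJ T X JX Y JY) where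
  lie_q x y := by
    simp only [LinearMap.add_apply, h.left.lie_q, h.right.lie_q, mul_add, add_mul, h.comm_q]
    abel
  lie_J x y := by
    have hθ : omegaBracket T X Y ⁅x, y⁆ = (X x + Y x) * omegaBracket T X Y y -
        omegaBracket T X Y y * (X x + Y x) := by
      have e : (X x + Y x) * omegaBracket T X Y y - omegaBracket T X Y y * (X x + Y x) =
          ∑ b, X ⁅x, T b⁆ * Y ⁅y, T b⁆ + ∑ b, X (T b) * Y ⁅x, ⁅y, T b⁆⁆ := by
        simp only [omegaBracket_apply, Finset.mul_sum, Finset.sum_mul, ← Finset.sum_sub_distrib,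
          ← Finset.sum_add_distrib]
        refine Finset.sum_congr rfl fun b _ => ?_
        rw [h.left.lie_q, h.right.lie_q x]
        simp only [mul_add, mul_sub, add_mul, sub_mul, mul_assoc, h.comm_q, h.comm_q']
        abel
      have c := hT.contract_mul X (Y ∘ₗ (LieAlgebra.ad ℝ g y : g →ₗ[ℝ] g)) x
      simp only [LinearMap.comp_apply, LieAlgebra.ad_apply] at c
      rw [e, ← neg_eq_iff_eq_neg.mpr c, neg_add_eq_sub, ← Finset.sum_sub_distrib, omegaBracket_apply]
      refine Finset.sum_congr rfl fun b _ => ?_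
      rw [lie_lie, map_sub, mul_sub]
    simp only [coprodJ, LinearMap.add_apply, LinearMap.smul_apply, hθ, h.left.lie_J,
      h.right.lie_J, mul_add, add_mul, h.comm_qJ, h.comm_Jq, smul_sub, smul_add, smul_mul_assoc,
      mul_smul_comm]
    abel

/-- The commutator of the coproducts of `J x` and `J w`. -/
theorem lie_coprodJ (hT : IsMetricBasis γ T) (h : IsCommutingPair X JX Y JY) (x w : g) :
    ⁅coprodJ T X JX Y JY x, coprodJ T X JX Y JY w⁆ = ⁅JX x, JX w⁆ + ⁅JY x, JY w⁆
      + (1 / 2 : ℝ) • (omegaBracket T JX Y ⁅x, w⁆ + omegaBracket T X JY ⁅x, w⁆)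
      + (1 / 4 : ℝ) • ⁅omegaBracket T X Y x, omegaBracket T X Y w⁆ := by
  have cJ (a b : g) (m : B) : JY a * (X b * m) = X b * (JY a * m) := by
    rw [← mul_assoc, h.comm_qJ, mul_assoc]
  -- Both this and `hR` depend on `x` and `w` only through `⁅x, w⁆`. Here `JX` acts on the left leg
  -- and integration by parts is needed; in `hR` the action is already on the right leg and Jacobi
  -- suffices.
  have hL : ⁅JX x, omegaBracket T X Y w⁆ + ⁅omegaBracket T X Y x, JX w⁆ =
      omegaBracket T JX Y ⁅x, w⁆ := by
    have e : ⁅JX x, omegaBracket T X Y w⁆ + ⁅omegaBracket T X Y x, JX w⁆ =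
        ∑ b, JX ⁅x, T b⁆ * Y ⁅w, T b⁆ - ∑ b, JX ⁅w, T b⁆ * Y ⁅x, T b⁆ := by
      simp only [omegaBracket_apply, Ring.lie_def, Finset.mul_sum, Finset.sum_mul,
        ← Finset.sum_sub_distrib, ← Finset.sum_add_distrib]
      refine Finset.sum_congr rfl fun b _ => ?_
      have e1 (x : g) : JX ⁅x, T b⁆ = JX x * X (T b) - X (T b) * JX x := by
        rw [← lie_skew, map_neg, h.left.lie_J, neg_sub]
      rw [e1, e1]
      simp only [sub_mul, mul_assoc, h.comm_Jq]
      abel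
    have c (x w : g) := hT.contract_mul JX (Y ∘ₗ (LieAlgebra.ad ℝ g w : g →ₗ[ℝ] g)) x
    simp only [LinearMap.comp_apply, LieAlgebra.ad_apply] at c
    rw [e, ← neg_eq_iff_eq_neg.mpr (c x w), ← neg_eq_iff_eq_neg.mpr (c w x), omegaBracket_apply]
    simp only [lie_lie, map_sub, mul_sub, Finset.sum_sub_distrib]
    abel
  have hR : ⁅JY x, omegaBracket T X Y w⁆ + ⁅omegaBracket T X Y x, JY w⁆ =
      omegaBracket T X JY ⁅x, w⁆ := by
    simp only [omegaBracket_apply, Ring.lie_def, Finset.mul_sum, Finset.sum_mul,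
      ← Finset.sum_sub_distrib, ← Finset.sum_add_distrib]
    refine Finset.sum_congr rfl fun b _ => ?_
    rw [lie_lie, ← lie_skew x ⁅w, T b⁆, ← lie_skew w ⁅x, T b⁆, map_sub, map_neg, map_neg,
      h.right.lie_J, h.right.lie_J]
    simp only [mul_sub, mul_neg, mul_assoc, cJ]
    abel
  rw [← hL, ← hR]
  have h1 : JX x * JY w = JY w * JX x := (h.comm_J _ _).symm
  have h2 : JX w * JY x = JY x * JX w := (h.comm_J _ _).symm
  simp only [coprodJ, LinearMap.add_apply, LinearMap.smul_apply, Ring.lie_def, mul_add, add_mul,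
    smul_mul_assoc, mul_smul_comm, h1, h2]
  module

/-- The Serre relation for `q` and `J`, in basis-free form. -/
def SerreRelation (γ : LinearMap.BilinForm ℝ g) (T : Module.Basis ι ℝ g)
    (q J : g →ₗ[ℝ] B) (x y z : g) : Prop :=
  ⁅J x, J ⁅y, z⁆⁆ + ⁅J y, J ⁅z, x⁆⁆ + ⁅J z, J ⁅x, y⁆⁆ = (1 / 4 : ℝ) • serreCubic γ T q x y z

/-- The terms linear in `J` are a linear map evaluated at a Jacobi sum, hence zero. What remains is
a quarter of the cyclic sum of `[θ, θ]`, which is a quarter of the mixed part of the cubic. -/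
theorem SerreRelation.coprod (hT : IsMetricBasis γ T) (h : IsCommutingPair X JX Y JY)
    {x y z : g} (hX : SerreRelation γ T X JX x y z) (hY : SerreRelation γ T Y JY x y z) :
    SerreRelation γ T (X + Y) (coprodJ T X JX Y JY) x y z := by
  rw [SerreRelation] at hX hY ⊢
  have jac : ⁅x, ⁅y, z⁆⁆ + ⁅y, ⁅z, x⁆⁆ + ⁅z, ⁅x, y⁆⁆ = 0 := lie_jacobi x y z
  have hJ (A A' : g →ₗ[ℝ] B) : omegaBracket T A A' ⁅x, ⁅y, z⁆⁆ + omegaBracket T A A' ⁅y, ⁅z, x⁆⁆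
      + omegaBracket T A A' ⁅z, ⁅x, y⁆⁆ = 0 := by
    rw [← map_add, ← map_add, jac, map_zero]
  have hθ : (2 : ℝ) • (⁅omegaBracket T X Y x, omegaBracket T X Y ⁅y, z⁆⁆
      + ⁅omegaBracket T X Y y, omegaBracket T X Y ⁅z, x⁆⁆
      + ⁅omegaBracket T X Y z, omegaBracket T X Y ⁅x, y⁆⁆) =
      jordanContract T X Y (fun b c => ⁅⁅⁅x, b⁆, ⁅y, c⁆⁆, z⁆ + -⁅⁅⁅x, b⁆, ⁅z, c⁆⁆, y⁆
        + ⁅⁅⁅y, b⁆, ⁅z, c⁆⁆, x⁆) +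
      jordanContract T Y X (fun b c => ⁅⁅⁅x, b⁆, ⁅y, c⁆⁆, z⁆ + -⁅⁅⁅x, b⁆, ⁅z, c⁆⁆, y⁆
        + ⁅⁅⁅y, b⁆, ⁅z, c⁆⁆, x⁆) := by
    rw [← jordanContract_congr T X Y _ _ fun b c => lie_identity x y z b c,
      ← jordanContract_congr T Y X _ _ fun b c => lie_identity x y z b c]
    simp only [smul_add, two_smul_lie_omegaBracket hT h, jordanContract_add]
    abel
  have h4 : (1 / 2 : ℝ) • (jordanContract T X Y (fun b c => ⁅⁅⁅x, b⁆, ⁅y, c⁆⁆, z⁆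
        + -⁅⁅⁅x, b⁆, ⁅z, c⁆⁆, y⁆ + ⁅⁅⁅y, b⁆, ⁅z, c⁆⁆, x⁆) +
      jordanContract T Y X (fun b c => ⁅⁅⁅x, b⁆, ⁅y, c⁆⁆, z⁆ + -⁅⁅⁅x, b⁆, ⁅z, c⁆⁆, y⁆
        + ⁅⁅⁅y, b⁆, ⁅z, c⁆⁆, x⁆)) = ⁅omegaBracket T X Y x, omegaBracket T X Y ⁅y, z⁆⁆
      + ⁅omegaBracket T X Y y, omegaBracket T X Y ⁅z, x⁆⁆
      + ⁅omegaBracket T X Y z, omegaBracket T X Y ⁅x, y⁆⁆ := by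
    rw [← hθ, smul_smul]; norm_num
  rw [serreCubic_add hT h, lie_coprodJ hT h, lie_coprodJ hT h, lie_coprodJ hT h]
  linear_combination (norm := module) (1 / 2 : ℝ) • hJ JX Y + (1 / 2 : ℝ) • hJ X JY + hX
    + hY - (1 / 4 : ℝ) • h4

end Serre
-- Dimension three: Drinfeld's relation as a quadratic identity
section ThreeDim

variable {g : Type*} [LieRing g] [LieAlgebra ℝ g] {B : Type*} [Ring B] [Algebra ℂ B]
  {ι : Type*} [Fintype ι] {γ : LinearMap.BilinForm ℝ g} {T : Module.Basis ι ℝ g}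

/-- The triple bracket of a three-dimensional Lie algebra with invariant metric, for which
`f = κ ε` with `κ² = r`. -/
structure IsCrossProduct (γ : LinearMap.BilinForm ℝ g) (T : Module.Basis ι ℝ g) (r : ℝ) :
    Prop where
  ne_zero : r ≠ 0
  card : Fintype.card ι = 3
  lie_lie : ∀ a b d : g, ⁅⁅a, b⁆, d⁆ = r • (γ a d • b - γ b d • a)

/-- The quadratic Casimir element. -/
noncomputable def casimirSum (T : Module.Basis ι ℝ g) (q : g →ₗ[ℝ] B) : B := ∑ b, q (T b) * q (T b)

/-- `J` and `K` with `K [a, b] = [J a, J b]`. -/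
def IsLieLift (J K : g →ₗ[ℝ] B) : Prop := ∀ a b, K ⁅a, b⁆ = J a * J b - J b * J a

/-- The right side of Drinfeld's relation, polarised. -/
noncomputable def sl2Form (T : Module.Basis ι ℝ g) (q J : g →ₗ[ℝ] B) (u v : g) : B :=
  ∑ b, symm3 (q u) (q (T b)) (J ⁅T b, v⁆)

/-- Drinfeld's additional relation for `sl(2)`, in quadratic form. -/
def Sl2Quadratic (T : Module.Basis ι ℝ g) (r : ℝ) (q J K : g →ₗ[ℝ] B) : Prop :=
  ∀ u, K u * J u - J u * K u =
    (r / 8) • (q u * (casimirSum T q * J u - J u * casimirSum T q))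

/-- Drinfeld's additional relation for `sl(2)`. -/
def Sl2Relation (γ : LinearMap.BilinForm ℝ g) (T : Module.Basis ι ℝ g) (q J : g →ₗ[ℝ] B)
    (x y z w : g) : Prop :=
  ⁅⁅J x, J y⁆, J ⁅z, w⁆⁆ + ⁅⁅J z, J w⁆, J ⁅x, y⁆⁆ =
    (1 / 4 : ℝ) • ∑ a, ∑ b, ∑ c, (γ ⁅x, T a⁆ ⁅⁅y, T b⁆, ⁅⁅z, w⁆, T c⁆⁆
      + γ ⁅z, T a⁆ ⁅⁅w, T b⁆, ⁅⁅x, y⁆, T c⁆⁆) • symm3 (q (T a)) (q (T b)) (J (T c))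

theorem symm3_swap (x y z : B) : symm3 y x z = symm3 x y z := by
  simp only [symm3]; congr 1; abel

theorem symm3_add_left (x x' y z : B) : symm3 (x + x') y z = symm3 x y z + symm3 x' y z := by
  simp only [symm3, add_mul, mul_add, ← smul_add]; congr 1; abel

theorem symm3_add_right (x y z z' : B) : symm3 x y (z + z') = symm3 x y z + symm3 x y z' := by
  simp only [symm3, add_mul, mul_add, ← smul_add]; congr 1; abel

theorem symm3_smul_left (c : ℝ) (x y z : B) : symm3 (c • x) y z = c • symm3 x y z := by
  simp only [symm3, smul_mul_assoc, mul_smul_comm, ← smul_add, smul_comm c (1 / 6 : ℂ)]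

theorem symm3_smul_right (c : ℝ) (x y z : B) : symm3 x y (c • z) = c • symm3 x y z := by
  simp only [symm3, smul_mul_assoc, mul_smul_comm, ← smul_add, smul_comm c (1 / 6 : ℂ)]

/-- `symm3` as a linear map in its last argument. -/
noncomputable def symm3Right (x y : B) : B →ₗ[ℝ] B where
  toFun := symm3 x y
  map_add' := symm3_add_right x y
  map_smul' c := symm3_smul_right c x y

namespace IsCrossProduct

variable {r : ℝ}

/-- The Casimir of the adjoint representation is `r(1 - 3)`. As `r ≠ 0`, this writes every vector as
a combination of brackets, which is how `ext` tests linear maps on brackets only. -/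
theorem sum_lie_lie (hr : IsCrossProduct γ T r) (hT : IsMetricBasis γ T) (u : g) :
    ∑ b, ⁅⁅u, T b⁆, T b⁆ = (-2 * r) • u := by
  simp_rw [hr.lie_lie, hT.norm_one, ← Finset.smul_sum, Finset.sum_sub_distrib, hT.sum_smul]
  simp [hr.card]
  module

theorem ext (hr : IsCrossProduct γ T r) (hT : IsMetricBasis γ T) {M : Type*} [AddCommGroup M]
    [Module ℝ M] {A A' : g →ₗ[ℝ] M} (h : ∀ a b : g, A ⁅a, b⁆ = A' ⁅a, b⁆) : A = A' := by
  ext u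
  have h2 : A ((-2 * r) • u) = A' ((-2 * r) • u) := by
    rw [← hr.sum_lie_lie hT u, map_sum, map_sum]
    exact Finset.sum_congr rfl fun b _ => h _ _
  rw [map_smul, map_smul] at h2
  exact smul_right_injective M (mul_ne_zero (by norm_num) hr.ne_zero) h2

theorem ext_basis (hr : IsCrossProduct γ T r) (hT : IsMetricBasis γ T) {M : Type*}
    [AddCommGroup M] [Module ℝ M] {A A' : g →ₗ[ℝ] M}
    (h : ∀ a b, A ⁅T a, T b⁆ = A' ⁅T a, T b⁆) : A = A' := by
  refine hr.ext hT fun a b => ?_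
  have : (LieModule.toEnd ℝ g g : g →ₗ[ℝ] Module.End ℝ g).compr₂ A =
      (LieModule.toEnd ℝ g g : g →ₗ[ℝ] Module.End ℝ g).compr₂ A' :=
    T.ext fun i => T.ext fun j => by simpa using h i j
  simpa using congrArg (fun F => F a b) this

theorem lie_lie_symm (hr : IsCrossProduct γ T r) (hT : IsMetricBasis γ T) (a b s t : g) :
    ⁅⁅a, s⁆, ⁅b, t⁆⁆ + ⁅⁅a, t⁆, ⁅b, s⁆⁆ = r • (γ ⁅a, b⁆ t • s + γ ⁅a, b⁆ s • t) := by
  rw [hr.lie_lie, hr.lie_lie, hT.metric.invariant, hT.metric.invariant, hT.metric.symm s,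
    hT.lie_skew_left b t s, hT.metric.symm t ⁅b, s⁆]
  module

/-- Contracting `c` puts the three brackets inside `J`. Since `symm3` is symmetric in its first two
slots, only the part symmetric in `a, b` counts; there `lie_lie_symm` leaves a factor `γ ⁅x, y⁆`,
which collapses one more sum. -/
theorem sl2Form_eq (hr : IsCrossProduct γ T r) (hT : IsMetricBasis γ T) (q J : g →ₗ[ℝ] B)
    (x y v : g) :
    ∑ a, ∑ b, ∑ c, γ ⁅x, T a⁆ ⁅⁅y, T b⁆, ⁅v, T c⁆⁆ • symm3 (q (T a)) (q (T b)) (J (T c)) =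
      r • sl2Form T q J ⁅x, y⁆ v := by
  have e1 : ∑ a, ∑ b, ∑ c, γ ⁅x, T a⁆ ⁅⁅y, T b⁆, ⁅v, T c⁆⁆ • symm3 (q (T a)) (q (T b)) (J (T c))
      = ∑ a, ∑ b, symm3 (q (T a)) (q (T b)) (J ⁅⁅⁅x, T a⁆, ⁅y, T b⁆⁆, v⁆) := by
    refine Finset.sum_congr rfl fun a _ => Finset.sum_congr rfl fun b _ => ?_
    refine Eq.trans (Finset.sum_congr rfl fun c _ => ?_)
      (hT.sum_smul_map (symm3Right (q (T a)) (q (T b)) ∘ₗ J) ⁅⁅⁅x, T a⁆, ⁅y, T b⁆⁆, v⁆)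
    rw [hT.metric.invariant ⁅⁅x, T a⁆, ⁅y, T b⁆⁆, hT.metric.invariant ⁅x, T a⁆]
    rfl
  have e2 (a b : ι) : symm3 (q (T a)) (q (T b)) (J ⁅⁅⁅x, T a⁆, ⁅y, T b⁆⁆, v⁆)
      + symm3 (q (T b)) (q (T a)) (J ⁅⁅⁅x, T b⁆, ⁅y, T a⁆⁆, v⁆) =
      r • (γ ⁅x, y⁆ (T b) • symm3 (q (T b)) (q (T a)) (J ⁅T a, v⁆)
        + γ ⁅x, y⁆ (T a) • symm3 (q (T a)) (q (T b)) (J ⁅T b, v⁆)) := by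
    rw [symm3_swap (q (T a)) (q (T b)), ← symm3_add_right, ← map_add, ← add_lie,
      hr.lie_lie_symm hT]
    simp only [smul_lie, add_lie, map_smul, map_add, symm3_add_right, symm3_smul_right]
    rw [symm3_swap (q (T a)) (q (T b))]
  have e3 (b : ι) : ∑ a, γ ⁅x, y⁆ (T a) • symm3 (q (T a)) (q (T b)) (J ⁅T b, v⁆) =
      symm3 (q ⁅x, y⁆) (q (T b)) (J ⁅T b, v⁆) := by
    let A : g →ₗ[ℝ] B :=
      { toFun := fun s => symm3 (q s) (q (T b)) (J ⁅T b, v⁆)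
        map_add' := fun s t => by rw [map_add, symm3_add_left]
        map_smul' := fun c s => by rw [map_smul, symm3_smul_left]; rfl }
    exact hT.sum_smul_map A _
  rw [e1]
  apply smul_right_injective B (two_ne_zero (α := ℝ))
  simp only [two_smul]
  nth_rewrite 2 [Finset.sum_comm]
  simp only [← Finset.sum_add_distrib]
  simp_rw [e2]
  simp only [smul_add, Finset.sum_add_distrib, ← Finset.smul_sum]
  rw [sl2Form]
  simp_rw [← e3]
  rw [Finset.sum_comm (s := Finset.univ (α := ι)) (t := Finset.univ (α := ι))
    (f := fun b a => γ ⁅x, y⁆ (T a) • symm3 (q (T a)) (q (T b)) (J ⁅T b, v⁆))]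
  congr 1
  simp only [Finset.smul_sum]

end IsCrossProduct

theorem symm3_eq_real (x y z : B) : symm3 x y z =
    (1 / 6 : ℝ) • (x * y * z + x * z * y + y * x * z + y * z * x + z * x * y + z * y * x) := by
  rw [symm3, ← Complex.coe_smul]; norm_num

theorem casimirSum_comm (hT : IsMetricBasis γ T) {q J : g →ₗ[ℝ] B} (h : IsEquivariantPair q J)
    (u : g) : casimirSum T q * q u = q u * casimirSum T q := by
  have e : q u * casimirSum T q - casimirSum T q * q u =
      ∑ b, q (T b) * q ⁅u, T b⁆ + ∑ b, q ⁅u, T b⁆ * q (T b) := by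
    simp only [casimirSum, Finset.mul_sum, Finset.sum_mul, ← Finset.sum_sub_distrib,
      ← Finset.sum_add_distrib]
    refine Finset.sum_congr rfl fun b _ => ?_
    rw [h.lie_q]
    noncomm_ring
  rw [hT.contract_mul, neg_add_cancel, sub_eq_zero] at e
  exact e.symm

/-- Commuting `q u` past `q (T b)` leaves `∑ q (T b) q ⁅u, T b⁆`. By parts this is half of a sum of
commutators, hence `-½` of the adjoint Casimir `-2r`. -/
theorem IsCrossProduct.sum_conj {r : ℝ} (hr : IsCrossProduct γ T r) (hT : IsMetricBasis γ T)
    {q J : g →ₗ[ℝ] B} (h : IsEquivariantPair q J) (u : g) :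
    ∑ b, q (T b) * q u * q (T b) = casimirSum T q * q u + r • q u := by
  have e1 : ∑ b, q (T b) * q u * q (T b) = casimirSum T q * q u + ∑ b, q (T b) * q ⁅u, T b⁆ := by
    simp only [casimirSum, Finset.sum_mul, ← Finset.sum_add_distrib]
    refine Finset.sum_congr rfl fun b _ => ?_
    rw [h.lie_q]
    noncomm_ring
  have e2 : (2 : ℝ) • ∑ b, q (T b) * q ⁅u, T b⁆ = (2 : ℝ) • r • q u := by
    rw [two_smul]
    nth_rewrite 2 [hT.contract_mul]
    rw [← sub_eq_add_neg, ← Finset.sum_sub_distrib]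
    have e3 (b : ι) : q (T b) * q ⁅u, T b⁆ - q ⁅u, T b⁆ * q (T b) = - q ⁅⁅u, T b⁆, T b⁆ := by
      rw [h.lie_q ⁅u, T b⁆, neg_sub]
    simp_rw [e3]
    rw [Finset.sum_neg_distrib, ← map_sum, hr.sum_lie_lie hT, map_smul]
    module
  rw [e1, smul_right_injective B (two_ne_zero (α := ℝ)) e2]

theorem IsEquivariantPair.comm_self {q J : g →ₗ[ℝ] B} (h : IsEquivariantPair q J) (u : g) :
    J u * q u = q u * J u := by
  rw [eq_comm, ← sub_eq_zero, ← h.lie_J, lie_self, map_zero]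

/-- On the diagonal `J u` commutes with `q u`, and `J ⁅T b, u⁆ = [q (T b), J u]`, so the symmetrised
product telescopes. Three of its six weights survive, giving `3/6`, and the shifts `r • q u` from
`sum_conj` cancel. -/
theorem IsCrossProduct.sl2Form_self {r : ℝ} (hr : IsCrossProduct γ T r)
    (hT : IsMetricBasis γ T) {q J : g →ₗ[ℝ] B} (h : IsEquivariantPair q J) (u : g) :
    sl2Form T q J u u =
      (1 / 2 : ℝ) • (q u * (casimirSum T q * J u - J u * casimirSum T q)) := by
  have hu := h.comm_self u
  have hu' (m : B) : J u * (q u * m) = q u * (J u * m) := by rw [← mul_assoc, hu, mul_assoc]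
  have hb (b : ι) : symm3 (q u) (q (T b)) (J ⁅T b, u⁆) = (1 / 6 : ℝ) •
      (q u * (q (T b) * q (T b)) * J u - q u * J u * (q (T b) * q (T b))
        + (q (T b) * q u * q (T b)) * J u - J u * (q (T b) * q u * q (T b))
        + (q (T b) * q (T b)) * (q u * J u) - J u * (q (T b) * q (T b)) * q u) := by
    rw [symm3_eq_real, h.lie_J]
    congr 1
    simp only [mul_sub, sub_mul, mul_assoc, hu, hu']
    abel
  have hC := casimirSum_comm hT h u
  have hC' (m : B) : casimirSum T q * (q u * m) = q u * (casimirSum T q * m) := by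
    rw [← mul_assoc, hC, mul_assoc]
  simp only [sl2Form, hb, ← Finset.smul_sum, Finset.sum_add_distrib, Finset.sum_sub_distrib,
    ← Finset.sum_mul, ← Finset.mul_sum, hr.sum_conj hT h]
  change (1 / 6 : ℝ) • (q u * casimirSum T q * J u - q u * J u * casimirSum T q
    + (casimirSum T q * q u + r • q u) * J u - J u * (casimirSum T q * q u + r • q u)
    + casimirSum T q * (q u * J u) - J u * casimirSum T q * q u) = _
  simp only [mul_sub, mul_add, add_mul, mul_assoc, hC, hC', hu, hu', smul_mul_assoc,
    mul_smul_comm]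
  module

/-- The bilinear form whose alternation is Drinfeld's relation. -/
noncomputable def sl2Defect (T : Module.Basis ι ℝ g) (r : ℝ) (q J K : g →ₗ[ℝ] B) :
    g →ₗ[ℝ] g →ₗ[ℝ] B :=
  LinearMap.mk₂ ℝ (fun u v => K u * J v - J v * K u - (r / 4) • sl2Form T q J u v)
    (fun u u' v => by
      simp only [sl2Form, map_add, symm3_add_left, Finset.sum_add_distrib, add_mul, mul_add]
      module)
    (fun c u v => by
      simp only [sl2Form, map_smul, symm3_smul_left, ← Finset.smul_sum, smul_mul_assoc,
        mul_smul_comm]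
      module)
    (fun u v v' => by
      simp only [sl2Form, map_add, lie_add, symm3_add_right, Finset.sum_add_distrib, add_mul,
        mul_add]
      module)
    (fun c u v => by
      simp only [sl2Form, map_smul, lie_smul, symm3_smul_right, ← Finset.smul_sum,
        smul_mul_assoc, mul_smul_comm]
      module)

theorem sl2Defect_apply (T : Module.Basis ι ℝ g) (r : ℝ) (q J K : g →ₗ[ℝ] B) (u v : g) :
    sl2Defect T r q J K u v = K u * J v - J v * K u - (r / 4) • sl2Form T q J u v := rfl

namespace IsCrossProduct

variable {r : ℝ}

/-- The constant `r/8` is `r/4` times the `1/2` of `sl2Form_self`. -/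
theorem sl2Quadratic_iff_defect (hr : IsCrossProduct γ T r) (hT : IsMetricBasis γ T)
    {q J K : g →ₗ[ℝ] B} (h : IsEquivariantPair q J) :
    Sl2Quadratic T r q J K ↔ ∀ u, sl2Defect T r q J K u u = 0 := by
  refine forall_congr' fun u => ?_
  rw [sl2Defect_apply, hr.sl2Form_self hT h, smul_smul, sub_eq_zero]
  ring_nf

/-- By `sl2Form_eq` the right side sees `x, y` and `z, w` only through their brackets, so the
relation is the symmetrised defect at two brackets. -/
theorem sl2Relation_iff_defect (hr : IsCrossProduct γ T r) (hT : IsMetricBasis γ T)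
    {q J K : g →ₗ[ℝ] B} (hK : IsLieLift J K) (x y z w : g) :
    Sl2Relation γ T q J x y z w ↔
      sl2Defect T r q J K ⁅x, y⁆ ⁅z, w⁆ + sl2Defect T r q J K ⁅z, w⁆ ⁅x, y⁆ = 0 := by
  rw [Sl2Relation, sl2Defect_apply, sl2Defect_apply, hK, hK, ← sub_eq_zero]
  simp only [add_smul, Finset.sum_add_distrib, hr.sl2Form_eq hT, Ring.lie_def]
  refine Eq.congr ?_ rfl
  module

/-- Brackets of basis vectors span `g`, so the symmetrised defect vanishes identically, in
particular on the diagonal. The converse below is polarisation. -/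
theorem sl2Quadratic_of_relation (hr : IsCrossProduct γ T r) (hT : IsMetricBasis γ T)
    {q J K : g →ₗ[ℝ] B} (h : IsEquivariantPair q J) (hK : IsLieLift J K)
    (hrel : ∀ a b c d, Sl2Relation γ T q J (T a) (T b) (T c) (T d)) :
    Sl2Quadratic T r q J K := by
  rw [hr.sl2Quadratic_iff_defect hT h]
  have hz : sl2Defect T r q J K + (sl2Defect T r q J K).flip = 0 := by
    refine hr.ext_basis hT fun a b => ?_
    refine hr.ext_basis hT fun c d => ?_
    simpa using (hr.sl2Relation_iff_defect hT hK _ _ _ _).1 (hrel a b c d)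
  intro u
  have := congrArg (fun F => F u u) hz
  simp only [LinearMap.add_apply, LinearMap.flip_apply, LinearMap.zero_apply, ← two_smul ℝ] at this
  exact (smul_eq_zero.1 this).resolve_left two_ne_zero

theorem sl2Relation_of_quadratic (hr : IsCrossProduct γ T r) (hT : IsMetricBasis γ T)
    {q J K : g →ₗ[ℝ] B} (h : IsEquivariantPair q J) (hK : IsLieLift J K)
    (hq : Sl2Quadratic T r q J K) (x y z w : g) : Sl2Relation γ T q J x y z w := by
  rw [hr.sl2Quadratic_iff_defect hT h] at hq
  rw [hr.sl2Relation_iff_defect hT hK]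
  have := hq (⁅x, y⁆ + ⁅z, w⁆)
  simp only [map_add, LinearMap.add_apply, hq, zero_add, add_zero] at this
  rwa [add_comm]

end IsCrossProduct

end ThreeDim
-- Dimension three: the quadratic identity for the coproduct
section Sl2Coproduct

variable {g : Type*} [LieRing g] [LieAlgebra ℝ g] {B : Type*} [Ring B] [Algebra ℂ B]
  {ι : Type*} [Fintype ι] {γ : LinearMap.BilinForm ℝ g} {T : Module.Basis ι ℝ g} {r : ℝ}
  {X JX Y JY KX KY : g →ₗ[ℝ] B}

/-- The canonical tensor. -/
noncomputable def omegaTensor (T : Module.Basis ι ℝ g) (X Y : g →ₗ[ℝ] B) : B :=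
  ∑ b, X (T b) * Y (T b)

theorem IsCommutingPair.omegaTensor_swap (h : IsCommutingPair X JX Y JY) :
    omegaTensor T Y X = omegaTensor T X Y :=
  Finset.sum_congr rfl fun _ _ => h.comm_q _ _

theorem IsCommutingPair.omegaTensor_comm (hT : IsMetricBasis γ T)
    (h : IsCommutingPair X JX Y JY) (u : g) :
    omegaTensor T X Y * (X u + Y u) = (X u + Y u) * omegaTensor T X Y := by
  have e : (X u + Y u) * omegaTensor T X Y - omegaTensor T X Y * (X u + Y u) =
      ∑ b, X ⁅u, T b⁆ * Y (T b) + ∑ b, X (T b) * Y ⁅u, T b⁆ := by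
    simp only [omegaTensor, Finset.mul_sum, Finset.sum_mul, ← Finset.sum_sub_distrib,
      ← Finset.sum_add_distrib]
    refine Finset.sum_congr rfl fun b _ => ?_
    rw [h.left.lie_q, h.right.lie_q]
    simp only [mul_add, mul_sub, add_mul, sub_mul, mul_assoc, h.comm_q, h.comm_q']
    abel
  rw [hT.contract_mul, add_neg_cancel, sub_eq_zero] at e
  exact e.symm

/-- The coproduct of `K`. -/
noncomputable def coprodK (T : Module.Basis ι ℝ g) (r : ℝ) (X JX KX Y JY KY : g →ₗ[ℝ] B) :
    g →ₗ[ℝ] B :=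
  KX + KY + (1 / 2 : ℝ) • (omegaBracket T JX Y + omegaBracket T X JY)
    + (r / 4) • (LinearMap.mulLeft ℝ (omegaTensor T X Y)) ∘ₗ (X + Y)

namespace IsCrossProduct

/-- This is why `coprodK` exists in closed form: `[θ a, θ b]` depends on `⁅a, b⁆` alone. Its
coefficient `1/4` in `lie_coprodJ` yields the `r/4` of `coprodK`. -/
theorem lie_omegaBracket (hr : IsCrossProduct γ T r) (hT : IsMetricBasis γ T)
    (h : IsCommutingPair X JX Y JY) (a b : g) :
    ⁅omegaBracket T X Y a, omegaBracket T X Y b⁆ =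
      r • (omegaTensor T X Y * (X ⁅a, b⁆ + Y ⁅a, b⁆)) := by
  have hφ (s t : g) : ⁅⁅a, s⁆, ⁅b, t⁆⁆ + ⁅⁅a, t⁆, ⁅b, s⁆⁆ =
      r • γ ⁅a, b⁆ t • s + r • γ ⁅a, b⁆ s • t := by
    rw [hr.lie_lie_symm hT, smul_add]
  have hJ (X Y : g →ₗ[ℝ] B) (hc : ∀ x y, Y y * X x = X x * Y y) :
      jordanContract T X Y (fun s t => r • γ ⁅a, b⁆ t • s) =
      r • (omegaTensor T X Y * X ⁅a, b⁆ + X ⁅a, b⁆ * omegaTensor T X Y) := by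
    have e (s : ι) : ∑ t, γ ⁅a, b⁆ (T t) • (X (T s) * X (T t) + X (T t) * X (T s)) =
        X (T s) * X ⁅a, b⁆ + X ⁅a, b⁆ * X (T s) :=
      hT.sum_smul_map ((LinearMap.mulLeft ℝ (X (T s)) + LinearMap.mulRight ℝ (X (T s))) ∘ₗ X) ⁅a, b⁆
    simp only [jordanContract, map_smul, mul_smul_comm, ← Finset.smul_sum]
    congr 1
    simp only [← smul_mul_assoc, ← Finset.sum_mul, e]
    simp only [omegaTensor, Finset.sum_mul, Finset.mul_sum, ← Finset.sum_add_distrib]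
    refine Finset.sum_congr rfl fun s _ => ?_
    simp only [add_mul, mul_assoc, hc]
  have key := two_smul_lie_omegaBracket hT h a b
  rw [jordanContract_congr T X Y _ (fun s t => r • γ ⁅a, b⁆ t • s) hφ,
    jordanContract_congr T Y X _ (fun s t => r • γ ⁅a, b⁆ t • s) hφ,
    hJ X Y h.comm_q, hJ Y X (fun x y => (h.comm_q y x).symm), h.omegaTensor_swap] at key
  have hc := h.omegaTensor_comm hT ⁅a, b⁆
  apply smul_right_injective B (two_ne_zero (α := ℝ))
  simp only
  rw [key]
  -- `Ω` commutes with `X + Y`, so the two orders of multiplication by `Ω` agree.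
  replace hc := congrArg (r • ·) hc
  simp only [mul_add, add_mul, smul_add] at hc ⊢
  linear_combination (norm := module) (-1 : ℝ) • hc

theorem coprodK_lift (hr : IsCrossProduct γ T r) (hT : IsMetricBasis γ T)
    (h : IsCommutingPair X JX Y JY) (hKX : IsLieLift JX KX) (hKY : IsLieLift JY KY) :
    IsLieLift (coprodJ T X JX Y JY) (coprodK T r X JX KX Y JY KY) := by
  intro a b
  rw [← Ring.lie_def, lie_coprodJ hT h, hr.lie_omegaBracket hT h, Ring.lie_def, Ring.lie_def,
    ← hKX, ← hKY]
  simp only [coprodK, LinearMap.add_apply, LinearMap.smul_apply, LinearMap.comp_apply,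
    LinearMap.mulLeft_apply]
  module

/-- On brackets `K` is a commutator of values of `J`, so it inherits the equivariance of `J`;
likewise in `lift_comm` whatever commutes with `J`. -/
theorem lift_equivariant (hr : IsCrossProduct γ T r) (hT : IsMetricBasis γ T)
    {q J K : g →ₗ[ℝ] B} (h : IsEquivariantPair q J) (hK : IsLieLift J K) (x u : g) :
    K ⁅x, u⁆ = q x * K u - K u * q x := by
  have : K ∘ₗ (LieAlgebra.ad ℝ g x : g →ₗ[ℝ] g) =
      LinearMap.mulLeft ℝ (q x) ∘ₗ K - LinearMap.mulRight ℝ (q x) ∘ₗ K := by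
    refine hr.ext hT fun a b => ?_
    simp only [LinearMap.comp_apply, LieAlgebra.ad_apply, LinearMap.sub_apply,
      LinearMap.mulLeft_apply, LinearMap.mulRight_apply]
    rw [leibniz_lie, map_add, hK, hK, hK, h.lie_J, h.lie_J]
    noncomm_ring
  exact congrArg (fun F => F u) this

theorem lift_comm (hr : IsCrossProduct γ T r) (hT : IsMetricBasis γ T)
    {J K : g →ₗ[ℝ] B} (hK : IsLieLift J K) (m : B) (hm : ∀ u, m * J u = J u * m) (u : g) :
    m * K u = K u * m := by
  have : LinearMap.mulLeft ℝ m ∘ₗ K = LinearMap.mulRight ℝ m ∘ₗ K := by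
    refine hr.ext hT fun a b => ?_
    simp only [LinearMap.comp_apply, LinearMap.mulLeft_apply, LinearMap.mulRight_apply]
    rw [hK, mul_sub, sub_mul, ← mul_assoc, ← mul_assoc, hm a, hm b, mul_assoc, mul_assoc, hm, hm]
    simp only [mul_assoc]
  exact congrArg (fun F => F u) this

/-- The terms of bidegree `(1, 1)` in `J` cancel. -/
theorem coprod_quadratic_terms (hr : IsCrossProduct γ T r) (hT : IsMetricBasis γ T)
    (h : IsCommutingPair X JX Y JY) (hKX : IsLieLift JX KX) (hKY : IsLieLift JY KY) (u : g) :
    ⁅KX u + KY u, omegaBracket T X Y u⁆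
      + ⁅omegaBracket T JX Y u + omegaBracket T X JY u, JX u + JY u⁆ = 0 := by
  have cJX (a b : g) (m : B) : JY a * (X b * m) = X b * (JY a * m) := by
    rw [← mul_assoc, h.comm_qJ, mul_assoc]
  have cXJ (a b : g) (m : B) : Y a * (JX b * m) = JX b * (Y a * m) := by
    rw [← mul_assoc, h.comm_Jq, mul_assoc]
  have cJJ (a b : g) (m : B) : JY a * (JX b * m) = JX b * (JY a * m) := by
    rw [← mul_assoc, h.comm_J, mul_assoc]
  have cKX (a b : g) : Y a * KX b = KX b * Y a :=
    hr.lift_comm hT hKX _ (fun v => h.comm_Jq v a) b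
  have cKY (a b : g) : KY a * X b = X b * KY a :=
    (hr.lift_comm hT hKY _ (fun v => (h.comm_qJ b v).symm) a).symm
  have cKY' (a b : g) (m : B) : KY a * (X b * m) = X b * (KY a * m) := by
    rw [← mul_assoc, cKY, mul_assoc]
  have eX := hr.lift_equivariant hT h.left hKX
  have eY := hr.lift_equivariant hT h.right hKY
  have neg (F : g →ₗ[ℝ] B) (v w : g) : F ⁅v, w⁆ = - F ⁅w, v⁆ := by rw [← lie_skew, map_neg]
  have parts (A A' : g →ₗ[ℝ] B) : ∑ b, A (T b) * A' ⁅u, ⁅u, T b⁆⁆ =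
      - ∑ b, A ⁅u, T b⁆ * A' ⁅u, T b⁆ :=
    hT.contract_mul A (A' ∘ₗ (LieAlgebra.ad ℝ g u : g →ₗ[ℝ] g)) u
  -- The six brackets cancel in pairs: `k1` with `k3`, `k2` with `k6`, `k4` with `k5`.
  have k1 : ⁅KX u, omegaBracket T X Y u⁆ = ∑ b, KX ⁅u, T b⁆ * Y ⁅u, T b⁆ := by
    simp only [omegaBracket_apply, Ring.lie_def, Finset.mul_sum, Finset.sum_mul,
      ← Finset.sum_sub_distrib]
    refine Finset.sum_congr rfl fun b _ => ?_
    rw [neg KX, eX]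
    simp only [mul_assoc, cKX, sub_mul, neg_sub]
  have k2 : ⁅KY u, omegaBracket T X Y u⁆ = - ∑ b, X ⁅u, T b⁆ * KY ⁅u, T b⁆ := by
    rw [← parts]
    simp only [omegaBracket_apply, Ring.lie_def, Finset.mul_sum, Finset.sum_mul,
      ← Finset.sum_sub_distrib]
    refine Finset.sum_congr rfl fun b _ => ?_
    rw [neg KY, eY]
    simp only [mul_assoc, cKY', mul_sub, neg_sub]
  have k3 : ⁅omegaBracket T JX Y u, JX u⁆ = - ∑ b, KX ⁅u, T b⁆ * Y ⁅u, T b⁆ := by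
    simp only [omegaBracket_apply, Ring.lie_def, Finset.mul_sum, Finset.sum_mul,
      ← Finset.sum_sub_distrib, ← Finset.sum_neg_distrib]
    refine Finset.sum_congr rfl fun b _ => ?_
    rw [hKX]
    simp only [mul_assoc, sub_mul, neg_sub, h.comm_Jq]
  have k4 : ⁅omegaBracket T JX Y u, JY u⁆ = ∑ b, JX ⁅u, T b⁆ * JY ⁅u, T b⁆ := by
    rw [← neg_neg (∑ b, JX ⁅u, T b⁆ * _), ← parts]
    simp only [omegaBracket_apply, Ring.lie_def, Finset.mul_sum, Finset.sum_mul,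
      ← Finset.sum_sub_distrib, ← Finset.sum_neg_distrib]
    refine Finset.sum_congr rfl fun b _ => ?_
    rw [neg JY, h.right.lie_J]
    simp only [mul_assoc, mul_sub, mul_neg, neg_neg, cJJ]
  have k5 : ⁅omegaBracket T X JY u, JX u⁆ = - ∑ b, JX ⁅u, T b⁆ * JY ⁅u, T b⁆ := by
    simp only [omegaBracket_apply, Ring.lie_def, Finset.mul_sum, Finset.sum_mul,
      ← Finset.sum_sub_distrib, ← Finset.sum_neg_distrib]
    refine Finset.sum_congr rfl fun b _ => ?_
    rw [neg JX, h.left.lie_J]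
    simp only [mul_assoc, sub_mul, neg_mul, neg_neg, h.comm_J]
  have k6 : ⁅omegaBracket T X JY u, JY u⁆ = ∑ b, X ⁅u, T b⁆ * KY ⁅u, T b⁆ := by
    rw [← neg_neg (∑ b, X ⁅u, T b⁆ * _), ← parts]
    simp only [omegaBracket_apply, Ring.lie_def, Finset.mul_sum, Finset.sum_mul,
      ← Finset.sum_sub_distrib, ← Finset.sum_neg_distrib]
    refine Finset.sum_congr rfl fun b _ => ?_
    rw [neg KY, hKY]
    simp only [mul_assoc, mul_sub, mul_neg, neg_neg, cJX]
  have add (a b c d : B) : ⁅a + b, c + d⁆ = ⁅a, c⁆ + ⁅a, d⁆ + ⁅b, c⁆ + ⁅b, d⁆ := by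
    simp only [Ring.lie_def, add_mul, mul_add]; abel
  have add' (a b c : B) : ⁅a + b, c⁆ = ⁅a, c⁆ + ⁅b, c⁆ := by
    simp only [Ring.lie_def, add_mul, mul_add]; abel
  rw [add', add, k1, k2, k3, k4, k5, k6]
  abel

/-- The terms which are linear in `J`, acting on the first factor. -/
theorem lie_omegaBracket_left (hr : IsCrossProduct γ T r) (hT : IsMetricBasis γ T)
    (h : IsCommutingPair X JX Y JY) (u : g) :
    ⁅omegaBracket T JX Y u, omegaBracket T X Y u⁆ =
      (r / 2) • (Y u * (casimirSum T X * JX u - JX u * casimirSum T X)) := by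
  have cXJ (a b : g) (m : B) : Y a * (JX b * m) = JX b * (Y a * m) := by
    rw [← mul_assoc, h.comm_Jq, mul_assoc]
  have step : (2 : ℝ) • ⁅omegaBracket T JX Y u, omegaBracket T X Y u⁆ =
      - ∑ b, ∑ c, (Y ⁅u, T b⁆ * Y ⁅u, T c⁆ + Y ⁅u, T c⁆ * Y ⁅u, T b⁆) * JX ⁅T c, T b⁆ +
      ∑ b, ∑ c, (JX (T b) * X (T c) + X (T c) * JX (T b)) * Y ⁅⁅u, T b⁆, ⁅u, T c⁆⁆ := by
    simp only [omegaBracket_apply, Ring.lie_def, Finset.sum_mul_sum]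
    rw [Finset.sum_comm (s := Finset.univ (α := ι))
      (f := fun i j => X (T i) * Y ⁅u, T i⁆ * (JX (T j) * Y ⁅u, T j⁆))]
    simp only [← Finset.sum_sub_distrib, ← Finset.sum_add_distrib, Finset.smul_sum,
      ← Finset.sum_neg_distrib]
    refine Finset.sum_congr rfl fun b _ => Finset.sum_congr rfl fun c _ => ?_
    rw [h.left.lie_J, h.right.lie_q ⁅u, T b⁆]
    simp only [mul_add, mul_sub, add_mul, mul_assoc, h.comm_q, h.comm_q', h.comm_Jq, cXJ,
      two_smul]
    abel
  -- A product symmetric in `b, c` against a bracket antisymmetric in them.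
  have z : ∑ b, ∑ c, (Y ⁅u, T b⁆ * Y ⁅u, T c⁆ + Y ⁅u, T c⁆ * Y ⁅u, T b⁆) * JX ⁅T c, T b⁆ = 0 := by
    apply smul_right_injective B (two_ne_zero (α := ℝ))
    simp only [two_smul, add_zero]
    nth_rewrite 2 [Finset.sum_comm]
    simp only [← Finset.sum_add_distrib]
    refine Finset.sum_eq_zero fun b _ => Finset.sum_eq_zero fun c _ => ?_
    rw [← lie_skew (T c) (T b), map_neg, add_comm (Y ⁅u, T c⁆ * Y ⁅u, T b⁆)]
    simp
  -- As for `(u × b) × (u × c)`, the result is a multiple of `u`, so the right leg reduces to the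
  -- single factor `Y u`.
  have t (b c : ι) : ⁅⁅u, T b⁆, ⁅u, T c⁆⁆ = (r * γ ⁅u, T b⁆ (T c)) • u := by
    rw [hr.lie_lie, hT.lie_skew_left, hT.metric.symm u, hT.lie_skew_left, lie_self]
    simp [hT.lie_skew_left, mul_smul]
  have s1 (b : ι) : ∑ c, γ ⁅u, T b⁆ (T c) • (JX (T b) * X (T c) + X (T c) * JX (T b)) =
      JX (T b) * X ⁅u, T b⁆ + X ⁅u, T b⁆ * JX (T b) :=
    hT.sum_smul_map ((LinearMap.mulLeft ℝ (JX (T b)) + LinearMap.mulRight ℝ (JX (T b))) ∘ₗ X) _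
  have s2 : ∑ b, (JX (T b) * X ⁅u, T b⁆ + X ⁅u, T b⁆ * JX (T b)) =
      casimirSum T X * JX u - JX u * casimirSum T X := by
    have c1 := hT.contract_mul JX X u
    have c2 := hT.contract_mul X JX u
    rw [Finset.sum_add_distrib, c1, ← neg_eq_iff_eq_neg.mpr c2]
    simp only [casimirSum, Finset.mul_sum, Finset.sum_mul, ← Finset.sum_sub_distrib,
      ← Finset.sum_add_distrib, ← Finset.sum_neg_distrib]
    refine Finset.sum_congr rfl fun b _ => ?_
    rw [← lie_skew, map_neg, h.left.lie_J]
    noncomm_ring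
  have cC : Y u * (casimirSum T X * JX u - JX u * casimirSum T X) =
      (casimirSum T X * JX u - JX u * casimirSum T X) * Y u := by
    simp only [casimirSum, mul_sub, sub_mul, Finset.mul_sum, Finset.sum_mul, mul_assoc, h.comm_q,
      h.comm_q', h.comm_Jq, cXJ]
  rw [z, neg_zero, zero_add] at step
  simp only [t, map_smul, mul_smul, mul_smul_comm, ← Finset.smul_sum] at step
  simp only [← smul_mul_assoc, ← Finset.sum_mul, s1, s2] at step
  rw [cC]
  apply smul_right_injective B (two_ne_zero (α := ℝ))
  simp only
  rw [step, smul_smul, smul_mul_assoc]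
  ring_nf

end IsCrossProduct

theorem casimirSum_add (h : IsCommutingPair X JX Y JY) :
    casimirSum T (X + Y) = casimirSum T X + casimirSum T Y + (2 : ℝ) • omegaTensor T X Y := by
  simp only [casimirSum, omegaTensor, two_smul, ← Finset.sum_add_distrib]
  refine Finset.sum_congr rfl fun b _ => ?_
  simp only [LinearMap.add_apply, mul_add, add_mul, h.comm_q]
  abel

/-- Exchange the two factors in `lie_omegaBracket_left`; both entries of the commutator change sign.
-/
theorem IsCommutingPair.lie_omegaBracket_right (hT : IsMetricBasis γ T)
    (hr : IsCrossProduct γ T r) (h : IsCommutingPair X JX Y JY) (u : g) :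
    ⁅omegaBracket T X JY u, omegaBracket T X Y u⁆ =
      (r / 2) • (X u * (casimirSum T Y * JY u - JY u * casimirSum T Y)) := by
  rw [← hr.lie_omegaBracket_left hT h.swap, h.omegaBracket_swap hT]
  have : omegaBracket T JY X u = - omegaBracket T X JY u := by
    rw [omegaBracket_apply, omegaBracket_apply, hT.contract_mul, neg_inj]
    exact Finset.sum_congr rfl fun b _ => h.comm_qJ _ _
  rw [this]
  simp [Ring.lie_def]

/-- The bookkeeping at a fixed `u`: `x, y, a, b, kx, ky` are the values of `X, Y, JX, JY, KX, KY`,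
`p` and `p'` are the two terms of `coprodK` linear in `J`, and `c, c'` are the Casimirs. `h1`, `h2`
give `x[c, a]` and `y[c', b]`; `h4`, `h5`, with weight `1/4`, supply `y[c, a]` and `x[c', b]`,
completing `x` and `y` to `d`. The `r/4` term accounts for the commutator with `2Ω`. -/
theorem quadratic_combination {x y d a b kx ky p p' θ Ω c c' : B} (hd : d = x + y)
    (h1 : kx * a - a * kx = (r / 8) • (x * (c * a - a * c)))
    (h2 : ky * b - b * ky = (r / 8) • (y * (c' * b - b * c')))
    (h3 : (kx + ky) * θ - θ * (kx + ky) + ((p + p') * (a + b) - (a + b) * (p + p')) = 0)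
    (h4 : p * θ - θ * p = (r / 2) • (y * (c * a - a * c)))
    (h5 : p' * θ - θ * p' = (r / 2) • (x * (c' * b - b * c')))
    (e1 : b * kx = kx * b) (e2 : ky * a = a * ky) (e3 : Ω * d = d * Ω)
    (e4 : d * (a + b) = (a + b) * d) (e5 : d * θ = θ * d) (e6 : c * θ = θ * c)
    (e7 : c' * θ = θ * c') (e8 : c' * a = a * c') (e9 : c * b = b * c) :
    (kx + ky + (1 / 2 : ℝ) • (p + p') + (r / 4) • (Ω * d)) * (a + b + (1 / 2 : ℝ) • θ)
      - (a + b + (1 / 2 : ℝ) • θ) * (kx + ky + (1 / 2 : ℝ) • (p + p') + (r / 4) • (Ω * d)) =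
    (r / 8) • (d * ((c + c' + (2 : ℝ) • Ω) * (a + b + (1 / 2 : ℝ) • θ)
      - (a + b + (1 / 2 : ℝ) • θ) * (c + c' + (2 : ℝ) • Ω))) := by
  have l : (kx + ky + (1 / 2 : ℝ) • (p + p') + (r / 4) • (Ω * d)) * (a + b + (1 / 2 : ℝ) • θ)
      - (a + b + (1 / 2 : ℝ) • θ) * (kx + ky + (1 / 2 : ℝ) • (p + p') + (r / 4) • (Ω * d)) =
      (kx * a - a * kx) + (ky * b - b * ky)
      + (1 / 2 : ℝ) • ((kx + ky) * θ - θ * (kx + ky) + ((p + p') * (a + b) - (a + b) * (p + p')))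
      + (1 / 4 : ℝ) • (p * θ - θ * p) + (1 / 4 : ℝ) • (p' * θ - θ * p')
      + (r / 4) • (Ω * d * (a + b) - (a + b) * (Ω * d))
      + (r / 8) • (Ω * d * θ - θ * (Ω * d)) := by
    simp only [mul_add, add_mul, smul_mul_assoc, mul_smul_comm, e1, e2]
    module
  have m1 : d * (Ω * (a + b)) = Ω * d * (a + b) := by rw [e3, mul_assoc]
  have m2 : d * ((a + b) * Ω) = (a + b) * (Ω * d) := by rw [← mul_assoc, e4, mul_assoc, e3]
  have m3 : d * (Ω * θ) = Ω * d * θ := by rw [e3, mul_assoc]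
  have m4 : d * (θ * Ω) = θ * (Ω * d) := by rw [← mul_assoc, e5, mul_assoc, e3]
  have s1 : (c + c' + (2 : ℝ) • Ω) * (a + b + (1 / 2 : ℝ) • θ)
      - (a + b + (1 / 2 : ℝ) • θ) * (c + c' + (2 : ℝ) • Ω) =
      (c * a - a * c) + (c' * b - b * c') + (2 : ℝ) • (Ω * (a + b) - (a + b) * Ω)
        + (Ω * θ - θ * Ω) := by
    simp only [mul_add, add_mul, smul_mul_assoc, mul_smul_comm, e6, e7, e8, e9]
    module
  rw [l, s1, h1, h2, h3, h4, h5, mul_add d, mul_add d, mul_smul_comm, mul_sub d, mul_sub d, m1,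
    m2, m3, m4, mul_add d, hd]
  simp only [add_mul x y]
  module

theorem IsCrossProduct.sl2Quadratic_coprod (hr : IsCrossProduct γ T r) (hT : IsMetricBasis γ T)
    (h : IsCommutingPair X JX Y JY) (hKX : IsLieLift JX KX) (hKY : IsLieLift JY KY)
    (hX : Sl2Quadratic T r X JX KX) (hY : Sl2Quadratic T r Y JY KY) :
    Sl2Quadratic T r (X + Y) (coprodJ T X JX Y JY) (coprodK T r X JX KX Y JY KY) := by
  intro u
  have hE := h.add_equivariant hT
  have hDJ : (X u + Y u) * coprodJ T X JX Y JY u = coprodJ T X JX Y JY u * (X u + Y u) :=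
    (hE.comm_self u).symm
  have hDX : (X u + Y u) * (JX u + JY u) = (JX u + JY u) * (X u + Y u) := by
    simp only [mul_add, add_mul, h.left.comm_self, h.right.comm_self, h.comm_qJ, h.comm_Jq]
    abel
  -- Subtracting the primitive part `hDX` from `hDJ` isolates `θ`.
  have hDθ : (X u + Y u) * omegaBracket T X Y u = omegaBracket T X Y u * (X u + Y u) := by
    simp only [coprodJ, LinearMap.add_apply, LinearMap.smul_apply] at hDJ
    rw [mul_add (X u + Y u), hDX, add_mul (JX u + JY u), add_right_inj, mul_smul_comm,
      smul_mul_assoc] at hDJ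
    exact smul_right_injective B (by norm_num : (1 / 2 : ℝ) ≠ 0) hDJ
  have hΩ := h.omegaTensor_comm hT u
  have cKX (a b : g) : JY a * KX b = KX b * JY a :=
    hr.lift_comm hT hKX _ (fun v => h.comm_J v a) b
  have cKY (a b : g) : KY a * JX b = JX b * KY a :=
    (hr.lift_comm hT hKY _ (fun v => (h.comm_J b v).symm) a).symm
  have q0 := hr.coprod_quadratic_terms hT h hKX hKY u
  have qL := hr.lie_omegaBracket_left hT h u
  have qR := h.lie_omegaBracket_right hT hr u
  have pX := hX u
  have pY := hY u
  have cXθ : casimirSum T X * omegaBracket T X Y u = omegaBracket T X Y u * casimirSum T X := by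
    simp only [omegaBracket_apply, Finset.mul_sum, Finset.sum_mul]
    refine Finset.sum_congr rfl fun b _ => ?_
    rw [← mul_assoc, casimirSum_comm hT h.left]
    simp only [casimirSum, Finset.mul_sum, Finset.sum_mul, mul_assoc, h.comm_q, h.comm_q']
  have cYθ : casimirSum T Y * omegaBracket T X Y u = omegaBracket T X Y u * casimirSum T Y := by
    simp only [omegaBracket_apply, Finset.mul_sum, Finset.sum_mul]
    refine Finset.sum_congr rfl fun b _ => ?_
    rw [mul_assoc, ← casimirSum_comm hT h.right]
    simp only [casimirSum, Finset.mul_sum, Finset.sum_mul, mul_assoc, h.comm_q, h.comm_q']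
  have cYJ : casimirSum T Y * JX u = JX u * casimirSum T Y := by
    have cXJ (a b : g) (m : B) : Y a * (JX b * m) = JX b * (Y a * m) := by
      rw [← mul_assoc, h.comm_Jq, mul_assoc]
    simp only [casimirSum, Finset.mul_sum, Finset.sum_mul, mul_assoc, h.comm_Jq, cXJ]
  have cXJ : casimirSum T X * JY u = JY u * casimirSum T X := by
    have cJX (a b : g) (m : B) : JY a * (X b * m) = X b * (JY a * m) := by
      rw [← mul_assoc, h.comm_qJ, mul_assoc]
    simp only [casimirSum, Finset.mul_sum, Finset.sum_mul, mul_assoc, h.comm_qJ, cJX]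
  rw [casimirSum_add h]
  simp only [coprodJ, coprodK, LinearMap.add_apply, LinearMap.smul_apply, LinearMap.comp_apply,
    LinearMap.mulLeft_apply]
  rw [Ring.lie_def] at qL qR
  rw [Ring.lie_def, Ring.lie_def] at q0
  exact quadratic_combination rfl pX pY q0 qL qR (cKX u u) (cKY u u) hΩ hDX hDθ cXθ cYθ cYJ cXJ

end Sl2Coproduct
-- Three-dimensional simple algebras, and Yangian pairs
section YangianHoms

variable {g : Type*} [LieRing g] [LieAlgebra ℝ g] {B : Type*} [Ring B] [Algebra ℂ B]
  {ι : Type*} [Fintype ι] {γ : LinearMap.BilinForm ℝ g} {T : Module.Basis ι ℝ g} {r : ℝ}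

theorem IsCrossProduct.of_triple (hT : IsMetricBasis γ T) (e : Fin 3 ≃ ι) {κ : ℝ} (hκ : κ ≠ 0)
    (h01 : ⁅T (e 0), T (e 1)⁆ = κ • T (e 2)) (h12 : ⁅T (e 1), T (e 2)⁆ = κ • T (e 0))
    (h20 : ⁅T (e 2), T (e 0)⁆ = κ • T (e 1)) : IsCrossProduct γ T (κ ^ 2) where
  ne_zero := pow_ne_zero 2 hκ
  card := by rw [← Fintype.card_congr e, Fintype.card_fin]
  lie_lie := by
    have h10 : ⁅T (e 1), T (e 0)⁆ = -(κ • T (e 2)) := by rw [← lie_skew, h01]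
    have h21 : ⁅T (e 2), T (e 1)⁆ = -(κ • T (e 0)) := by rw [← lie_skew, h12]
    have h02 : ⁅T (e 0), T (e 2)⁆ = -(κ • T (e 1)) := by rw [← lie_skew, h20]
    have ho (i j : Fin 3) : γ (T (e i)) (T (e j)) = if i = j then 1 else 0 := by
      split_ifs with h
      · rw [h, hT.norm_one]
      · exact hT.ortho _ _ (fun h' => h (e.injective h'))
    have key (i j k : Fin 3) : ⁅⁅T (e i), T (e j)⁆, T (e k)⁆ =
        κ ^ 2 • (γ (T (e i)) (T (e k)) • T (e j) - γ (T (e j)) (T (e k)) • T (e i)) := by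
      simp only [ho]
      fin_cases i <;> fin_cases j <;> fin_cases k <;>
        simp [h01, h12, h20, h10, h21, h02] <;> module
    let br : g →ₗ[ℝ] g →ₗ[ℝ] g := LieModule.toEnd ℝ g g
    let F : g →ₗ[ℝ] g →ₗ[ℝ] g →ₗ[ℝ] g := br.compr₂ br
    let G : g →ₗ[ℝ] g →ₗ[ℝ] g →ₗ[ℝ] g := LinearMap.mk₂ ℝ
      (fun a b => κ ^ 2 • ((γ a).smulRight b - (γ b).smulRight a))
      (by intros; ext; simp; module) (by intros; ext; simp; module)
      (by intros; ext; simp; module) (by intros; ext; simp; module)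
    have hFG : F = G := by
      refine T.ext fun a => T.ext fun b => T.ext fun c => ?_
      obtain ⟨i, rfl⟩ := e.surjective a
      obtain ⟨j, rfl⟩ := e.surjective b
      obtain ⟨k, rfl⟩ := e.surjective c
      exact key i j k
    intro a b d
    exact congrArg (fun H => H a b d) hFG

/-- `γ ⁅a, b⁆ c` is an alternating 3-form on a three-dimensional space, hence `κ` times the volume
form. A simple algebra is not abelian, so `κ ≠ 0`, and `r = κ²`. -/
theorem exists_isCrossProduct [LieAlgebra.IsSimple ℝ g] (hT : IsMetricBasis γ T)
    (h3 : Fintype.card ι = 3) : ∃ r, IsCrossProduct γ T r := by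
  let e : Fin 3 ≃ ι := (Fintype.equivFinOfCardEq h3).symm
  have hsum (i j : Fin 3) : ⁅T (e i), T (e j)⁆ = γ ⁅T (e i), T (e j)⁆ (T (e 0)) • T (e 0)
      + γ ⁅T (e i), T (e j)⁆ (T (e 1)) • T (e 1) + γ ⁅T (e i), T (e j)⁆ (T (e 2)) • T (e 2) := by
    conv_lhs => rw [← hT.sum_smul ⁅T (e i), T (e j)⁆]
    rw [← e.sum_comp, Fin.sum_univ_three]
  have z1 (a b : g) : γ ⁅a, b⁆ a = 0 := by
    rw [hT.metric.symm, ← hT.metric.invariant, lie_self, map_zero, LinearMap.zero_apply]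
  have z2 (a b : g) : γ ⁅a, b⁆ b = 0 := by rw [hT.metric.invariant, lie_self, map_zero]
  have cyc (a b c : g) : γ ⁅a, b⁆ c = γ ⁅b, c⁆ a := by rw [hT.metric.invariant, hT.metric.symm]
  set κ := γ ⁅T (e 0), T (e 1)⁆ (T (e 2)) with hκ
  have h01 : ⁅T (e 0), T (e 1)⁆ = κ • T (e 2) := by rw [hsum, z1, z2]; simp [hκ]
  have h12 : ⁅T (e 1), T (e 2)⁆ = κ • T (e 0) := by
    rw [hsum, z1, z2, hκ, cyc (T (e 0))]; simp
  have h20 : ⁅T (e 2), T (e 0)⁆ = κ • T (e 1) := by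
    rw [hsum, z1, z2, hκ, ← cyc (T (e 2))]; simp
  refine ⟨κ ^ 2, IsCrossProduct.of_triple hT e (fun h0 => ?_) h01 h12 h20⟩
  rw [h0, zero_smul] at h01 h12 h20
  refine LieAlgebra.IsSimple.non_abelian (R := ℝ) (L := g) ⟨fun a b => ?_⟩
  have key (i j : Fin 3) : ⁅T (e i), T (e j)⁆ = 0 := by
    have h10 : ⁅T (e 1), T (e 0)⁆ = 0 := by rw [← lie_skew, h01, neg_zero]
    have h21 : ⁅T (e 2), T (e 1)⁆ = 0 := by rw [← lie_skew, h12, neg_zero]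
    have h02 : ⁅T (e 0), T (e 2)⁆ = 0 := by rw [← lie_skew, h20, neg_zero]
    fin_cases i <;> fin_cases j <;> simp [h01, h12, h20, h10, h21, h02]
  have : (LieModule.toEnd ℝ g g : g →ₗ[ℝ] Module.End ℝ g) = 0 := by
    refine T.ext fun a => T.ext fun b => ?_
    obtain ⟨i, rfl⟩ := e.surjective a
    obtain ⟨j, rfl⟩ := e.surjective b
    exact key i j
  exact congrArg (fun H => H a b) this

/-- Since `u = -(1/2r) ∑ ⁅⁅u, T c⁆, T c⁆`, a lift can only be `-(1/2r) ∑ [J ⁅u, T c⁆, J (T c)]`. The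
triple bracket formula confirms that this works. -/
theorem IsCrossProduct.exists_lieLift (hr : IsCrossProduct γ T r) (hT : IsMetricBasis γ T)
    (J : g →ₗ[ℝ] B) : ∃ K : g →ₗ[ℝ] B, IsLieLift J K := by
  let F : g →ₗ[ℝ] B :=
    { toFun := fun u => ∑ c, (J ⁅u, T c⁆ * J (T c) - J (T c) * J ⁅u, T c⁆)
      map_add' := fun u v => by
        rw [← Finset.sum_add_distrib]
        refine Finset.sum_congr rfl fun c _ => ?_
        simp only [add_lie, map_add, add_mul, mul_add]
        abel
      map_smul' := fun t u => by simp [Finset.smul_sum, smul_sub] }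
  refine ⟨(-(1 / (2 * r))) • F, fun a b => ?_⟩
  have e : F ⁅a, b⁆ = (-(2 * r)) • (J a * J b - J b * J a) := by
    change ∑ c, (J ⁅⁅a, b⁆, T c⁆ * J (T c) - J (T c) * J ⁅⁅a, b⁆, T c⁆) = _
    have s1 := hT.sum_smul_map (LinearMap.mulLeft ℝ (J b) ∘ₗ J) a
    have s2 := hT.sum_smul_map (LinearMap.mulRight ℝ (J b) ∘ₗ J) a
    have s3 := hT.sum_smul_map (LinearMap.mulLeft ℝ (J a) ∘ₗ J) b
    have s4 := hT.sum_smul_map (LinearMap.mulRight ℝ (J a) ∘ₗ J) b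
    simp only [LinearMap.comp_apply, LinearMap.mulLeft_apply, LinearMap.mulRight_apply] at s1 s2 s3 s4
    have : ∀ c, J ⁅⁅a, b⁆, T c⁆ * J (T c) - J (T c) * J ⁅⁅a, b⁆, T c⁆ =
        r • (γ a (T c) • (J b * J (T c)) - γ a (T c) • (J (T c) * J b)
          - γ b (T c) • (J a * J (T c)) + γ b (T c) • (J (T c) * J a)) := by
      intro c
      rw [hr.lie_lie]
      simp only [map_smul, map_sub, smul_mul_assoc, mul_smul_comm, sub_mul, mul_sub]
      module
    simp only [this, ← Finset.smul_sum, Finset.sum_add_distrib, Finset.sum_sub_distrib, s1, s2,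
      s3, s4]
    module
  rw [LinearMap.smul_apply, e, smul_smul]
  have := hr.ne_zero
  rw [show -(1 / (2 * r)) * -(2 * r) = 1 by field_simp, one_smul]

/-- The relations of the Yangian, for images `q`, `J` of `g` in an algebra. -/
structure IsYangianPair (γ : LinearMap.BilinForm ℝ g) (T : Module.Basis ι ℝ g)
    (q J : g →ₗ[ℝ] B) : Prop where
  equivariant : IsEquivariantPair q J
  serre : ∀ a b c, SerreRelation γ T q J (T a) (T b) (T c)
  sl2 : Fintype.card ι = 3 → ∀ a b c d, Sl2Relation γ T q J (T a) (T b) (T c) (T d)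

theorem IsYangianPair.coprod [LieAlgebra.IsSimple ℝ g] (hT : IsMetricBasis γ T)
    {X JX Y JY : g →ₗ[ℝ] B} (hX : IsYangianPair γ T X JX) (hY : IsYangianPair γ T Y JY)
    (h : IsCommutingPair X JX Y JY) : IsYangianPair γ T (X + Y) (coprodJ T X JX Y JY) where
  equivariant := h.add_equivariant hT
  serre a b c := .coprod hT h (hX.serre a b c) (hY.serre a b c)
  sl2 h3 a b c d := by
    obtain ⟨r, hr⟩ := exists_isCrossProduct hT h3
    obtain ⟨KX, hKX⟩ := hr.exists_lieLift hT JX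
    obtain ⟨KY, hKY⟩ := hr.exists_lieLift hT JY
    exact hr.sl2Relation_of_quadratic hT (h.add_equivariant hT) (hr.coprodK_lift hT h hKX hKY)
      (hr.sl2Quadratic_coprod hT h hKX hKY
        (hr.sl2Quadratic_of_relation hT h.left hKX (hX.sl2 h3))
        (hr.sl2Quadratic_of_relation hT h.right hKY (hY.sl2 h3))) _ _ _ _

theorem sum_structureConst_smul (hT : IsMetricBasis γ T) (q : g →ₗ[ℝ] B) (a b : ι) :
    ∑ c, (structureConst γ T a b c : ℂ) • q (T c) = q ⁅T a, T b⁆ := by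
  simp only [Complex.coe_smul]
  exact hT.sum_smul_map q _

theorem IsMetricBasis.sum_triple (hT : IsMetricBasis γ T) (x y w : g) :
    ∑ i, ∑ j, ∑ k, γ x (T i) * γ y (T j) * γ w (T k) * structureConst γ T i j k =
      γ x ⁅y, w⁆ := by
  have e1 (i j : ι) : ∑ k, γ x (T i) * γ y (T j) * γ w (T k) * structureConst γ T i j k =
      γ x (T i) * (γ y (T j) * γ w ⁅T i, T j⁆) := by
    simp only [mul_assoc, ← Finset.mul_sum, structureConst, hT.sum_mul]
  have e2 (i : ι) : ∑ j, γ y (T j) * γ w ⁅T i, T j⁆ = γ w ⁅T i, y⁆ :=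
    hT.sum_smul_map (γ w ∘ₗ (LieAlgebra.ad ℝ g (T i) : g →ₗ[ℝ] g)) y
  have e3 : ∑ i, γ x (T i) * γ w ⁅T i, y⁆ = γ w ⁅x, y⁆ := by
    have := hT.sum_smul_map (γ w ∘ₗ (LieAlgebra.ad ℝ g y : g →ₗ[ℝ] g)) x
    simp only [LinearMap.comp_apply, LieAlgebra.ad_apply, smul_eq_mul] at this
    rw [← lie_skew, map_neg, ← this, ← Finset.sum_neg_distrib]
    refine Finset.sum_congr rfl fun i _ => ?_
    rw [← lie_skew y, map_neg, mul_neg, neg_neg]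
  simp only [e1, ← Finset.mul_sum, e2, e3]
  rw [hT.metric.symm, hT.metric.invariant]

/-- Antisymmetry of `f` makes the six terms of `alt3` agree in pairs, so the weight is `2/6`. This
turns the `1/12` of the Yangian relation into the `1/4` of `SerreRelation`. -/
theorem serre_lhs (hT : IsMetricBasis γ T) (J : g →ₗ[ℝ] B) (a b c : ι) :
    alt3 (fun a b c => ∑ d, (structureConst γ T d a b : ℂ) • ⁅J (T c), J (T d)⁆) a b c =
      (1 / 3 : ℝ) • (⁅J (T a), J ⁅T b, T c⁆⁆ + ⁅J (T b), J ⁅T c, T a⁆⁆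
        + ⁅J (T c), J ⁅T a, T b⁆⁆) := by
  have e (a b c : ι) : ∑ d, (structureConst γ T d a b : ℂ) • ⁅J (T c), J (T d)⁆ =
      ⁅J (T c), J ⁅T a, T b⁆⁆ := by
    have s1 := hT.sum_smul_map (LinearMap.mulLeft ℝ (J (T c)) ∘ₗ J) ⁅T a, T b⁆
    have s2 := hT.sum_smul_map (LinearMap.mulRight ℝ (J (T c)) ∘ₗ J) ⁅T a, T b⁆
    simp only [LinearMap.comp_apply, LinearMap.mulLeft_apply, LinearMap.mulRight_apply] at s1 s2
    rw [Ring.lie_def, ← s1, ← s2, ← Finset.sum_sub_distrib]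
    refine Finset.sum_congr rfl fun d _ => ?_
    rw [Complex.coe_smul, structureConst, hT.metric.invariant, hT.metric.symm, Ring.lie_def,
      smul_sub]
  simp only [alt3, e]
  rw [← lie_skew (T b) (T a), ← lie_skew (T c) (T b), ← lie_skew (T a) (T c)]
  have hs (m : B) : (1 / 6 : ℂ) • m = (1 / 6 : ℝ) • m := by
    rw [← Complex.coe_smul]; norm_num
  rw [hs]
  simp only [Ring.lie_def, map_neg, mul_neg, neg_mul]
  module

end YangianHoms
-- From basis-free relations to homomorphisms of the Yangian
section YangianLift

variable {g : Type*} [LieRing g] [LieAlgebra ℝ g] {B : Type*} [Ring B] [Algebra ℂ B]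
  {ι : Type*} [Fintype ι] {γ : LinearMap.BilinForm ℝ g} {T : Module.Basis ι ℝ g}

theorem serre_rhs (hT : IsMetricBasis γ T) (q : g →ₗ[ℝ] B) (a b c : ι) :
    (∑ p, ∑ s, ∑ t, ∑ i, ∑ j, ∑ k, ((structureConst γ T a p i * structureConst γ T b s j *
      structureConst γ T c t k * structureConst γ T i j k : ℝ) : ℂ) •
        symm3 (q (T p)) (q (T s)) (q (T t))) = serreCubic γ T q (T a) (T b) (T c) := by
  rw [serreCubic]
  refine Finset.sum_congr rfl fun p _ => Finset.sum_congr rfl fun s _ =>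
    Finset.sum_congr rfl fun t _ => ?_
  rw [← hT.sum_triple]
  simp only [Complex.coe_smul, ← Finset.sum_smul]
  rfl

theorem sl2_rhs (hT : IsMetricBasis γ T) (q J : g →ₗ[ℝ] B) (a b c d : ι) :
    (∑ p, ∑ s, ∑ t, ∑ i, ∑ j, ∑ k, ∑ e,
      (((structureConst γ T a p i * structureConst γ T b s j * structureConst γ T c d e
        + structureConst γ T c p i * structureConst γ T d s j * structureConst γ T a b e)
          * structureConst γ T e t k * structureConst γ T i j k : ℝ) : ℂ) •
        symm3 (q (T p)) (q (T s)) (J (T t))) =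
      ∑ p, ∑ s, ∑ t, (γ ⁅T a, T p⁆ ⁅⁅T b, T s⁆, ⁅⁅T c, T d⁆, T t⁆⁆
        + γ ⁅T c, T p⁆ ⁅⁅T d, T s⁆, ⁅⁅T a, T b⁆, T t⁆⁆) •
          symm3 (q (T p)) (q (T s)) (J (T t)) := by
  have contr (c d t k : ι) : ∑ e, structureConst γ T c d e * structureConst γ T e t k =
      γ ⁅⁅T c, T d⁆, T t⁆ (T k) := by
    have := hT.sum_smul_map ((γ.flip (T k)) ∘ₗ (-LieAlgebra.ad ℝ g (T t) : g →ₗ[ℝ] g)) ⁅T c, T d⁆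
    simp only [LinearMap.comp_apply, LinearMap.neg_apply, LieAlgebra.ad_apply, lie_skew,
      LinearMap.flip_apply, smul_eq_mul] at this
    exact this
  refine Finset.sum_congr rfl fun p _ => Finset.sum_congr rfl fun s _ =>
    Finset.sum_congr rfl fun t _ => ?_
  rw [← hT.sum_triple, ← hT.sum_triple]
  simp only [Complex.coe_smul, ← Finset.sum_smul, ← Finset.sum_add_distrib]
  congr 1
  refine Finset.sum_congr rfl fun i _ => Finset.sum_congr rfl fun j _ =>
    Finset.sum_congr rfl fun k _ => ?_
  rw [← contr, ← contr]
  simp only [Finset.mul_sum, Finset.sum_mul, ← Finset.sum_add_distrib]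
  refine Finset.sum_congr rfl fun e _ => ?_
  simp only [structureConst]
  ring

theorem sl2_lhs (hT : IsMetricBasis γ T) (J : g →ₗ[ℝ] B) (a b c d : ι) :
    (∑ e, ((structureConst γ T c d e : ℂ) • ⁅⁅J (T a), J (T b)⁆, J (T e)⁆
      + (structureConst γ T a b e : ℂ) • ⁅⁅J (T c), J (T d)⁆, J (T e)⁆)) =
      ⁅⁅J (T a), J (T b)⁆, J ⁅T c, T d⁆⁆ + ⁅⁅J (T c), J (T d)⁆, J ⁅T a, T b⁆⁆ := by
  have e (m : B) (c d : ι) : ∑ e, (structureConst γ T c d e : ℂ) • ⁅m, J (T e)⁆ =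
      ⁅m, J ⁅T c, T d⁆⁆ := by
    simp only [Ring.lie_def, smul_sub, Finset.sum_sub_distrib]
    congr 1
    · exact sum_structureConst_smul hT (LinearMap.mulLeft ℝ m ∘ₗ J) c d
    · exact sum_structureConst_smul hT (LinearMap.mulRight ℝ m ∘ₗ J) c d
  rw [Finset.sum_add_distrib, e, e]

theorem map_symm3 {A : Type*} [Ring A] [Algebra ℂ A] (φ : A →ₐ[ℂ] B) (x y z : A) :
    φ (symm3 x y z) = symm3 (φ x) (φ y) (φ z) := by
  simp [symm3]

theorem map_lie' {A : Type*} [Ring A] [Algebra ℂ A] (φ : A →ₐ[ℂ] B) (x y : A) :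
    φ ⁅x, y⁆ = ⁅φ x, φ y⁆ := by
  simp [Ring.lie_def]

/-- An algebra homomorphism from the free algebra respects the relations of the Yangian exactly
when the images of the generators satisfy the basis-free relations. -/
theorem isYangianPair_iff (hT : IsMetricBasis γ T) (q J : g →ₗ[ℝ] B)
    (φ : FreeAlgebra ℂ (YangianGen ι) →ₐ[ℂ] B) (h0 : ∀ a, φ (freeQ0 a) = q (T a))
    (h1 : ∀ a, φ (freeQ1 a) = J (T a)) :
    (∀ x y, YangianRel (structureConst γ T) x y → φ x = φ y) ↔ IsYangianPair γ T q J := by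
  have halt (F : ι → ι → ι → FreeAlgebra ℂ (YangianGen ι)) (a b c : ι) :
      φ (alt3 F a b c) = alt3 (fun a b c => φ (F a b c)) a b c := by simp [alt3]
  have hcS (m m' : B) (t : ℝ) : (1 / 3 : ℝ) • m = (1 / 12 : ℂ) • m' ↔ m = (1 / 4 : ℝ) • m' := by
    have e : (1 / 12 : ℂ) • m' = (1 / 3 : ℝ) • (1 / 4 : ℝ) • m' := by
      rw [← Complex.coe_smul, ← Complex.coe_smul, smul_smul]; norm_num
    rw [e]
    exact (smul_right_injective B (by norm_num : (1 / 3 : ℝ) ≠ 0)).eq_iff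
  have hc4 (m : B) : (1 / 4 : ℂ) • m = (1 / 4 : ℝ) • m := by
    rw [← Complex.coe_smul]; norm_num
  have hS (a b c : ι) : φ (alt3 (fun a b c => ∑ d, (structureConst γ T d a b : ℂ) •
        ⁅freeQ1 c, freeQ1 d⁆) a b c) = φ ((1 / 12 : ℂ) • ∑ p, ∑ q, ∑ r, ∑ i, ∑ j, ∑ k,
          ((structureConst γ T a p i * structureConst γ T b q j * structureConst γ T c r k *
            structureConst γ T i j k : ℝ) : ℂ) • symm3 (freeQ0 p) (freeQ0 q) (freeQ0 r)) ↔
      SerreRelation γ T q J (T a) (T b) (T c) := by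
    rw [halt]
    simp only [map_sum, map_smul, map_lie', map_symm3, h0, h1]
    rw [serre_lhs hT, serre_rhs hT, hcS _ _ 0]
    rfl
  have hD (a b c d : ι) : φ (∑ e, ((structureConst γ T c d e : ℂ) •
        ⁅⁅freeQ1 a, freeQ1 b⁆, freeQ1 e⁆
          + (structureConst γ T a b e : ℂ) • ⁅⁅freeQ1 c, freeQ1 d⁆, freeQ1 e⁆)) =
      φ ((1 / 4 : ℂ) • ∑ p, ∑ q, ∑ r, ∑ i, ∑ j, ∑ k, ∑ e,
        (((structureConst γ T a p i * structureConst γ T b q j * structureConst γ T c d e +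
          structureConst γ T c p i * structureConst γ T d q j * structureConst γ T a b e)
              * structureConst γ T e r k * structureConst γ T i j k : ℝ) : ℂ) •
            symm3 (freeQ0 p) (freeQ0 q) (freeQ1 r)) ↔
      Sl2Relation γ T q J (T a) (T b) (T c) (T d) := by
    simp only [map_sum, map_add, map_smul, map_lie', map_symm3, h0, h1]
    rw [sl2_lhs hT, sl2_rhs hT, hc4]
    rfl
  have h00 (a b : ι) : φ ⁅freeQ0 a, freeQ0 b⁆ =
      φ (∑ c, (structureConst γ T a b c : ℂ) • freeQ0 c) ↔
      q ⁅T a, T b⁆ = q (T a) * q (T b) - q (T b) * q (T a) := by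
    simp only [map_sum, map_smul, map_lie', h0]
    rw [sum_structureConst_smul hT, Ring.lie_def, eq_comm]
  have h01 (a b : ι) : φ ⁅freeQ0 a, freeQ1 b⁆ =
      φ (∑ c, (structureConst γ T a b c : ℂ) • freeQ1 c) ↔
      J ⁅T a, T b⁆ = q (T a) * J (T b) - J (T b) * q (T a) := by
    simp only [map_sum, map_smul, map_lie', h0, h1]
    rw [sum_structureConst_smul hT, Ring.lie_def, eq_comm]
  -- Both sides are bilinear, so equivariance on basis vectors gives it everywhere.
  have hext (A A' : g →ₗ[ℝ] B)
      (h : ∀ a b, A' ⁅T a, T b⁆ = A (T a) * A' (T b) - A' (T b) * A (T a)) (x y : g) :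
      A' ⁅x, y⁆ = A x * A' y - A' y * A x := by
    have : (LieModule.toEnd ℝ g g : g →ₗ[ℝ] Module.End ℝ g).compr₂ A' =
        (LinearMap.mul ℝ B).compl₁₂ A A' - (LinearMap.mul ℝ B).flip.compl₁₂ A A' :=
      T.ext fun a => T.ext fun b => h a b
    exact congrArg (fun F => F x y) this
  constructor
  · intro h
    exact
      { equivariant :=
          { lie_q := hext q q fun a b => (h00 a b).1 (h _ _ (.q0_q0 a b))
            lie_J := hext q J fun a b => (h01 a b).1 (h _ _ (.q0_q1 a b)) }
        serre := fun a b c => (hS a b c).1 (h _ _ (.serre a b c))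
        sl2 := fun h3 a b c d => (hD a b c d).1 (h _ _ (.sl2 h3 a b c d)) }
  · intro h x y hxy
    induction hxy with
    | q0_q0 a b => exact (h00 a b).2 (h.equivariant.lie_q _ _)
    | q0_q1 a b => exact (h01 a b).2 (h.equivariant.lie_J _ _)
    | serre a b c => exact (hS a b c).2 (h.serre a b c)
    | sl2 h3 a b c d => exact (hD a b c d).2 (h.sl2 h3 a b c d)

/-- A pair satisfying the relations extends to the Yangian. -/
theorem IsYangianPair.exists_algHom (hT : IsMetricBasis γ T) {q J : g →ₗ[ℝ] B}
    (h : IsYangianPair γ T q J) : ∃ φ : Yangian (structureConst γ T) →ₐ[ℂ] B,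
      (∀ a, φ (Yangian.Q0 _ a) = q (T a)) ∧ ∀ a, φ (Yangian.Q1 _ a) = J (T a) := by
  let φ : FreeAlgebra ℂ (YangianGen ι) →ₐ[ℂ] B := FreeAlgebra.lift ℂ fun x =>
    match x with
    | .q0 a => q (T a)
    | .q1 a => J (T a)
  have h0 (a : ι) : φ (freeQ0 a) = q (T a) := by simp [φ, freeQ0]
  have h1 (a : ι) : φ (freeQ1 a) = J (T a) := by simp [φ, freeQ1]
  refine ⟨RingQuot.liftAlgHom ℂ ⟨φ, fun _ _ hxy => (isYangianPair_iff hT q J φ h0 h1).2 h _ _ hxy⟩,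
    fun a => ?_, fun a => ?_⟩
  · rw [Yangian.Q0, RingQuot.liftAlgHom_mkAlgHom_apply, h0]
  · rw [Yangian.Q1, RingQuot.liftAlgHom_mkAlgHom_apply, h1]

theorem isYangianPair_of_algHom (hT : IsMetricBasis γ T)
    (φ : Yangian (structureConst γ T) →ₐ[ℂ] B) :
    IsYangianPair γ T (T.constr ℝ fun a => φ (Yangian.Q0 _ a))
      (T.constr ℝ fun a => φ (Yangian.Q1 _ a)) := by
  refine (isYangianPair_iff hT _ _ (φ.comp (RingQuot.mkAlgHom ℂ _)) (fun a => ?_) fun a => ?_).1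
    fun x y hxy => ?_
  · rw [Module.Basis.constr_basis]; rfl
  · rw [Module.Basis.constr_basis]; rfl
  · rw [AlgHom.comp_apply, AlgHom.comp_apply, RingQuot.mkAlgHom_rel ℂ hxy]

/-- The coproduct, followed by a pair of commuting homomorphisms. -/
theorem exists_coproduct_map [LieAlgebra.IsSimple ℝ g] (hT : IsMetricBasis γ T)
    (L R : Yangian (structureConst γ T) →ₐ[ℂ] B) (hc : ∀ x y, R y * L x = L x * R y) :
    ∃ Δ : Yangian (structureConst γ T) →ₐ[ℂ] B,
      (∀ a, Δ (Yangian.Q0 _ a) = L (Yangian.Q0 _ a) + R (Yangian.Q0 _ a)) ∧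
      ∀ a, Δ (Yangian.Q1 _ a) = L (Yangian.Q1 _ a) + R (Yangian.Q1 _ a) + (1 / 2 : ℂ) •
        ∑ b, ∑ c, (structureConst γ T a b c : ℂ) •
          (L (Yangian.Q0 _ b) * R (Yangian.Q0 _ c)) := by
  have hL := isYangianPair_of_algHom hT L
  have hR := isYangianPair_of_algHom hT R
  have hcomm (u v : ι → Yangian (structureConst γ T)) (x y : g) :
      (T.constr ℝ fun a => R (v a)) y * (T.constr ℝ fun a => L (u a)) x =
        (T.constr ℝ fun a => L (u a)) x * (T.constr ℝ fun a => R (v a)) y := by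
    simp only [Module.Basis.constr_apply_fintype, Finset.sum_mul_sum, smul_mul_smul_comm, hc]
    rw [Finset.sum_comm]
    simp only [mul_comm]
  obtain ⟨Δ, h0, h1⟩ := (hL.coprod hT hR
    ⟨hL.equivariant, hR.equivariant, hcomm _ _, hcomm _ _, hcomm _ _, hcomm _ _⟩).exists_algHom hT
  refine ⟨Δ, fun a => ?_, fun a => ?_⟩
  · simp only [h0, LinearMap.add_apply, Module.Basis.constr_basis]
  · have hs (m : B) : (1 / 2 : ℂ) • m = (1 / 2 : ℝ) • m := by
      rw [← Complex.coe_smul]; norm_num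
    rw [h1, hs]
    simp only [coprodJ, LinearMap.add_apply, LinearMap.smul_apply, omegaBracket_apply,
      Module.Basis.constr_basis, ← mul_smul_comm, ← Finset.mul_sum]
    congr 3
    ext b
    rw [← sum_structureConst_smul hT]
    simp only [Module.Basis.constr_basis]

theorem exists_isCoproduct [LieAlgebra.IsSimple ℝ g] (hT : IsMetricBasis γ T) :
    ∃ Δ, Yangian.IsCoproduct (structureConst γ T) Δ := by
  let L : Yangian (structureConst γ T) →ₐ[ℂ]
      Yangian (structureConst γ T) ⊗[ℂ] Yangian (structureConst γ T) :=
    Algebra.TensorProduct.includeLeft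
  let R : Yangian (structureConst γ T) →ₐ[ℂ]
      Yangian (structureConst γ T) ⊗[ℂ] Yangian (structureConst γ T) :=
    Algebra.TensorProduct.includeRight
  obtain ⟨Δ, h0, h1⟩ := exists_coproduct_map
    (B := Yangian (structureConst γ T) ⊗[ℂ] Yangian (structureConst γ T)) hT L R
    (fun x y => by simp [L, R])
  exact ⟨Δ, fun a => by simpa [L, R] using h0 a, fun a => by simpa [L, R] using h1 a⟩

end YangianLift
-- The co-ideal property for symmetric pairs
section Twisted

variable {g : Type*} [LieRing g] [LieAlgebra ℝ g]
  {I P : Type*} [Fintype I] [Fintype P] {γ : LinearMap.BilinForm ℝ g}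
  {h : LieSubalgebra ℝ g} {k : Submodule ℝ g} {T : Module.Basis (I ⊕ P) ℝ g}

omit [Fintype I] [Fintype P] in
theorem IsAdaptedBasis.isMetricBasis (hT : IsAdaptedBasis γ h k T) (hγ : IsInvariantMetric γ) :
    IsMetricBasis γ T :=
  ⟨hγ, hT.norm_one, hT.ortho⟩

omit [Fintype I] [Fintype P] in
theorem structureConst_swap (hT : IsMetricBasis γ T) (a b c : I ⊕ P) :
    structureConst γ T b a c = - structureConst γ T a b c := by
  rw [structureConst, structureConst, ← lie_skew, map_neg, LinearMap.neg_apply]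

omit [Fintype I] [Fintype P] in
theorem structureConst_rotate (hT : IsMetricBasis γ T) (a b c : I ⊕ P) :
    structureConst γ T b c a = structureConst γ T a b c := by
  rw [structureConst, structureConst, hT.metric.invariant (T a), hT.metric.symm]

omit [Fintype I] [Fintype P] in
/-- The grading of the structure constants of a symmetric pair. -/
theorem structureConst_graded (hT : IsMetricBasis γ T) (hA : IsAdaptedBasis γ h k T)
    (hs : IsSymmetricPair h k) (a b c : I ⊕ P) :
    let ε : I ⊕ P → ℝ := Sum.elim (fun _ => 1) (fun _ => -1)
    ε a * ε b * structureConst γ T a b c = ε c * structureConst γ T a b c := by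
  intro ε
  obtain ⟨σ, -, hh, hk⟩ := hs
  have hσ (a : I ⊕ P) : σ (T a) = ε a • T a := by
    rcases a with i | p
    · simpa [ε] using (hh _).1 (hA.mem_h i)
    · simpa [ε] using (hk _).1 (hA.mem_k p)
  -- Here `σ` need not be known to preserve `γ`: it is diagonal in an orthonormal basis, hence
  -- self-adjoint.
  have hγ (w : g) : γ (σ w) (T c) = ε c * γ w (T c) := by
    have e : γ.flip (T c) ∘ₗ (σ : g →ₗ[ℝ] g) = ε c • γ.flip (T c) := by
      refine T.ext fun b => ?_
      by_cases hbc : b = c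
      · subst hbc; simp [hσ]
      · simp [hσ, hT.ortho b c hbc]
    exact congrArg (fun F => F w) e
  rw [structureConst, ← hγ, LieEquiv.map_lie, hσ, hσ, smul_lie, lie_smul, smul_smul, map_smul,
    LinearMap.smul_apply, smul_eq_mul]

section Generic

variable {A : Type*} [Ring A] [Algebra ℂ A] {Q Q₁ : I ⊕ P → A} {f : I ⊕ P → I ⊕ P → I ⊕ P → ℝ}
  {Δ : A →ₐ[ℂ] A ⊗[ℂ] A}

/-- The canonical tensor of `h`. -/
def subTensor (Q : I ⊕ P → A) : A ⊗[ℂ] A :=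
  ∑ i : I, Q (Sum.inl i) ⊗ₜ[ℂ] Q (Sum.inl i)

/-- The Casimir element of `h`. -/
def subCasimir (Q : I ⊕ P → A) : A := ∑ i : I, Q (Sum.inl i) * Q (Sum.inl i)

theorem coproduct_casimir (h0 : ∀ a, Δ (Q a) = Q a ⊗ₜ[ℂ] 1 + 1 ⊗ₜ[ℂ] Q a) :
    Δ (subCasimir Q) = subCasimir Q ⊗ₜ[ℂ] 1 + 1 ⊗ₜ[ℂ] subCasimir Q + (2 : ℂ) • subTensor Q := by
  simp only [subCasimir, subTensor, map_sum, map_mul, h0, TensorProduct.sum_tmul,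
    TensorProduct.tmul_sum, ← Finset.sum_add_distrib, Finset.smul_sum]
  refine Finset.sum_congr rfl fun i _ => ?_
  simp only [mul_add, add_mul, Algebra.TensorProduct.tmul_mul_tmul, one_mul, mul_one, two_smul]
  abel

/-- The right legs stay in `h`. In the companion with `1 ⊗ Q a` they need not, which is what the
co-ideal property has to avoid. -/
theorem lie_subTensor_left
    (hQ : ∀ a b, Q a * Q b - Q b * Q a = ∑ c, (f a b c : ℂ) • Q c) (a : I ⊕ P) :
    ⁅subTensor Q, Q a ⊗ₜ[ℂ] (1 : A)⁆ =
      ∑ i : I, ∑ c, (f (Sum.inl i) a c : ℂ) • (Q c ⊗ₜ[ℂ] Q (Sum.inl i)) := by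
  simp only [Ring.lie_def, subTensor, Finset.sum_mul, Finset.mul_sum, ← Finset.sum_sub_distrib,
    Algebra.TensorProduct.tmul_mul_tmul, one_mul, mul_one, ← TensorProduct.sub_tmul, hQ,
    TensorProduct.sum_tmul, TensorProduct.smul_tmul']

theorem lie_subTensor_right
    (hQ : ∀ a b, Q a * Q b - Q b * Q a = ∑ c, (f a b c : ℂ) • Q c) (a : I ⊕ P) :
    ⁅subTensor Q, (1 : A) ⊗ₜ[ℂ] Q a⁆ =
      ∑ i : I, ∑ c, (f (Sum.inl i) a c : ℂ) • (Q (Sum.inl i) ⊗ₜ[ℂ] Q c) := by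
  simp only [Ring.lie_def, subTensor, Finset.sum_mul, Finset.mul_sum, ← Finset.sum_sub_distrib,
    Algebra.TensorProduct.tmul_mul_tmul, one_mul, mul_one, ← TensorProduct.tmul_sub, hQ,
    TensorProduct.tmul_sum, TensorProduct.tmul_smul]

/-- The coproduct of `Q̃`, without any assumption on the subalgebra. -/
theorem coproduct_add_lie (h0 : ∀ a, Δ (Q a) = Q a ⊗ₜ[ℂ] 1 + 1 ⊗ₜ[ℂ] Q a) {x : A}
    {t : A ⊗[ℂ] A} (h1 : Δ x = x ⊗ₜ[ℂ] 1 + 1 ⊗ₜ[ℂ] x + (1 / 2 : ℂ) • t) (a : I ⊕ P) :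
    Δ (x + (1 / 4 : ℂ) • ⁅subCasimir Q, Q a⁆) =
      (x + (1 / 4 : ℂ) • ⁅subCasimir Q, Q a⁆) ⊗ₜ[ℂ] 1
        + 1 ⊗ₜ[ℂ] (x + (1 / 4 : ℂ) • ⁅subCasimir Q, Q a⁆)
        + (1 / 2 : ℂ) • (t + ⁅subTensor Q, Q a ⊗ₜ[ℂ] (1 : A)⁆
          + ⁅subTensor Q, (1 : A) ⊗ₜ[ℂ] Q a⁆) := by
  rw [map_add, map_smul, h1, Ring.lie_def, Ring.lie_def, Ring.lie_def, map_sub,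
    map_mul, map_mul, coproduct_casimir h0, h0]
  simp only [mul_add, add_mul, Algebra.TensorProduct.tmul_mul_tmul, one_mul, mul_one,
    TensorProduct.add_tmul, TensorProduct.tmul_add, TensorProduct.sub_tmul, TensorProduct.tmul_sub,
    TensorProduct.tmul_smul, ← TensorProduct.smul_tmul', smul_mul_assoc, mul_smul_comm]
  module

/-- Only `f^{pqi}` and `f^{piq}` are left, and each family is one of the two commutators with the
tensor of `h`. -/
theorem sum_structureConst_tmul
    (hQ : ∀ a b, Q a * Q b - Q b * Q a = ∑ c, (f a b c : ℂ) • Q c)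
    (hsw : ∀ a b c, f b a c = - f a b c) (hrot : ∀ a b c, f b c a = f a b c)
    (h1 : ∀ p i j, f (Sum.inr p) (Sum.inl i) (Sum.inl j) = 0)
    (h3 : ∀ p q r, f (Sum.inr p) (Sum.inr q) (Sum.inr r) = 0) (p : P) :
    ∑ b, ∑ c, (f (Sum.inr p) b c : ℂ) • (Q b ⊗ₜ[ℂ] Q c) =
      ⁅subTensor Q, Q (Sum.inr p) ⊗ₜ[ℂ] (1 : A)⁆ - ⁅subTensor Q, (1 : A) ⊗ₜ[ℂ] Q (Sum.inr p)⁆ := by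
  have e1 (i j) : f (Sum.inl i) (Sum.inr p) (Sum.inl j) = 0 := by rw [hsw, h1, neg_zero]
  rw [lie_subTensor_left hQ, lie_subTensor_right hQ]
  simp only [Fintype.sum_sum_type, h1, h3, e1, Complex.ofReal_zero, zero_smul,
    Finset.sum_const_zero, zero_add, add_zero]
  rw [Finset.sum_comm (s := Finset.univ (α := P)), add_comm, sub_eq_add_neg,
    ← Finset.sum_neg_distrib]
  congr 1
  · refine Finset.sum_congr rfl fun i _ => Finset.sum_congr rfl fun q _ => ?_
    rw [← hrot (Sum.inl i)]
  · refine Finset.sum_congr rfl fun i _ => ?_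
    rw [← Finset.sum_neg_distrib]
    refine Finset.sum_congr rfl fun q _ => ?_
    rw [hsw, Complex.ofReal_neg, neg_smul]

theorem coproduct_add_lie_of_symmetric
    (hQ : ∀ a b, Q a * Q b - Q b * Q a = ∑ c, (f a b c : ℂ) • Q c)
    (hsw : ∀ a b c, f b a c = - f a b c) (hrot : ∀ a b c, f b c a = f a b c)
    (hf1 : ∀ p i j, f (Sum.inr p) (Sum.inl i) (Sum.inl j) = 0)
    (hf3 : ∀ p q r, f (Sum.inr p) (Sum.inr q) (Sum.inr r) = 0)
    (h0 : ∀ a, Δ (Q a) = Q a ⊗ₜ[ℂ] 1 + 1 ⊗ₜ[ℂ] Q a)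
    (h1 : ∀ a, Δ (Q₁ a) = Q₁ a ⊗ₜ[ℂ] 1 + 1 ⊗ₜ[ℂ] Q₁ a
      + (1 / 2 : ℂ) • ∑ b, ∑ c, (f a b c : ℂ) • (Q b ⊗ₜ[ℂ] Q c)) (p : P) :
    Δ (Q₁ (Sum.inr p) + (1 / 4 : ℂ) • ⁅subCasimir Q, Q (Sum.inr p)⁆) =
      (Q₁ (Sum.inr p) + (1 / 4 : ℂ) • ⁅subCasimir Q, Q (Sum.inr p)⁆) ⊗ₜ[ℂ] 1
        + 1 ⊗ₜ[ℂ] (Q₁ (Sum.inr p) + (1 / 4 : ℂ) • ⁅subCasimir Q, Q (Sum.inr p)⁆)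
        + ⁅subTensor Q, Q (Sum.inr p) ⊗ₜ[ℂ] (1 : A)⁆ := by
  rw [coproduct_add_lie h0 (h1 _), sum_structureConst_tmul hQ hsw hrot hf1 hf3]
  module

theorem half_smul_lie_casimir (h0 : ∀ a, Δ (Q a) = Q a ⊗ₜ[ℂ] 1 + 1 ⊗ₜ[ℂ] Q a) (y : A ⊗[ℂ] A) :
    (1 / 2 : ℂ) • ⁅Δ (subCasimir Q) - subCasimir Q ⊗ₜ[ℂ] 1 - 1 ⊗ₜ[ℂ] subCasimir Q, y⁆ =
      ⁅subTensor Q, y⁆ := by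
  rw [coproduct_casimir h0]
  simp only [Ring.lie_def, add_mul, sub_mul, mul_add, mul_sub, smul_mul_assoc, mul_smul_comm]
  module

theorem tmul_mem_coideal (S : Subalgebra ℂ A) (x : A) {y : A} (hy : y ∈ S) :
    x ⊗ₜ[ℂ] y ∈ (Algebra.TensorProduct.map (AlgHom.id ℂ A) S.val).range :=
  ⟨x ⊗ₜ[ℂ] ⟨y, hy⟩, by simp⟩

/-- The image of `A ⊗ S` is a subalgebra and `Δ` is multiplicative, so generators suffice. -/
theorem isLeftCoideal_adjoin {Qt : P → A}
    (hQ : ∀ a b, Q a * Q b - Q b * Q a = ∑ c, (f a b c : ℂ) • Q c)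
    (h0 : ∀ a, Δ (Q a) = Q a ⊗ₜ[ℂ] 1 + 1 ⊗ₜ[ℂ] Q a)
    (ht : ∀ p, Δ (Qt p) = Qt p ⊗ₜ[ℂ] 1 + 1 ⊗ₜ[ℂ] Qt p
      + ⁅subTensor Q, Q (Sum.inr p) ⊗ₜ[ℂ] (1 : A)⁆) :
    IsLeftCoideal Δ (Algebra.adjoin ℂ
      (Set.range (fun i : I => Q (Sum.inl i)) ∪ Set.range Qt)) := by
  set S := Algebra.adjoin ℂ (Set.range (fun i : I => Q (Sum.inl i)) ∪ Set.range Qt) with hS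
  have m0 (i : I) : Q (Sum.inl i) ∈ S := Algebra.subset_adjoin (Or.inl ⟨i, rfl⟩)
  have m1 (p : P) : Qt p ∈ S := Algebra.subset_adjoin (Or.inr ⟨p, rfl⟩)
  have key : ∀ x ∈ Set.range (fun i : I => Q (Sum.inl i)) ∪ Set.range Qt,
      Δ x ∈ (Algebra.TensorProduct.map (AlgHom.id ℂ A) S.val).range := by
    rintro x (⟨i, rfl⟩ | ⟨p, rfl⟩)
    · rw [h0]
      exact add_mem (tmul_mem_coideal _ _ (one_mem _)) (tmul_mem_coideal _ _ (m0 i))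
    · rw [ht, lie_subTensor_left hQ]
      exact add_mem (add_mem (tmul_mem_coideal _ _ (one_mem _)) (tmul_mem_coideal _ _ (m1 p)))
        (sum_mem fun i _ => sum_mem fun c _ =>
          Subalgebra.smul_mem _ (tmul_mem_coideal _ _ (m0 i)) _)
  rw [IsLeftCoideal, Subalgebra.map_le, hS, Algebra.adjoin_le_iff]
  exact key

end Generic

theorem Yangian.Q0_mul_Q0 {ι : Type*} [Fintype ι] (f : ι → ι → ι → ℝ) (a b : ι) :
    Yangian.Q0 f a * Yangian.Q0 f b - Yangian.Q0 f b * Yangian.Q0 f a =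
      ∑ c, (f a b c : ℂ) • Yangian.Q0 f c := by
  have := RingQuot.mkAlgHom_rel ℂ (YangianRel.q0_q0 (f := f) a b)
  rw [Ring.lie_def, map_sub, map_mul, map_mul, map_sum] at this
  simp only [map_smul] at this
  exact this

theorem exists_coproduct_coideal [LieAlgebra.IsSimple ℝ g] (hγ : IsInvariantMetric γ)
    (hs : IsSymmetricPair h k) (hA : IsAdaptedBasis γ h k T) :
    ∃ Δ : Yangian (structureConst γ T) →ₐ[ℂ]
        Yangian (structureConst γ T) ⊗[ℂ] Yangian (structureConst γ T),
      Yangian.IsCoproduct (structureConst γ T) Δ ∧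
      (∀ p : P, Δ (TwistedYangian.Qtilde (structureConst γ T) p) =
        TwistedYangian.Qtilde (structureConst γ T) p ⊗ₜ[ℂ] 1
          + 1 ⊗ₜ[ℂ] TwistedYangian.Qtilde (structureConst γ T) p
          + (1 / 2 : ℂ) • ⁅Δ (TwistedYangian.casimir (structureConst γ T))
              - TwistedYangian.casimir (structureConst γ T) ⊗ₜ[ℂ] 1
              - 1 ⊗ₜ[ℂ] TwistedYangian.casimir (structureConst γ T),
            Yangian.Q0 (structureConst γ T) (Sum.inr p) ⊗ₜ[ℂ] 1⁆) ∧
      IsLeftCoideal Δ (twistedYangian (structureConst γ T)) := by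
  have hT := hA.isMetricBasis hγ
  obtain ⟨Δ, hΔ⟩ := exists_isCoproduct hT
  have h1 (p i j) : structureConst γ T (Sum.inr p) (Sum.inl i) (Sum.inl j) = 0 := by
    have := structureConst_graded hT hA hs (Sum.inr p) (Sum.inl i) (Sum.inl j)
    simp only [Sum.elim_inl, Sum.elim_inr] at this
    linarith
  have h3 (p q r) : structureConst γ T (Sum.inr p) (Sum.inr q) (Sum.inr r) = 0 := by
    have := structureConst_graded hT hA hs (Sum.inr p) (Sum.inr q) (Sum.inr r)
    simp only [Sum.elim_inr] at this
    linarith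
  have hQ := coproduct_add_lie_of_symmetric (Yangian.Q0_mul_Q0 (structureConst γ T))
    (structureConst_swap hT) (structureConst_rotate hT) h1 h3 hΔ.map_Q0 hΔ.map_Q1
  refine ⟨Δ, hΔ, fun p => ?_, isLeftCoideal_adjoin (Yangian.Q0_mul_Q0 (structureConst γ T))
    hΔ.map_Q0 hQ⟩
  exact (hQ p).trans (congrArg _ (half_smul_lie_casimir hΔ.map_Q0 _).symm)

end Twisted
-- The Lie algebra `su(n)` and complexified ideals
section SpecialUnitary

open Matrix

attribute [local instance] LieRing.ofAssociativeRing

variable {n : Type*} [Fintype n] [DecidableEq n]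

/-- The Lie algebra `su(n)`. -/
def suLie (n : Type*) [Fintype n] [DecidableEq n] : LieSubalgebra ℝ (Matrix n n ℂ) where
  carrier := {X | Xᴴ = -X ∧ X.trace = 0}
  add_mem' := by
    rintro X Y ⟨h1, h2⟩ ⟨h3, h4⟩
    exact ⟨by rw [conjTranspose_add, h1, h3]; abel, by rw [trace_add, h2, h4, add_zero]⟩
  zero_mem' := ⟨by simp, by simp⟩
  smul_mem' := by
    rintro c X ⟨h1, h2⟩
    exact ⟨by rw [conjTranspose_smul, h1]; simp, by rw [trace_smul, h2, smul_zero]⟩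
  lie_mem' := by
    rintro X Y ⟨h1, h2⟩ ⟨h3, h4⟩
    refine ⟨?_, ?_⟩
    · rw [Ring.lie_def, conjTranspose_sub, conjTranspose_mul, conjTranspose_mul, h1, h3]
      noncomm_ring
    · rw [Ring.lie_def, trace_sub, trace_mul_comm, sub_self]

theorem exists_suLie_decomp [Nonempty n] (Z : Matrix n n ℂ) : ∃ A ∈ suLie n, ∃ B ∈ suLie n,
    Z = (Z.trace / Fintype.card n) • (1 : Matrix n n ℂ) + A + Complex.I • B := by
  have hn : (Fintype.card n : ℂ) ≠ 0 := by exact_mod_cast Fintype.card_ne_zero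
  set W := Z - (Z.trace / Fintype.card n) • (1 : Matrix n n ℂ) with hW
  have hWt : W.trace = 0 := by
    rw [hW, trace_sub, trace_smul, trace_one, smul_eq_mul, div_mul_cancel₀ _ hn, sub_self]
  have hWt' : Wᴴ.trace = 0 := by rw [trace_conjTranspose, hWt, star_zero]
  refine ⟨(1 / 2 : ℂ) • (W - Wᴴ), ⟨?_, ?_⟩, (-(Complex.I / 2)) • (W + Wᴴ), ⟨?_, ?_⟩, ?_⟩
  · rw [conjTranspose_smul, conjTranspose_sub, conjTranspose_conjTranspose]
    simp
    module
  · rw [trace_smul, trace_sub, hWt, hWt', sub_zero, smul_zero]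
  · rw [conjTranspose_smul, conjTranspose_add, conjTranspose_conjTranspose]
    simp
    module
  · rw [trace_smul, trace_add, hWt, hWt', add_zero, smul_zero]
  · rw [smul_smul, show Complex.I * -(Complex.I / 2) = 1 / 2 by
      rw [mul_neg, ← mul_div_assoc, Complex.I_mul_I]; ring]
    have : Z = (Z.trace / Fintype.card n) • (1 : Matrix n n ℂ) + W := by rw [hW]; abel
    conv_lhs => rw [this]
    module

/-- The complexification of an ideal of `su(n)`, inside the matrices. -/
def suComplexify (I : LieIdeal ℝ (suLie n)) : Submodule ℂ (Matrix n n ℂ) where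
  carrier := {Z | ∃ A ∈ I, ∃ B ∈ I, Z = (A : Matrix n n ℂ) + Complex.I • (B : Matrix n n ℂ)}
  add_mem' := by
    rintro _ _ ⟨A, hA, B, hB, rfl⟩ ⟨A', hA', B', hB', rfl⟩
    exact ⟨A + A', add_mem hA hA', B + B', add_mem hB hB', by push_cast; module⟩
  zero_mem' := ⟨0, zero_mem _, 0, zero_mem _, by simp⟩
  smul_mem' := by
    rintro c _ ⟨A, hA, B, hB, rfl⟩
    refine ⟨c.re • A - c.im • B, sub_mem (I.smul_mem _ hA) (I.smul_mem _ hB),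
      c.im • A + c.re • B, add_mem (I.smul_mem _ hA) (I.smul_mem _ hB), ?_⟩
    have e (r : ℝ) (X : Matrix n n ℂ) : r • X = (r : ℂ) • X := by
      ext i j; simp
    push_cast
    simp only [e, smul_add, smul_sub, smul_smul]
    conv_lhs => rw [← Complex.re_add_im c]
    have : (Complex.re c + Complex.im c * Complex.I) * Complex.I =
        -(c.im : ℂ) + Complex.I * c.re := by
      linear_combination (c.im : ℂ) * Complex.I_mul_I
    rw [this]
    module

/-- Every matrix is a scalar plus an element of `su(n) + i su(n)`, and scalars commute with
everything. -/
theorem lie_mem_suComplexify [Nonempty n] (I : LieIdeal ℝ (suLie n)) (W : Matrix n n ℂ)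
    {Z : Matrix n n ℂ} (hZ : Z ∈ suComplexify I) : W * Z - Z * W ∈ suComplexify I := by
  have key (C : Matrix n n ℂ) (hC : C ∈ suLie n) : C * Z - Z * C ∈ suComplexify I := by
    obtain ⟨A, hA, B, hB, rfl⟩ := hZ
    refine ⟨⁅⟨C, hC⟩, A⁆, lie_mem_right ℝ _ I _ _ hA, ⁅⟨C, hC⟩, B⁆, lie_mem_right ℝ _ I _ _ hB, ?_⟩
    rw [LieSubalgebra.coe_bracket, LieSubalgebra.coe_bracket, Ring.lie_def, Ring.lie_def]
    simp only [mul_add, add_mul, mul_smul_comm, smul_mul_assoc]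
    module
  obtain ⟨C, hC, D, hD, hW⟩ := exists_suLie_decomp W
  have : W * Z - Z * W = (C * Z - Z * C) + Complex.I • (D * Z - Z * D) := by
    rw [hW]
    simp only [mul_add, add_mul, mul_smul_comm, smul_mul_assoc, one_mul, mul_one]
    module
  rw [this]
  exact add_mem (key C hC) (Submodule.smul_mem _ _ (key D hD))

/-- Because `E_ij² = 0`, applying `ad E_ij` twice sends `Z` to `-2 Z_ji E_ij`. -/
theorem single_mem_of_entry_ne [Nonempty n] (I : LieIdeal ℝ (suLie n)) {Z : Matrix n n ℂ}
    (hZ : Z ∈ suComplexify I) {i j : n} (hij : i ≠ j) (h : Z j i ≠ 0) :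
    single i j (1 : ℂ) ∈ suComplexify I := by
  have h2 := lie_mem_suComplexify I (single i j 1) (lie_mem_suComplexify I (single i j 1) hZ)
  have e : single i j (1 : ℂ) * (single i j 1 * Z - Z * single i j 1)
      - (single i j 1 * Z - Z * single i j 1) * single i j 1 = (-2 * Z j i) • single i j 1 := by
    have s0 : single i j (1 : ℂ) * single i j (1 : ℂ) = 0 := single_mul_single_of_ne _ _ _ _ hij.symm _
    have s1 : single i j (1 : ℂ) * Z * single i j (1 : ℂ) = Z j i • single i j 1 := by
      ext a b
      simp [single_mul_mul_single, single_apply]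
    rw [mul_sub, sub_mul, ← mul_assoc, s0, mul_assoc Z, s0, ← mul_assoc, s1, zero_mul, mul_zero]
    module
  rw [e] at h2
  have := Submodule.smul_mem _ (-2 * Z j i)⁻¹ h2
  rwa [smul_smul, inv_mul_cancel₀ (by simpa using h), one_smul] at this

end SpecialUnitary
-- Simplicity of `su(n)`
section SpecialUnitarySimple

open Matrix

attribute [local instance] LieRing.ofAssociativeRing

variable {n : Type*} [Fintype n] [DecidableEq n] [Nonempty n]

/-- If `Z` is diagonal, being traceless and nonzero it is not scalar, so two diagonal entries differ
and `[E_ij, Z] = (Z_jj - Z_ii) E_ij` does the work. -/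
theorem exists_single_mem (I : LieIdeal ℝ (suLie n)) {Z : Matrix n n ℂ}
    (hZ : Z ∈ suComplexify I) (hZ0 : Z ≠ 0) (ht : Z.trace = 0) :
    ∃ i j, i ≠ j ∧ single i j (1 : ℂ) ∈ suComplexify I := by
  by_cases hd : ∃ i j, i ≠ j ∧ Z j i ≠ 0
  · obtain ⟨i, j, hij, h⟩ := hd
    exact ⟨i, j, hij, single_mem_of_entry_ne I hZ hij h⟩
  push Not at hd
  have hne : ∃ i j, Z i i ≠ Z j j := by
    by_contra hc
    push Not at hc
    obtain ⟨i₀⟩ := ‹Nonempty n›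
    have h0 : Z i₀ i₀ = 0 := by
      have : Z.trace = Fintype.card n * Z i₀ i₀ := by
        simp only [trace, diag_apply]
        rw [Finset.sum_congr rfl fun i _ => hc i i₀]
        simp
      rw [this] at ht
      exact (mul_eq_zero.1 ht).resolve_left (by exact_mod_cast (Fintype.card_pos_iff.2 ⟨i₀⟩).ne')
    apply hZ0
    ext i j
    by_cases hij : i = j
    · subst hij; rw [hc i i₀, h0, Matrix.zero_apply]
    · exact hd j i (Ne.symm hij)
  obtain ⟨i, j, h⟩ := hne
  have hij : i ≠ j := fun h' => h (by rw [h'])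
  refine ⟨i, j, hij, ?_⟩
  have h2 := lie_mem_suComplexify I (single i j 1) hZ
  have e : single i j (1 : ℂ) * Z - Z * single i j 1 = (Z j j - Z i i) • single i j 1 := by
    ext a b
    simp only [Matrix.sub_apply, Matrix.smul_apply, smul_eq_mul, single_apply]
    by_cases ha : i = a <;> by_cases hb : j = b
    · subst ha hb
      simp
    · subst ha
      rw [single_mul_apply_same, mul_single_apply_of_ne _ _ _ _ _ (Ne.symm hb), hd _ _ (Ne.symm hb)]
      simp [hb]
    · subst hb
      rw [single_mul_apply_of_ne _ _ _ _ _ (Ne.symm ha), mul_single_apply_same, hd _ _ ha]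
      simp [ha]
    · rw [single_mul_apply_of_ne _ _ _ _ _ (Ne.symm ha), mul_single_apply_of_ne _ _ _ _ _ (Ne.symm hb)]
      simp [ha]
  rw [e] at h2
  have h3 := Submodule.smul_mem _ (Z j j - Z i i)⁻¹ h2
  rwa [smul_smul, inv_mul_cancel₀ (sub_ne_zero.2 h.symm), one_smul] at h3

/-- The bracket of `E_li` with `E_ij` has a nonzero entry at `(l, j)`, so `E_ij` leads to `E_jl`;
one or two such moves reach any `E_kl`. -/
theorem all_single_mem (I : LieIdeal ℝ (suLie n)) {i j : n} (hij : i ≠ j)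
    (h : single i j (1 : ℂ) ∈ suComplexify I) (k l : n) (hkl : k ≠ l) :
    single k l (1 : ℂ) ∈ suComplexify I := by
  have step (i j : n) (hij : i ≠ j) (h : single i j (1 : ℂ) ∈ suComplexify I) (l : n)
      (hl : l ≠ j) : single j l (1 : ℂ) ∈ suComplexify I := by
    refine single_mem_of_entry_ne I (lie_mem_suComplexify I (single l i 1) h) hl.symm ?_
    rw [single_mul_single_same, Matrix.sub_apply, single_apply_same]
    by_cases hli : j = l
    · exact absurd hli.symm hl
    · rw [single_mul_single_of_ne _ _ _ _ (Ne.symm hl)]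
      simp
  by_cases hk : k = j
  · subst hk
    exact step i k hij h l hkl.symm
  · exact step j k (Ne.symm hk) (step i j hij h k hk) l hkl.symm

theorem traceless_mem (I : LieIdeal ℝ (suLie n))
    (h : ∀ k l, k ≠ l → single k l (1 : ℂ) ∈ suComplexify I) {Z : Matrix n n ℂ}
    (hZ : Z.trace = 0) : Z ∈ suComplexify I := by
  obtain ⟨o⟩ := ‹Nonempty n›
  have hd (k : n) : single k k (1 : ℂ) - single o o 1 ∈ suComplexify I := by
    by_cases hk : k = o
    · subst hk; rw [sub_self]; exact zero_mem _
    · have := lie_mem_suComplexify I (single k o 1) (h o k (Ne.symm hk))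
      rwa [single_mul_single_same, single_mul_single_same, mul_one] at this
  -- Subtracting the corner `E_oo` on the diagonal costs `tr Z` times `E_oo`, which is zero.
  have hs : Z = ∑ i, ∑ j, Z i j • (single i j (1 : ℂ) - if i = j then single o o 1 else 0) := by
    simp only [smul_sub, Finset.sum_sub_distrib]
    have e1 : ∑ i, ∑ j, Z i j • (if i = j then single o o (1 : ℂ) else 0) =
        Z.trace • single o o (1 : ℂ) := by
      simp [trace, Finset.sum_smul]
    rw [e1, hZ, zero_smul, sub_zero]
    conv_lhs => rw [matrix_eq_sum_single Z]
    simp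
  rw [hs]
  refine sum_mem fun i _ => sum_mem fun j _ => Submodule.smul_mem _ _ ?_
  split_ifs with hij
  · subst hij; exact hd i
  · rw [sub_zero]; exact h i j hij

theorem suLie_isSimple [Nontrivial n] : LieAlgebra.IsSimple ℝ (suLie n) where
  eq_bot_or_eq_top I := by
    by_cases hI : I = ⊥
    · exact Or.inl hI
    right
    rw [LieSubmodule.eq_bot_iff] at hI
    push Not at hI
    obtain ⟨X, hX, hX0⟩ := hI
    have hXm : (X : Matrix n n ℂ) ∈ suComplexify I := ⟨X, hX, 0, zero_mem _, by simp⟩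
    obtain ⟨i, j, hij, hs⟩ := exists_single_mem I hXm (by simpa using hX0) X.2.2
    rw [eq_top_iff]
    intro Z _
    obtain ⟨A, hA, B, hB, hZ⟩ := traceless_mem I (all_single_mem I hij hs) Z.2.2
    -- The complexified ideal contains every traceless matrix. For `Z = A + iB` in `su(n)`, taking
    -- adjoints forces `B = 0`, so `Z` lies in the ideal itself.
    have h1 := congrArg conjTranspose hZ
    rw [conjTranspose_add, conjTranspose_smul, Z.2.1, A.2.1, B.2.1, hZ] at h1
    have hB0 : (B : Matrix n n ℂ) = 0 := by
      have h2 : Complex.I • (B : Matrix n n ℂ) = - (Complex.I • (B : Matrix n n ℂ)) := by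
        simp only [Complex.star_def, Complex.conj_I, smul_neg, neg_smul, neg_neg, neg_add] at h1
        exact (add_left_cancel h1).symm
      have h3 : (2 : ℂ) • Complex.I • (B : Matrix n n ℂ) = 0 := by
        rw [two_smul]
        nth_rewrite 1 [h2]
        exact neg_add_cancel _
      exact (smul_eq_zero.1 ((smul_eq_zero.1 h3).resolve_left two_ne_zero)).resolve_left
        Complex.I_ne_zero
    rw [hB0, smul_zero, add_zero] at hZ
    rwa [Subtype.ext hZ]
  non_abelian := by
    intro hab
    obtain ⟨i, j, hij⟩ := exists_pair_ne n
    let X : suLie n := ⟨single i j 1 - single j i 1, by simp [conjTranspose_single],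
      by simp [hij, hij.symm]⟩
    let Y : suLie n := ⟨Complex.I • (single i i 1 - single j j 1), by simp [conjTranspose_single],
      by simp⟩
    have h := congrArg (fun Z : suLie n => (Z : Matrix n n ℂ) i j) (hab.trivial X Y)
    simp [LieSubalgebra.coe_bracket, X, Y, Ring.lie_def, mul_sub, sub_mul, hij, hij.symm] at h
    have h2 := congrArg Complex.im h
    norm_num at h2
end SpecialUnitarySimple

/-! ### Orthonormal bases adapted to a subalgebra -/

/-- A positive definite form on a finite-dimensional Lie algebra has an orthonormal basis adapted
to a subalgebra and its orthogonal complement. -/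
theorem exists_adaptedBasis {g : Type} [LieRing g] [LieAlgebra ℝ g] [FiniteDimensional ℝ g]
    {γ : LinearMap.BilinForm ℝ g} (hγ : IsInvariantMetric γ) (h : LieSubalgebra ℝ g) :
    ∃ (I P : Type) (_ : Fintype I) (_ : Fintype P) (T : Module.Basis (I ⊕ P) ℝ g),
      IsAdaptedBasis γ h (γ.orthogonal h.toSubmodule) T := by
  let core : InnerProductSpace.Core ℝ g :=
    { inner := fun x y => γ x y
      conj_inner_symm := fun x y => by simpa using hγ.symm y x
      re_inner_nonneg := fun x => by
        by_cases hx : x = 0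
        · simp [hx]
        · simpa using (hγ.pos x hx).le
      add_left := fun x y z => by simp
      smul_left := fun x y r => by simp
      definite := fun x hx => by
        by_contra hne
        exact (hγ.pos x hne).ne' hx }
  let _ : NormedAddCommGroup g := core.toNormedAddCommGroup
  let _ : InnerProductSpace ℝ g := InnerProductSpace.ofCore core.toCore
  have hin (x y : g) : inner ℝ x y = γ x y := rfl
  let K : Submodule ℝ g := h.toSubmodule
  let b₁ := stdOrthonormalBasis ℝ K
  let b₂ := stdOrthonormalBasis ℝ Kᗮ
  have hK (x : g) : x ∈ Kᗮ ↔ x ∈ γ.orthogonal h.toSubmodule := Iff.rfl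
  let T := (b₁.toBasis.prod b₂.toBasis).map
    (Submodule.prodEquivOfIsCompl K Kᗮ (Submodule.isCompl_orthogonal K))
  have T1 (i) : T (Sum.inl i) = b₁ i := by simp [T]
  have T2 (i) : T (Sum.inr i) = b₂ i := by simp [T]
  refine ⟨_, _, inferInstance, inferInstance, T, ?_, ?_, ?_, ?_⟩
  · rintro (i | i)
    · rw [T1, ← hin]
      exact (orthonormal_iff_ite.1 b₁.orthonormal i i).trans (if_pos rfl)
    · rw [T2, ← hin]
      exact (orthonormal_iff_ite.1 b₂.orthonormal i i).trans (if_pos rfl)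
  · rintro (i | i) (j | j) hij
    · have hij' : i ≠ j := fun e => hij (by rw [e])
      rw [T1, T1, ← hin]
      exact (orthonormal_iff_ite.1 b₁.orthonormal i j).trans (if_neg hij')
    · rw [T1, T2, ← hin]
      exact (Submodule.mem_orthogonal K _).1 (b₂ j).2 _ (b₁ i).2
    · rw [T1, T2, ← hin, real_inner_comm]
      exact (Submodule.mem_orthogonal K _).1 (b₂ i).2 _ (b₁ j).2
    · have hij' : i ≠ j := fun e => hij (by rw [e])
      rw [T2, T2, ← hin]
      exact (orthonormal_iff_ite.1 b₂.orthonormal i j).trans (if_neg hij')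
  · intro i
    rw [T1]
    exact (b₁ i).2
  · intro i
    rw [T2, ← hK]
    exact (b₂ i).2

/-! ### The trace metric on `su(n)` and completeness relations -/

section SpecialUnitaryMetric

open Matrix

attribute [local instance] LieRing.ofAssociativeRing

variable {n : Type*} [Fintype n] [DecidableEq n]

/-- The invariant metric `-tr(xy)` on `su(n)`. -/
noncomputable def suMetric (n : Type*) [Fintype n] [DecidableEq n] :
    LinearMap.BilinForm ℝ (suLie n) :=
  LinearMap.mk₂ ℝ (fun x y => -((x : Matrix n n ℂ) * (y : Matrix n n ℂ)).trace.re)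
    (fun x y z => by simp [add_mul]; ring) (fun c x y => by simp)
    (fun x y z => by simp [mul_add]; ring) (fun c x y => by simp)

theorem suMetric_apply (x y : suLie n) :
    suMetric n x y = -((x : Matrix n n ℂ) * (y : Matrix n n ℂ)).trace.re := rfl

/-- The trace of a product of two skew-Hermitian matrices is real, so the real part in the metric
loses nothing. -/
theorem suMetric_trace (x y : suLie n) :
    ((x : Matrix n n ℂ) * (y : Matrix n n ℂ)).trace = -(suMetric n x y : ℂ) := by
  have h : star ((x : Matrix n n ℂ) * (y : Matrix n n ℂ)).trace =
      ((x : Matrix n n ℂ) * (y : Matrix n n ℂ)).trace := by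
    rw [← trace_conjTranspose, conjTranspose_mul, x.2.1, y.2.1, neg_mul_neg, trace_mul_comm]
  have := Complex.conj_eq_iff_re.1 h
  rw [suMetric_apply, Complex.ofReal_neg, neg_neg, this]

theorem suMetric_isInvariant : IsInvariantMetric (suMetric n) where
  symm x y := by rw [suMetric_apply, suMetric_apply, trace_mul_comm]
  pos x hx := by
    have h1 : suMetric n x x = ∑ i, ∑ j, Complex.normSq ((x : Matrix n n ℂ) i j) := by
      have : (x : Matrix n n ℂ) * x = -((x : Matrix n n ℂ) * (x : Matrix n n ℂ)ᴴ) := by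
        rw [x.2.1, mul_neg, neg_neg]
      rw [suMetric_apply, this]
      simp [trace, mul_apply, Complex.mul_conj]
    have h0 : (x : Matrix n n ℂ) ≠ 0 := by simpa using hx
    have h2 : ∃ i j, (x : Matrix n n ℂ) i j ≠ 0 := by
      by_contra hc
      push Not at hc
      exact h0 (by ext i j; exact hc i j)
    obtain ⟨i, j, hij⟩ := h2
    rw [h1]
    refine Finset.sum_pos' (fun i _ => Finset.sum_nonneg fun j _ => Complex.normSq_nonneg _)
      ⟨i, Finset.mem_univ _, Finset.sum_pos' (fun j _ => Complex.normSq_nonneg _)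
        ⟨j, Finset.mem_univ _, Complex.normSq_pos.2 hij⟩⟩
  invariant x y z := by
    rw [suMetric_apply, suMetric_apply, LieSubalgebra.coe_bracket, LieSubalgebra.coe_bracket,
      Ring.lie_def, Ring.lie_def, sub_mul, mul_sub, trace_sub, trace_sub, mul_assoc, mul_assoc,
      trace_mul_comm (y : Matrix n n ℂ) ((x : Matrix n n ℂ) * z), mul_assoc]

/-- A map which is linear for the real scalars, viewed as complex scalars. -/
def realLinearMap {g B : Type*} [AddCommGroup g] [Module ℝ g] [Ring B] [Algebra ℂ B] (F : g → B)
    (hadd : ∀ x y, F (x + y) = F x + F y) (hsmul : ∀ (c : ℝ) x, F (c • x) = (c : ℂ) • F x) :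
    g →ₗ[ℝ] B where
  toFun := F
  map_add' := hadd
  map_smul' c x := by rw [hsmul, Complex.coe_smul]; rfl

/-- The inclusion of `su(n)` into the complex matrices. -/
noncomputable def suIncl (n : Type*) [Fintype n] [DecidableEq n] :=
  realLinearMap (g := suLie n) (B := Matrix n n ℂ) (fun x => x) (fun _ _ => rfl)
    (fun c x => by ext i j; simp)

theorem suIncl_apply (x : suLie n) : suIncl n x = x := rfl

theorem suLie_sum_smul {ι : Type*} [Fintype ι] {T : Module.Basis ι ℝ (suLie n)}
    (hT : IsMetricBasis (suMetric n) T) (A : suLie n) :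
    ∑ a, ((T a : Matrix n n ℂ) * A).trace • (T a : Matrix n n ℂ) = -A := by
  have := hT.sum_smul_map (suIncl n) A
  simp only [suIncl_apply] at this
  simp only [suMetric_trace, neg_smul, Finset.sum_neg_distrib, Complex.coe_smul,
    hT.metric.symm _ A]
  rw [← this]

/-- The expansion in an orthonormal basis, extended complex-linearly: on traceless matrices it is
minus the identity, and scalars are killed. -/
theorem suLie_completeness {ι : Type*} [Fintype ι] {T : Module.Basis ι ℝ (suLie n)} [Nonempty n]
    (hT : IsMetricBasis (suMetric n) T) (Z : Matrix n n ℂ) :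
    ∑ a, ((T a : Matrix n n ℂ) * Z).trace • (T a : Matrix n n ℂ) =
      -(Z - (Z.trace / Fintype.card n) • (1 : Matrix n n ℂ)) := by
  have hn : (Fintype.card n : ℂ) ≠ 0 := by exact_mod_cast Fintype.card_ne_zero
  obtain ⟨A, hA, B, hB, hZ⟩ := exists_suLie_decomp Z
  have e1 := suLie_sum_smul hT ⟨A, hA⟩
  have e2 := suLie_sum_smul hT ⟨B, hB⟩
  have e3 (a : ι) : (T a : Matrix n n ℂ).trace = 0 := (T a).2.2
  conv_lhs => rw [hZ]
  simp only [mul_add, mul_smul_comm, mul_one, trace_add, trace_smul, e3, smul_zero, zero_add,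
    add_smul, Finset.sum_add_distrib, smul_assoc, ← Finset.smul_sum, e1, e2]
  conv_rhs => rw [hZ]
  simp only [trace_add, trace_smul, hA.2, hB.2, trace_one, smul_eq_mul, mul_zero, add_zero,
    div_mul_cancel₀ _ hn]
  module

/-- The diagonal matrices in `su(n)`. -/
def suTorus (n : Type*) [Fintype n] [DecidableEq n] : LieSubalgebra ℝ (suLie n) where
  carrier := {x | (x : Matrix n n ℂ).IsDiag}
  add_mem' h1 h2 := h1.add h2
  zero_mem' := isDiag_zero
  smul_mem' c _ h := h.smul c
  lie_mem' := by
    intro x y h1 h2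
    have h1' : (x : Matrix n n ℂ).IsDiag := h1
    have h2' : (y : Matrix n n ℂ).IsDiag := h2
    change (⁅x, y⁆ : suLie n).1.IsDiag
    rw [LieSubalgebra.coe_bracket, Ring.lie_def, ← h1'.diagonal_diag, ← h2'.diagonal_diag,
      diagonal_mul_diagonal, diagonal_mul_diagonal]
    exact (isDiag_diagonal _).sub (isDiag_diagonal _)

theorem suTorus_completeness {I P : Type*} [Fintype I] [Fintype P]
    {T : Module.Basis (I ⊕ P) ℝ (suLie n)} [Nonempty n]
    (hT : IsAdaptedBasis (suMetric n) (suTorus n) ((suMetric n).orthogonal (suTorus n).toSubmodule)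
      T) (Z : Matrix n n ℂ) :
    ∑ i, ((T (Sum.inl i) : Matrix n n ℂ) * Z).trace • (T (Sum.inl i) : Matrix n n ℂ) =
      -(diagonal Z.diag - (Z.trace / Fintype.card n) • (1 : Matrix n n ℂ)) := by
  have hn : (Fintype.card n : ℂ) ≠ 0 := by exact_mod_cast Fintype.card_ne_zero
  have key (A : Matrix n n ℂ) (hA : A ∈ suLie n) :
      ∑ i, ((T (Sum.inl i) : Matrix n n ℂ) * A).trace • (T (Sum.inl i) : Matrix n n ℂ) =
        -diagonal A.diag := by
    have hD : diagonal A.diag ∈ suLie n := by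
      refine ⟨?_, by rw [trace_diagonal]; exact hA.2⟩
      have h1 : diagonal (Aᴴ).diag = -diagonal A.diag := by rw [hA.1, diag_neg, diagonal_neg]; rfl
      rw [diagonal_conjTranspose, ← h1]
      rfl
    set D : suLie n := ⟨diagonal A.diag, hD⟩
    have hDt : D ∈ suTorus n := isDiag_diagonal _
    have h2 := suLie_sum_smul (hT.isMetricBasis suMetric_isInvariant) D
    rw [Fintype.sum_sum_type] at h2
    -- The `k`-part of the basis is orthogonal to the torus, so only the `h`-indices expand `D`.
    have h3 (p : P) : ((T (Sum.inr p) : Matrix n n ℂ) * (D : Matrix n n ℂ)).trace = 0 := by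
      have : suMetric n D (T (Sum.inr p)) = 0 := hT.mem_k p D hDt
      rw [suMetric_trace, suMetric_isInvariant.symm, this]
      simp
    simp only [h3, zero_smul, Finset.sum_const_zero, add_zero] at h2
    rw [← show (D : Matrix n n ℂ) = diagonal A.diag from rfl, ← h2]
    refine Finset.sum_congr rfl fun i _ => ?_
    have h4 : (T (Sum.inl i) : Matrix n n ℂ).IsDiag := hT.mem_h i
    congr 1
    rw [← h4.diagonal_diag]
    simp [trace, D]
  obtain ⟨A, hA, B, hB, hZ⟩ := exists_suLie_decomp Z
  have e3 (a) : (T a : Matrix n n ℂ).trace = 0 := (T a).2.2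
  conv_lhs => rw [hZ]
  simp only [mul_add, mul_smul_comm, mul_one, trace_add, trace_smul, e3, smul_zero, zero_add,
    add_smul, Finset.sum_add_distrib, smul_assoc, ← Finset.smul_sum, key A hA, key B hB]
  have h5 : diagonal Z.diag = (Z.trace / Fintype.card n) • (1 : Matrix n n ℂ) + diagonal A.diag
      + Complex.I • diagonal B.diag := by
    conv_lhs => rw [hZ]
    ext i j
    by_cases hij : i = j
    · subst hij; simp
    · simp [hij]
  rw [h5]
  module

end SpecialUnitaryMetric

/-! ### Contractions with matrix units -/

section MatrixUnits

open Matrix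

variable {n : Type*} [Fintype n] [DecidableEq n]

theorem sum_single_mul_mul_single (A : Matrix n n ℂ) :
    ∑ p : n × n, single p.1 p.2 (1 : ℂ) * A * single p.2 p.1 (1 : ℂ) = A.trace • 1 := by
  ext i j
  rw [Fintype.sum_prod_type]
  simp [Matrix.sum_apply, single_mul_mul_single, single_apply, trace, Matrix.one_apply,
    Finset.sum_ite_eq, ite_and]

theorem sum_single_mul_mul_single' (A : Matrix n n ℂ) :
    ∑ p : n × n, single p.2 p.1 (1 : ℂ) * A * single p.1 p.2 (1 : ℂ) = A.trace • 1 := by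
  rw [← sum_single_mul_mul_single A]
  exact (Equiv.prodComm n n).sum_comp fun p => single p.1 p.2 (1 : ℂ) * A * single p.2 p.1 (1 : ℂ)

theorem sum_trace_mul_single_smul (A : Matrix n n ℂ) :
    ∑ p : n × n, (A * single p.2 p.1 (1 : ℂ)).trace • single p.1 p.2 (1 : ℂ) = A := by
  conv_rhs => rw [matrix_eq_sum_single A]
  rw [Fintype.sum_prod_type]
  simp [trace_mul_single]

theorem sum_trace_mul_single_smul' (A : Matrix n n ℂ) :
    ∑ p : n × n, (A * single p.1 p.2 (1 : ℂ)).trace • single p.2 p.1 (1 : ℂ) = A := by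
  conv_rhs => rw [← sum_trace_mul_single_smul A]
  exact (Equiv.prodComm n n).sum_comp fun p =>
    (A * single p.2 p.1 (1 : ℂ)).trace • single p.1 p.2 (1 : ℂ)

/-- The commutator of `z` with a matrix unit. -/
def lieSingle (z : Matrix n n ℂ) (p : n × n) : Matrix n n ℂ :=
  z * single p.1 p.2 (1 : ℂ) - single p.1 p.2 (1 : ℂ) * z

/-- The matrix unit dual to that of `p` for the trace form. -/
abbrev dualSingle (p : n × n) : Matrix n n ℂ := single p.2 p.1 (1 : ℂ)

theorem trace_lieSingle (z : Matrix n n ℂ) (p : n × n) : (lieSingle z p).trace = 0 := by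
  rw [lieSingle, trace_sub, trace_mul_comm, sub_self]

theorem sum_lieSingle_mul (z A : Matrix n n ℂ) :
    ∑ p, lieSingle z p * A * dualSingle p = A.trace • z - (z * A).trace • 1 := by
  have : ∑ p, lieSingle z p * A * dualSingle p =
      z * (∑ p : n × n, single p.1 p.2 (1 : ℂ) * A * single p.2 p.1 (1 : ℂ)) -
      ∑ p : n × n, single p.1 p.2 (1 : ℂ) * (z * A) * single p.2 p.1 (1 : ℂ) := by
    rw [Finset.mul_sum, ← Finset.sum_sub_distrib]
    refine Finset.sum_congr rfl fun p _ => ?_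
    rw [lieSingle, dualSingle]
    noncomm_ring
  rw [this, sum_single_mul_mul_single, sum_single_mul_mul_single, mul_smul_comm, mul_one]

theorem sum_mul_lieSingle (z A : Matrix n n ℂ) :
    ∑ p, dualSingle p * A * lieSingle z p = (A * z).trace • 1 - A.trace • z := by
  have : ∑ p, dualSingle p * A * lieSingle z p =
      (∑ p : n × n, single p.2 p.1 (1 : ℂ) * (A * z) * single p.1 p.2 (1 : ℂ)) -
      (∑ p : n × n, single p.2 p.1 (1 : ℂ) * A * single p.1 p.2 (1 : ℂ)) * z := by
    rw [Finset.sum_mul, ← Finset.sum_sub_distrib]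
    refine Finset.sum_congr rfl fun p _ => ?_
    rw [lieSingle, dualSingle]
    noncomm_ring
  rw [this, sum_single_mul_mul_single', sum_single_mul_mul_single', smul_mul_assoc, one_mul]

theorem sum_trace_dualSingle_smul (y A : Matrix n n ℂ) :
    ∑ p, (A * dualSingle p).trace • lieSingle y p = y * A - A * y := by
  conv_rhs => rw [← sum_trace_mul_single_smul A]
  rw [Finset.mul_sum, Finset.sum_mul, ← Finset.sum_sub_distrib]
  simp only [lieSingle, smul_sub, smul_mul_assoc, mul_smul_comm]

theorem sum_trace_lieSingle_smul (y A : Matrix n n ℂ) :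
    ∑ p, (A * lieSingle y p).trace • dualSingle p = A * y - y * A := by
  conv_rhs => rw [← sum_trace_mul_single_smul' (A * y - y * A)]
  refine Finset.sum_congr rfl fun p _ => ?_
  congr 1
  rw [lieSingle, mul_sub, sub_mul, trace_sub, trace_sub, ← mul_assoc, ← mul_assoc, mul_assoc y,
    trace_mul_comm y]

end MatrixUnits

/-! ### Vanishing of the Serre cubic on traceless matrices -/

section MatrixSerre

open Matrix

variable {n : Type*} [Fintype n] [DecidableEq n]

/-- The commutator of `[u, v]` with `x`. -/
def doubleLie (x u v : Matrix n n ℂ) : Matrix n n ℂ :=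
  (u * v - v * u) * x - x * (u * v - v * u)

variable {x z : Matrix n n ℂ} (hx : x.trace = 0) (hz : z.trace = 0)
  (u s : Matrix n n ℂ) (hu : u.trace = 0)

/-- First of six inner sums, one for each order of the three factors in `symm3`. Here `s` stands for
the matrix unit of the outer index, and each sum splits into pieces handled by `sum_lieSingle_mul`
or `sum_mul_lieSingle`. -/
theorem sum_doubleLie_mul_dual :
    ∑ r, doubleLie x u (lieSingle z r) * s * dualSingle r =
      (x * s).trace • (u * z) - (z * x * s).trace • u - (u * x * s).trace • z
        + (z * u * x * s).trace • 1 - s.trace • (x * u * z) + (z * s).trace • (x * u)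
        + (u * s).trace • (x * z) - (z * u * s).trace • x := by
  have : ∑ r, doubleLie x u (lieSingle z r) * s * dualSingle r =
      u * (∑ r, lieSingle z r * (x * s) * dualSingle r)
      - ∑ r, lieSingle z r * (u * x * s) * dualSingle r
      - x * u * (∑ r, lieSingle z r * s * dualSingle r)
      + x * (∑ r, lieSingle z r * (u * s) * dualSingle r) := by
    simp only [Finset.mul_sum, ← Finset.sum_sub_distrib, ← Finset.sum_add_distrib]
    refine Finset.sum_congr rfl fun r _ => ?_
    rw [doubleLie]
    noncomm_ring
  rw [this]
  simp only [sum_lieSingle_mul]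
  simp only [mul_sub, mul_smul_comm, mul_one, ← mul_assoc]
  module

include hx hz hu in
theorem sum_doubleLie_dual_mul :
    ∑ r, doubleLie x u (lieSingle z r) * dualSingle r * s =
      -(z * x).trace • (u * s) - (x * u).trace • (z * s) + (x * z * u).trace • s
        - (Fintype.card n : ℂ) • (x * u * z * s) - (z * u).trace • (x * s) := by
  have : ∑ r, doubleLie x u (lieSingle z r) * dualSingle r * s =
      u * (∑ r, lieSingle z r * x * dualSingle r) * s
      - (∑ r, lieSingle z r * (u * x) * dualSingle r) * s
      - x * u * (∑ r, lieSingle z r * 1 * dualSingle r) * s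
      + x * (∑ r, lieSingle z r * u * dualSingle r) * s := by
    simp only [Finset.mul_sum, Finset.sum_mul, ← Finset.sum_sub_distrib, ← Finset.sum_add_distrib]
    refine Finset.sum_congr rfl fun r _ => ?_
    rw [doubleLie]
    noncomm_ring
  rw [this, trace_mul_comm x u, mul_assoc x z u, trace_mul_comm x (z * u)]
  simp only [sum_lieSingle_mul]
  simp only [mul_sub, sub_mul, mul_smul_comm, smul_mul_assoc, mul_one, one_mul, mul_zero, zero_mul,
    ← mul_assoc, hx, hz, hu, trace_one, zero_smul]
  module

include hx hz hu in
theorem sum_mul_doubleLie_dual :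
    ∑ r, s * doubleLie x u (lieSingle z r) * dualSingle r =
      -(z * x).trace • (s * u) - (x * u).trace • (s * z) + (x * z * u).trace • s
        - (Fintype.card n : ℂ) • (s * x * u * z) - (z * u).trace • (s * x) := by
  have : ∑ r, s * doubleLie x u (lieSingle z r) * dualSingle r =
      s * u * (∑ r, lieSingle z r * x * dualSingle r)
      - s * (∑ r, lieSingle z r * (u * x) * dualSingle r)
      - s * x * u * (∑ r, lieSingle z r * 1 * dualSingle r)
      + s * x * (∑ r, lieSingle z r * u * dualSingle r) := by
    simp only [Finset.mul_sum, Finset.sum_mul, ← Finset.sum_sub_distrib, ← Finset.sum_add_distrib]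
    refine Finset.sum_congr rfl fun r _ => ?_
    rw [doubleLie]
    noncomm_ring
  rw [this, trace_mul_comm x u, mul_assoc x z u, trace_mul_comm x (z * u)]
  simp only [sum_lieSingle_mul]
  simp only [mul_sub, sub_mul, mul_smul_comm, smul_mul_assoc, mul_one, one_mul, mul_zero, zero_mul,
    ← mul_assoc, hx, hz, hu, trace_one, zero_smul]
  module

include hx hz hu in
theorem sum_dual_doubleLie_mul :
    ∑ r, dualSingle r * doubleLie x u (lieSingle z r) * s =
      (z * u).trace • (x * s) + (Fintype.card n : ℂ) • (z * u * x * s)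
        - (z * x * u).trace • s + (x * u).trace • (z * s) + (z * x).trace • (u * s) := by
  have : ∑ r, dualSingle r * doubleLie x u (lieSingle z r) * s =
      (∑ r, dualSingle r * u * lieSingle z r) * x * s
      - (∑ r, dualSingle r * 1 * lieSingle z r) * u * x * s
      - (∑ r, dualSingle r * (x * u) * lieSingle z r) * s
      + (∑ r, dualSingle r * x * lieSingle z r) * u * s := by
    simp only [Finset.mul_sum, Finset.sum_mul, ← Finset.sum_sub_distrib, ← Finset.sum_add_distrib]
    refine Finset.sum_congr rfl fun r _ => ?_
    rw [doubleLie]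
    noncomm_ring
  rw [this, trace_mul_comm z u, trace_mul_comm z x, mul_assoc z x u, trace_mul_comm z (x * u)]
  simp only [sum_mul_lieSingle]
  simp only [mul_sub, sub_mul, mul_smul_comm, smul_mul_assoc, mul_one, one_mul, mul_zero, zero_mul,
    ← mul_assoc, hx, hz, hu, trace_one, zero_smul]
  module

include hx hz hu in
theorem sum_mul_dual_doubleLie :
    ∑ r, s * dualSingle r * doubleLie x u (lieSingle z r) =
      (z * u).trace • (s * x) + (Fintype.card n : ℂ) • (s * z * u * x)
        - (z * x * u).trace • s + (x * u).trace • (s * z) + (z * x).trace • (s * u) := by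
  have : ∑ r, s * dualSingle r * doubleLie x u (lieSingle z r) =
      s * (∑ r, dualSingle r * u * lieSingle z r) * x
      - s * (∑ r, dualSingle r * 1 * lieSingle z r) * u * x
      - s * (∑ r, dualSingle r * (x * u) * lieSingle z r)
      + s * (∑ r, dualSingle r * x * lieSingle z r) * u := by
    simp only [Finset.mul_sum, Finset.sum_mul, ← Finset.sum_sub_distrib, ← Finset.sum_add_distrib]
    refine Finset.sum_congr rfl fun r _ => ?_
    rw [doubleLie]
    noncomm_ring
  rw [this, trace_mul_comm z u, trace_mul_comm z x, mul_assoc z x u, trace_mul_comm z (x * u)]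
  simp only [sum_mul_lieSingle]
  simp only [mul_sub, sub_mul, mul_smul_comm, smul_mul_assoc, mul_one, one_mul, mul_zero, zero_mul,
    ← mul_assoc, hx, hz, hu, trace_one, zero_smul]
  module

theorem sum_dual_mul_doubleLie :
    ∑ r, dualSingle r * s * doubleLie x u (lieSingle z r) =
      (s * u * z).trace • x - (s * u).trace • (z * x) - (z * s).trace • (u * x)
        + s.trace • (z * u * x) - (s * x * u * z).trace • 1 + (s * x * u).trace • z
        + (x * z * s).trace • u - (x * s).trace • (z * u) := by
  have : ∑ r, dualSingle r * s * doubleLie x u (lieSingle z r) =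
      (∑ r, dualSingle r * (s * u) * lieSingle z r) * x
      - (∑ r, dualSingle r * s * lieSingle z r) * u * x
      - (∑ r, dualSingle r * (s * x * u) * lieSingle z r)
      + (∑ r, dualSingle r * (s * x) * lieSingle z r) * u := by
    simp only [Finset.mul_sum, Finset.sum_mul, ← Finset.sum_sub_distrib, ← Finset.sum_add_distrib]
    refine Finset.sum_congr rfl fun r _ => ?_
    rw [doubleLie]
    noncomm_ring
  rw [this, trace_mul_comm z s, trace_mul_comm x s, trace_mul_comm (x * z) s]
  simp only [sum_mul_lieSingle]
  simp only [mul_sub, sub_mul, mul_smul_comm, smul_mul_assoc, mul_one, one_mul, mul_zero, zero_mul,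
    ← mul_assoc]
  module

variable {y : Matrix n n ℂ} (hy : y.trace = 0)

-- The six double sums that start here carry out the outer summation for the same six orders.
-- Individually they do not vanish identically; only their total is claimed to be zero.
include hx hy hz in
theorem double_sum_doubleLie_mul_dual :
    ∑ q, ∑ r, doubleLie x (lieSingle y q) (lieSingle z r) * dualSingle q * dualSingle r =
      (y * x - x * y) * z - (y * (z * x) - z * x * y) + ((Fintype.card n : ℂ) * (x * y).trace) • z
        + x * (y * z - z * y)
        - ((Fintype.card n : ℂ) * (y * z).trace) • x := by
  have : ∑ q, ∑ r, doubleLie x (lieSingle y q) (lieSingle z r) * dualSingle q * dualSingle r =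
      (∑ q, (x * dualSingle q).trace • lieSingle y q) * z - (∑ q,
        (z * x * dualSingle q).trace • lieSingle y q)
        - (∑ q, lieSingle y q * x * dualSingle q).trace • z + (z * (∑ q,
        lieSingle y q * x * dualSingle q)).trace • 1
        - x * (∑ q, (1 * dualSingle q).trace • lieSingle y q) * z + x * (∑ q,
        (z * dualSingle q).trace • lieSingle y q)
        + (∑ q, lieSingle y q * 1 * dualSingle q).trace • (x * z) - (z * (∑ q,
        lieSingle y q * 1 * dualSingle q)).trace • x := by
    simp only [sum_doubleLie_mul_dual]
    simp only [Finset.mul_sum, Finset.sum_mul, trace_sum, Finset.sum_smul, Finset.smul_sum,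
      ← Finset.sum_sub_distrib, ← Finset.sum_add_distrib, ← Finset.sum_neg_distrib]
    refine Finset.sum_congr rfl fun q _ => ?_
    simp only [mul_one, one_mul, mul_assoc, smul_mul_assoc, mul_smul_comm, neg_smul]
  rw [this]
  simp only [sum_lieSingle_mul, sum_mul_lieSingle, sum_trace_dualSingle_smul,
    sum_trace_lieSingle_smul]
  simp only [mul_sub, sub_mul, mul_add, add_mul, mul_smul_comm, smul_mul_assoc, mul_one, one_mul,
    mul_zero, zero_mul, trace_sub, trace_smul, trace_one, hx, hy, hz, ← mul_assoc, smul_eq_mul,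
    zero_smul, smul_zero, sub_zero, zero_sub, mul_neg, neg_mul, neg_smul, trace_neg, neg_zero,
    trace_mul_comm y x, trace_mul_comm z y, trace_mul_comm z x]
  module

include hx hy hz in
theorem double_sum_doubleLie_dual_mul :
    ∑ q, ∑ r, doubleLie x (lieSingle y q) (lieSingle z r) * dualSingle r * dualSingle q =
      -((Fintype.card n : ℂ) * (x * z).trace) • y - z * (x * y - y * x)
        + (x * z * y - y * (x * z)) + ((Fintype.card n : ℂ) * (y * z).trace) • x
        - x * (z * y - y * z) := by
  have : ∑ q, ∑ r, doubleLie x (lieSingle y q) (lieSingle z r) * dualSingle r * dualSingle q =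
      -((z * x).trace • (∑ q, lieSingle y q * 1 * dualSingle q)) - z * (∑ q,
        (x * lieSingle y q).trace • dualSingle q)
        + (∑ q, (x * z * lieSingle y q).trace • dualSingle q) - (Fintype.card n : ℂ) • (x * (∑ q,
        lieSingle y q * z * dualSingle q))
        - x * (∑ q, (z * lieSingle y q).trace • dualSingle q) := by
    simp only [sum_doubleLie_dual_mul hx hz _ _ (trace_lieSingle y _)]
    simp only [Finset.mul_sum, Finset.sum_mul, trace_sum, Finset.sum_smul, Finset.smul_sum,
      ← Finset.sum_sub_distrib, ← Finset.sum_add_distrib, ← Finset.sum_neg_distrib]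
    refine Finset.sum_congr rfl fun q _ => ?_
    simp only [mul_one, one_mul, mul_assoc, smul_mul_assoc, mul_smul_comm, neg_smul]
  rw [this]
  simp only [sum_lieSingle_mul, sum_mul_lieSingle, sum_trace_dualSingle_smul,
    sum_trace_lieSingle_smul]
  simp only [mul_sub, sub_mul, mul_add, add_mul, mul_smul_comm, smul_mul_assoc, mul_one, one_mul,
    mul_zero, zero_mul, trace_sub, trace_smul, trace_one, hx, hy, hz, ← mul_assoc, smul_eq_mul,
    zero_smul, smul_zero, sub_zero, zero_sub, mul_neg, neg_mul, neg_smul, trace_neg, neg_zero,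
    trace_mul_comm y x, trace_mul_comm z y, trace_mul_comm z x]
  module

include hx hy hz in
theorem double_sum_mul_doubleLie_dual :
    ∑ q, ∑ r, dualSingle q * doubleLie x (lieSingle y q) (lieSingle z r) * dualSingle r =
      ((Fintype.card n : ℂ) * (x * z).trace) • y - (x * y - y * x) * z + (x * z * y - y * (x * z))
        - ((Fintype.card n : ℂ) * (x * y).trace) • z
        - (z * y - y * z) * x := by
  have : ∑ q, ∑ r, dualSingle q * doubleLie x (lieSingle y q) (lieSingle z r) * dualSingle r =
      -((z * x).trace • (∑ q, dualSingle q * 1 * lieSingle y q)) - (∑ q,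
        (x * lieSingle y q).trace • dualSingle q) * z
        + (∑ q, (x * z * lieSingle y q).trace • dualSingle q) - (Fintype.card n : ℂ) • ((∑ q,
        dualSingle q * x * lieSingle y q) * z)
        - (∑ q, (z * lieSingle y q).trace • dualSingle q) * x := by
    simp only [sum_mul_doubleLie_dual hx hz _ _ (trace_lieSingle y _)]
    simp only [Finset.mul_sum, Finset.sum_mul, trace_sum, Finset.sum_smul, Finset.smul_sum,
      ← Finset.sum_sub_distrib, ← Finset.sum_add_distrib, ← Finset.sum_neg_distrib]
    refine Finset.sum_congr rfl fun q _ => ?_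
    simp only [mul_one, one_mul, mul_assoc, smul_mul_assoc, mul_smul_comm, neg_smul]
  rw [this]
  simp only [sum_lieSingle_mul, sum_mul_lieSingle, sum_trace_dualSingle_smul,
    sum_trace_lieSingle_smul]
  simp only [mul_sub, sub_mul, mul_add, add_mul, mul_smul_comm, smul_mul_assoc, mul_one, one_mul,
    mul_zero, zero_mul, trace_sub, trace_smul, trace_one, hx, hy, hz, ← mul_assoc, smul_eq_mul,
    zero_smul, smul_zero, sub_zero, zero_sub, mul_neg, neg_mul, neg_smul, trace_neg, neg_zero,
    trace_mul_comm y x, trace_mul_comm z y, trace_mul_comm z x]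
  module

include hx hy hz in
theorem double_sum_dual_doubleLie_mul :
    ∑ q, ∑ r, dualSingle r * doubleLie x (lieSingle y q) (lieSingle z r) * dualSingle q =
      x * (z * y - y * z) - ((Fintype.card n : ℂ) * (x * y).trace) • z - (z * x * y - y * (z * x))
        + z * (x * y - y * x)
        + ((Fintype.card n : ℂ) * (x * z).trace) • y := by
  have : ∑ q, ∑ r, dualSingle r * doubleLie x (lieSingle y q) (lieSingle z r) * dualSingle q =
      x * (∑ q, (z * lieSingle y q).trace • dualSingle q) + (Fintype.card n : ℂ) • (z * (∑ q,
        lieSingle y q * x * dualSingle q))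
        - (∑ q, (z * x * lieSingle y q).trace • dualSingle q) + z * (∑ q,
        (x * lieSingle y q).trace • dualSingle q)
        + (z * x).trace • (∑ q, lieSingle y q * 1 * dualSingle q) := by
    simp only [sum_dual_doubleLie_mul hx hz _ _ (trace_lieSingle y _)]
    simp only [Finset.mul_sum, Finset.sum_mul, trace_sum, Finset.sum_smul, Finset.smul_sum,
      ← Finset.sum_sub_distrib, ← Finset.sum_add_distrib, ← Finset.sum_neg_distrib]
    refine Finset.sum_congr rfl fun q _ => ?_
    simp only [mul_one, one_mul, mul_assoc, smul_mul_assoc, mul_smul_comm, neg_smul]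
  rw [this]
  simp only [sum_lieSingle_mul, sum_mul_lieSingle, sum_trace_dualSingle_smul,
    sum_trace_lieSingle_smul]
  simp only [mul_sub, sub_mul, mul_add, add_mul, mul_smul_comm, smul_mul_assoc, mul_one, one_mul,
    mul_zero, zero_mul, trace_sub, trace_smul, trace_one, hx, hy, hz, ← mul_assoc, smul_eq_mul,
    zero_smul, smul_zero, sub_zero, zero_sub, mul_neg, neg_mul, neg_smul, trace_neg, neg_zero,
    trace_mul_comm y x, trace_mul_comm z y, trace_mul_comm z x]
  module

include hx hy hz in
theorem double_sum_mul_dual_doubleLie :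
    ∑ q, ∑ r, dualSingle q * dualSingle r * doubleLie x (lieSingle y q) (lieSingle z r) =
      (z * y - y * z) * x + ((Fintype.card n : ℂ) * (y * z).trace) • x - (z * x * y - y * (z * x))
        + (x * y - y * x) * z
        - ((Fintype.card n : ℂ) * (x * z).trace) • y := by
  have : ∑ q, ∑ r, dualSingle q * dualSingle r * doubleLie x (lieSingle y q) (lieSingle z r) =
      (∑ q, (z * lieSingle y q).trace • dualSingle q) * x + (Fintype.card n : ℂ) • ((∑ q,
        dualSingle q * z * lieSingle y q) * x)
        - (∑ q, (z * x * lieSingle y q).trace • dualSingle q) + (∑ q,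
        (x * lieSingle y q).trace • dualSingle q) * z
        + (z * x).trace • (∑ q, dualSingle q * 1 * lieSingle y q) := by
    simp only [sum_mul_dual_doubleLie hx hz _ _ (trace_lieSingle y _)]
    simp only [Finset.mul_sum, Finset.sum_mul, trace_sum, Finset.sum_smul, Finset.smul_sum,
      ← Finset.sum_sub_distrib, ← Finset.sum_add_distrib, ← Finset.sum_neg_distrib]
    refine Finset.sum_congr rfl fun q _ => ?_
    simp only [mul_one, one_mul, mul_assoc, smul_mul_assoc, mul_smul_comm, neg_smul]
  rw [this]
  simp only [sum_lieSingle_mul, sum_mul_lieSingle, sum_trace_dualSingle_smul,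
    sum_trace_lieSingle_smul]
  simp only [mul_sub, sub_mul, mul_add, add_mul, mul_smul_comm, smul_mul_assoc, mul_one, one_mul,
    mul_zero, zero_mul, trace_sub, trace_smul, trace_one, hx, hy, hz, ← mul_assoc, smul_eq_mul,
    zero_smul, smul_zero, sub_zero, zero_sub, mul_neg, neg_mul, neg_smul, trace_neg, neg_zero,
    trace_mul_comm y x, trace_mul_comm z y, trace_mul_comm z x]
  module

include hx hy hz in
theorem double_sum_dual_mul_doubleLie :
    ∑ q, ∑ r, dualSingle r * dualSingle q * doubleLie x (lieSingle y q) (lieSingle z r) =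
      -((Fintype.card n : ℂ) * (y * z).trace) • x - (y * z - z * y) * x
        + ((Fintype.card n : ℂ) * (x * y).trace) • z + (y * (x * z) - x * z * y)
        - z * (y * x - x * y) := by
  have : ∑ q, ∑ r, dualSingle r * dualSingle q * doubleLie x (lieSingle y q) (lieSingle z r) =
      ((∑ q, dualSingle q * 1 * lieSingle y q) * z).trace • x - (∑ q,
        dualSingle q * 1 * lieSingle y q).trace • (z * x)
        - (∑ q, (z * dualSingle q).trace • lieSingle y q) * x + z * (∑ q,
        (1 * dualSingle q).trace • lieSingle y q) * x
        - ((∑ q, dualSingle q * x * lieSingle y q) * z).trace • 1 + (∑ q,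
        dualSingle q * x * lieSingle y q).trace • z
        + (∑ q, (x * z * dualSingle q).trace • lieSingle y q) - z * (∑ q,
        (x * dualSingle q).trace • lieSingle y q) := by
    simp only [sum_dual_mul_doubleLie]
    simp only [Finset.mul_sum, Finset.sum_mul, trace_sum, Finset.sum_smul, Finset.smul_sum,
      ← Finset.sum_sub_distrib, ← Finset.sum_add_distrib, ← Finset.sum_neg_distrib]
    refine Finset.sum_congr rfl fun q _ => ?_
    simp only [mul_one, one_mul, mul_assoc, smul_mul_assoc, mul_smul_comm, neg_smul]
  rw [this]
  simp only [sum_lieSingle_mul, sum_mul_lieSingle, sum_trace_dualSingle_smul,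
    sum_trace_lieSingle_smul]
  simp only [mul_sub, sub_mul, mul_add, add_mul, mul_smul_comm, smul_mul_assoc, mul_one, one_mul,
    mul_zero, zero_mul, trace_sub, trace_smul, trace_one, hx, hy, hz, ← mul_assoc, smul_eq_mul,
    zero_smul, smul_zero, sub_zero, zero_sub, mul_neg, neg_mul, neg_smul, trace_neg, neg_zero,
    trace_mul_comm y x, trace_mul_comm z y, trace_mul_comm z x]
  module

/-- The right-hand side of the Serre relation, written in matrix units, vanishes on traceless
matrices. -/
theorem sum_symm3_doubleLie_eq_zero (hx : x.trace = 0) (hy : y.trace = 0) (hz : z.trace = 0) :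
    ∑ q, ∑ r, symm3 (doubleLie x (lieSingle y q) (lieSingle z r)) (dualSingle q) (dualSingle r)
        = 0 := by
  simp only [symm3, ← Finset.smul_sum, Finset.sum_add_distrib,
        double_sum_doubleLie_mul_dual hx hz hy, double_sum_doubleLie_dual_mul hx hz hy,
    double_sum_mul_doubleLie_dual hx hz hy, double_sum_dual_doubleLie_mul hx hz hy,
        double_sum_mul_dual_doubleLie hx hz hy, double_sum_dual_mul_doubleLie hx hz hy]
  simp only [mul_sub, sub_mul, ← mul_assoc]
  module

end MatrixSerre

/-! ### The defining representation of `su(n)` as a Yangian representation -/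

section FundamentalRepresentation

open Matrix

attribute [local instance] LieRing.ofAssociativeRing

variable {n : Type*} [Fintype n] [DecidableEq n] {ι : Type*} [Fintype ι]
  {T : Module.Basis ι ℝ (suLie n)}

/-- By completeness `∑ T_a ⊗ T_a` is `-∑ E_ij ⊗ E_ji` up to a multiple of `1 ⊗ 1`; the condition `F
1 1 = 0` discards that multiple. -/
theorem suLie_contract [Nonempty n] {N : Type*} [AddCommGroup N] [Module ℂ N]
    (hT : IsMetricBasis (suMetric n) T) (F : Matrix n n ℂ → Matrix n n ℂ → N)
    (h1 : ∀ s s' t, F (s + s') t = F s t + F s' t) (h2 : ∀ (c : ℂ) s t, F (c • s) t = c • F s t)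
    (h3 : ∀ s t t', F s (t + t') = F s t + F s t') (h4 : ∀ (c : ℂ) s t, F s (c • t) = c • F s t)
    (h0 : F 1 1 = 0) :
    ∑ a, F (T a) (T a) = -∑ p : n × n, F (single p.1 p.2 1) (dualSingle p) := by
  let β : Matrix n n ℂ →ₗ[ℂ] Matrix n n ℂ →ₗ[ℂ] N := LinearMap.mk₂ ℂ F h1 h2 h3 h4
  have e (s t : Matrix n n ℂ) : F s t = β s t := rfl
  have h0' : β 1 1 = 0 := h0
  simp_rw [e]
  have l (a : ι) : β (T a) (T a) = ∑ p : n × n,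
      β (single p.1 p.2 1) (((T a : Matrix n n ℂ) * dualSingle p).trace • (T a : Matrix n n ℂ)) := by
    have := congrArg (β · (T a)) (sum_trace_mul_single_smul (T a : Matrix n n ℂ))
    simp only [map_sum, LinearMap.sum_apply, map_smul, LinearMap.smul_apply] at this
    simp only [map_smul]
    exact this.symm
  simp_rw [l]
  rw [Finset.sum_comm]
  simp_rw [← map_sum, suLie_completeness hT, map_neg, map_sub, map_smul]
  rw [Finset.sum_neg_distrib, Finset.sum_sub_distrib]
  have : ∑ p : n × n, ((dualSingle p).trace / (Fintype.card n : ℂ)) • β (single p.1 p.2 1) 1 =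
      (Fintype.card n : ℂ)⁻¹ • β 1 1 := by
    have h5 := congrArg (β · 1) (sum_trace_mul_single_smul (1 : Matrix n n ℂ))
    simp only [map_sum, LinearMap.sum_apply, map_smul, LinearMap.smul_apply, one_mul] at h5
    rw [← h5, Finset.smul_sum]
    simp only [smul_smul, div_eq_inv_mul]
  rw [this, h0', smul_zero, sub_zero]

theorem serreCubic_eq_double_sum {g B : Type*} [LieRing g] [LieAlgebra ℝ g] [Ring B] [Algebra ℂ B]
    {γ : LinearMap.BilinForm ℝ g} {T : Module.Basis ι ℝ g} (hT : IsMetricBasis γ T)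
    (q : g →ₗ[ℝ] B) (x y z : g) : serreCubic γ T q x y z =
      ∑ b, ∑ c, symm3 (q ⁅⁅⁅y, T b⁆, ⁅z, T c⁆⁆, x⁆) (q (T b)) (q (T c)) := by
  rw [serreCubic, Finset.sum_comm]
  refine Finset.sum_congr rfl fun b _ => ?_
  rw [Finset.sum_comm]
  refine Finset.sum_congr rfl fun c _ => ?_
  let L : g →ₗ[ℝ] B :=
    { toFun := fun a => symm3 (q a) (q (T b)) (q (T c))
      map_add' := fun a a' => by rw [map_add, symm3_add_left]
      map_smul' := fun r a => by rw [map_smul, symm3_smul_left]; rfl }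
  refine Eq.trans ?_ (hT.sum_smul_map L ⁅⁅⁅y, T b⁆, ⁅z, T c⁆⁆, x⁆)
  refine Finset.sum_congr rfl fun a _ => ?_
  rw [hT.metric.invariant _ x, hT.metric.symm]
  rfl

theorem symm3_smul_left_complex {B : Type*} [Ring B] [Algebra ℂ B] (c : ℂ) (x y z : B) :
    symm3 (c • x) y z = c • symm3 x y z := by
  simp only [symm3, smul_mul_assoc, mul_smul_comm, ← smul_add, smul_comm c (1 / 6 : ℂ)]

theorem symm3_smul_right_complex {B : Type*} [Ring B] [Algebra ℂ B] (c : ℂ) (x y z : B) :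
    symm3 x y (c • z) = c • symm3 x y z := by
  simp only [symm3, smul_mul_assoc, mul_smul_comm, ← smul_add, smul_comm c (1 / 6 : ℂ)]

theorem symm3_rotate {B : Type*} [Ring B] [Algebra ℂ B] (x y z : B) :
    symm3 x y z = symm3 x z y := by
  simp only [symm3]; congr 1; abel

/-- Both contractions are rewritten in matrix units. The `1 ⊗ 1` terms drop out because the first
leg enters through a commutator, and the two signs cancel. -/
theorem serreCubic_suIncl [Nonempty n] (hT : IsMetricBasis (suMetric n) T) (x y z : suLie n) :
    serreCubic (suMetric n) T (suIncl n) x y z = 0 := by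
  rw [serreCubic_eq_double_sum hT]
  have hd (b c : ι) : suIncl n ⁅⁅⁅y, T b⁆, ⁅z, T c⁆⁆, x⁆ =
      doubleLie (x : Matrix n n ℂ) ((y : Matrix n n ℂ) * T b - (T b : Matrix n n ℂ) * y)
        ((z : Matrix n n ℂ) * T c - (T c : Matrix n n ℂ) * z) := by
    simp only [suIncl_apply, LieSubalgebra.coe_bracket, Ring.lie_def, doubleLie]
  simp only [hd, suIncl_apply]
  have inner (b : ι) := suLie_contract hT
    (fun s t => symm3 (doubleLie (x : Matrix n n ℂ)
      ((y : Matrix n n ℂ) * T b - (T b : Matrix n n ℂ) * y) (z * s - s * z)) (T b) t)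
    (fun s s' t => by
      rw [← symm3_add_left]; congr 1; simp only [doubleLie]; noncomm_ring)
    (fun c s t => by
      rw [← symm3_smul_left_complex]; congr 1
      simp only [doubleLie, mul_smul_comm, smul_mul_assoc, ← smul_sub])
    (fun s t t' => symm3_add_right _ _ _ _) (fun c s t => symm3_smul_right_complex _ _ _ _)
    (by simp [doubleLie, symm3])
  simp only [inner]
  rw [Finset.sum_neg_distrib, Finset.sum_comm]
  have outer (p : n × n) := suLie_contract hT
    (fun s t => symm3 (doubleLie (x : Matrix n n ℂ) (y * s - s * y) (lieSingle z p)) t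
      (dualSingle p))
    (fun s s' t => by
      rw [← symm3_add_left]; congr 1; simp only [doubleLie]; noncomm_ring)
    (fun c s t => by
      rw [← symm3_smul_left_complex]; congr 1
      simp only [doubleLie, mul_smul_comm, smul_mul_assoc, ← smul_sub])
    (fun s t t' => by simp only [symm3_rotate _ _ (dualSingle p), symm3_add_right])
    (fun c s t => by simp only [symm3_rotate _ _ (dualSingle p), symm3_smul_right_complex])
    (by simp [doubleLie, symm3])
  have key := sum_symm3_doubleLie_eq_zero (x.2.2) (y.2.2) (z.2.2)
  simp only [lieSingle] at outer key
  simp only [outer]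
  rw [Finset.sum_neg_distrib, neg_neg, Finset.sum_comm]
  exact key

/-- The fundamental representation of `su(n)` extends to the Yangian, with `Q₁` acting by zero. -/
theorem suIncl_isYangianPair [Nonempty n] (hT : IsMetricBasis (suMetric n) T) :
    IsYangianPair (suMetric n) T (suIncl n) 0 where
  equivariant :=
    { lie_q := fun x y => by
        simp only [suIncl_apply, LieSubalgebra.coe_bracket, Ring.lie_def]
      lie_J := fun x y => by simp }
  serre a b c := by
    rw [SerreRelation, serreCubic_suIncl hT]
    simp
  sl2 _ a b c d := by
    have h0 (u v : Matrix n n ℂ) : symm3 u v 0 = 0 := by simp [symm3]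
    simp [Sl2Relation, h0]

end FundamentalRepresentation

/-! ### Failure of the co-ideal property for the torus -/

section CoidealFailure

open Matrix

attribute [local instance] LieRing.ofAssociativeRing

variable {I P : Type*} [Fintype I] [Fintype P]

/-- A product of two functionals, the second vanishing on a co-ideal subalgebra, kills its
coproduct. -/
theorem IsLeftCoideal.mul_map_eq_zero {A : Type*} [Ring A] [Algebra ℂ A]
    {Δ : A →ₐ[ℂ] A ⊗[ℂ] A} {S : Subalgebra ℂ A} (h : IsLeftCoideal Δ S) (α β : A →ₗ[ℂ] ℂ)
    (hβ : ∀ y ∈ S, β y = 0) {x : A} (hx : x ∈ S) :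
    LinearMap.mul' ℂ ℂ (TensorProduct.map α β (Δ x)) = 0 := by
  obtain ⟨t, ht⟩ := h ⟨x, hx, rfl⟩
  rw [← show Algebra.TensorProduct.map (AlgHom.id ℂ A) S.val t = Δ x from ht]
  clear ht
  induction t using TensorProduct.induction_on with
  | zero => simp
  | tmul u v => simp [hβ v v.2]
  | add u v hu hv =>
    rw [map_add, map_add, map_add, hu, hv, add_zero]

/-- The value on `Δ(Q̃)` of a product of functionals vanishing at `1` and on the subalgebra. -/
theorem mul_map_coproduct_add_lie {A : Type*} [Ring A] [Algebra ℂ A] {Q : I ⊕ P → A}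
    {f : I ⊕ P → I ⊕ P → I ⊕ P → ℝ} {Δ : A →ₐ[ℂ] A ⊗[ℂ] A}
    (hQ : ∀ a b, Q a * Q b - Q b * Q a = ∑ c, (f a b c : ℂ) • Q c)
    (h0 : ∀ a, Δ (Q a) = Q a ⊗ₜ[ℂ] 1 + 1 ⊗ₜ[ℂ] Q a) {x : A} {a : I ⊕ P}
    (h1 : Δ x = x ⊗ₜ[ℂ] 1 + 1 ⊗ₜ[ℂ] x + (1 / 2 : ℂ) • ∑ b, ∑ c, (f a b c : ℂ) • (Q b ⊗ₜ[ℂ] Q c))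
    (α β : A →ₗ[ℂ] ℂ) (hα : α 1 = 0) (hβ : β 1 = 0) (hαQ : ∀ i, α (Q (Sum.inl i)) = 0)
    (hβQ : ∀ i, β (Q (Sum.inl i)) = 0) :
    LinearMap.mul' ℂ ℂ (TensorProduct.map α β (Δ (x + (1 / 4 : ℂ) • ⁅subCasimir Q, Q a⁆))) =
      (1 / 2 : ℂ) * ∑ b, ∑ c, (f a b c : ℂ) * (α (Q b) * β (Q c)) := by
  -- Each term of the two commutators has a leg in `h`, so `α` or `β` kills it and only the `f`-tail
  -- of `Δ(Q_1)` contributes.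
  rw [coproduct_add_lie h0 h1, lie_subTensor_left hQ, lie_subTensor_right hQ]
  simp only [map_add, map_smul, map_sum, TensorProduct.map_tmul, LinearMap.mul'_apply, hα, hβ,
    hαQ, hβQ, mul_zero, zero_mul, Finset.sum_const_zero, add_zero, zero_add, smul_eq_mul]

variable {n : Type*} [Fintype n] [DecidableEq n]

/-- All weights of the defining representation have the same length, so the torus Casimir is scalar.
The constant is read off from completeness at `E_jj`. -/
theorem suTorus_sum_mul_self [Nonempty n] {T : Module.Basis (I ⊕ P) ℝ (suLie n)}
    (hT : IsAdaptedBasis (suMetric n) (suTorus n) ((suMetric n).orthogonal (suTorus n).toSubmodule)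
      T) :
    ∑ i, (T (Sum.inl i) : Matrix n n ℂ) * (T (Sum.inl i) : Matrix n n ℂ) =
      (-(1 - 1 / Fintype.card n) : ℂ) • (1 : Matrix n n ℂ) := by
  have hd (i : I) : (T (Sum.inl i) : Matrix n n ℂ) = diagonal (T (Sum.inl i) : Matrix n n ℂ).diag :=
    (IsDiag.diagonal_diag (hT.mem_h i)).symm
  ext j k
  by_cases hjk : j = k
  · subst hjk
    have h := congrFun (congrFun (suTorus_completeness hT (single j j 1)) j) j
    simp only [Matrix.sum_apply, Matrix.smul_apply, smul_eq_mul] at h ⊢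
    have e (i : I) : ((T (Sum.inl i) : Matrix n n ℂ) * (T (Sum.inl i) : Matrix n n ℂ)) j j =
        ((T (Sum.inl i) : Matrix n n ℂ) * single j j 1).trace * (T (Sum.inl i) : Matrix n n ℂ) j j := by
      rw [hd i, diagonal_mul_diagonal, trace_mul_single]
      simp
    simp only [e, h]
    simp
  · rw [Matrix.sum_apply, Matrix.smul_apply, one_apply_ne hjk, smul_zero]
    refine Finset.sum_eq_zero fun i _ => ?_
    rw [hd i, diagonal_mul_diagonal, diagonal_apply_ne _ hjk]

/-- A scalar Casimir has no commutators and `Q_1` acts by zero, so each `Q̃` maps to zero; the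
remaining generators map to diagonal matrices. -/
theorem map_twistedYangian_isDiag [Nonempty n] {T : Module.Basis (I ⊕ P) ℝ (suLie n)}
    (hT : IsAdaptedBasis (suMetric n) (suTorus n) ((suMetric n).orthogonal (suTorus n).toSubmodule)
      T) {φ : Yangian (structureConst (suMetric n) T) →ₐ[ℂ] Matrix n n ℂ}
    (h0 : ∀ a, φ (Yangian.Q0 _ a) = T a) (h1 : ∀ a, φ (Yangian.Q1 _ a) = 0)
    {x : Yangian (structureConst (suMetric n) T)}
    (hx : x ∈ twistedYangian (structureConst (suMetric n) T)) : (φ x).IsDiag := by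
  have hle : twistedYangian (structureConst (suMetric n) T) ≤
      (diagonalAlgHom (n := n) (α := ℂ) ℂ).range.comap φ := by
    rw [twistedYangian, Algebra.adjoin_le_iff]
    rintro _ (⟨i, rfl⟩ | ⟨p, rfl⟩)
    · refine ⟨(T (Sum.inl i) : Matrix n n ℂ).diag, ?_⟩
      exact (IsDiag.diagonal_diag (hT.mem_h i)).trans (h0 _).symm
    · have hC : φ (TwistedYangian.casimir (structureConst (suMetric n) T)) =
          (-(1 - 1 / Fintype.card n) : ℂ) • (1 : Matrix n n ℂ) := by
        rw [TwistedYangian.casimir, map_sum, ← suTorus_sum_mul_self hT]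
        simp only [map_mul, h0]
      have : φ (TwistedYangian.Qtilde (structureConst (suMetric n) T) p) = 0 := by
        rw [TwistedYangian.Qtilde, map_add, h1, map_smul, Ring.lie_def, map_sub, map_mul, map_mul,
          hC]
        simp
      exact ⟨0, by simpa using this.symm⟩
  obtain ⟨d, hd⟩ := hle hx
  rw [← show diagonal d = φ x from hd]
  exact isDiag_diagonal d

/-- Completeness at `E_jk` turns the sum over `b` into `-E_jk`, leaving the `(i, k)` entry of
`-[T_p, E_jk]`. -/
theorem suLie_sum_entry_mul_lie [Nonempty n] {ι : Type*} [Fintype ι]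
    {T : Module.Basis ι ℝ (suLie n)} (hT : IsMetricBasis (suMetric n) T) (p : ι) {i j k : n}
    (hij : i ≠ j) (hjk : j ≠ k) :
    ∑ b, ∑ c, (structureConst (suMetric n) T p b c : ℂ) *
      ((T b : Matrix n n ℂ) k j * (T c : Matrix n n ℂ) i k) = -(T p : Matrix n n ℂ) i j := by
  have inner (b : ι) : ∑ c, (structureConst (suMetric n) T p b c : ℂ) * (T c : Matrix n n ℂ) i k =
      ((T p : Matrix n n ℂ) * T b - (T b : Matrix n n ℂ) * T p) i k := by
    have := congrFun (congrFun (sum_structureConst_smul hT (suIncl n) p b) i) k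
    simpa [suIncl_apply, Matrix.sum_apply, Ring.lie_def] using this
  have hZ : ∑ b, (T b : Matrix n n ℂ) k j • (T b : Matrix n n ℂ) = -single j k 1 := by
    have := suLie_completeness hT (single j k 1)
    simpa [trace_mul_single, hjk, hjk.symm] using this
  have : ∑ b, ∑ c, (structureConst (suMetric n) T p b c : ℂ) *
      ((T b : Matrix n n ℂ) k j * (T c : Matrix n n ℂ) i k) =
      ((T p : Matrix n n ℂ) * (∑ b, (T b : Matrix n n ℂ) k j • (T b : Matrix n n ℂ))
        - (∑ b, (T b : Matrix n n ℂ) k j • (T b : Matrix n n ℂ)) * T p) i k := by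
    rw [Finset.mul_sum, Finset.sum_mul, ← Finset.sum_sub_distrib, Matrix.sum_apply]
    refine Finset.sum_congr rfl fun b _ => ?_
    rw [mul_smul_comm, smul_mul_assoc, ← smul_sub, Matrix.smul_apply, ← inner, smul_eq_mul,
      Finset.mul_sum]
    exact Finset.sum_congr rfl fun c _ => by ring
  rw [this, hZ]
  simp [hij, hij.symm]

theorem not_isLeftCoideal_suTorus {i j k : n} (hij : i ≠ j) (hjk : j ≠ k) (hik : i ≠ k)
    {T : Module.Basis (I ⊕ P) ℝ (suLie n)}
    (hT : IsAdaptedBasis (suMetric n) (suTorus n) ((suMetric n).orthogonal (suTorus n).toSubmodule)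
      T) {Δ : Yangian (structureConst (suMetric n) T) →ₐ[ℂ]
        Yangian (structureConst (suMetric n) T) ⊗[ℂ] Yangian (structureConst (suMetric n) T)}
    (hΔ : Yangian.IsCoproduct (structureConst (suMetric n) T) Δ) :
    ¬ IsLeftCoideal Δ (twistedYangian (structureConst (suMetric n) T)) := by
  intro hco
  have : Nonempty n := ⟨i⟩
  have hM := hT.isMetricBasis suMetric_isInvariant
  obtain ⟨φ, h0, h1⟩ := (suIncl_isYangianPair hM).exists_algHom hM
  have hdiag (b : I) {r s : n} (hrs : r ≠ s) : (T (Sum.inl b) : Matrix n n ℂ) r s = 0 :=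
    hT.mem_h b hrs
  let entry (r s : n) : Yangian (structureConst (suMetric n) T) →ₗ[ℂ] ℂ :=
    Matrix.entryLinearMap ℂ ℂ r s ∘ₗ φ.toLinearMap
  have hentry (r s : n) (y) : entry r s y = φ y r s := rfl
  have hone {r s : n} (hrs : r ≠ s) : entry r s 1 = 0 := by
    rw [hentry, map_one, one_apply_ne hrs]
  -- The functional `(k, j) ⊗ (i, k)` is both zero, by the co-ideal property, and `-½ (T_p)_{ij}`.
  -- Both entries must be off-diagonal and also `i ≠ j`, hence three distinct indices.
  have hz (p : P) : (T (Sum.inr p) : Matrix n n ℂ) i j = 0 := by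
    have e1 := hco.mul_map_eq_zero (entry k j) (entry i k)
      (fun y hy => map_twistedYangian_isDiag hT h0 h1 hy hik)
      (Algebra.subset_adjoin (Or.inr ⟨p, rfl⟩))
    have e2 := mul_map_coproduct_add_lie (Yangian.Q0_mul_Q0 _) hΔ.map_Q0 (hΔ.map_Q1 (Sum.inr p))
      (entry k j) (entry i k) (hone hjk.symm) (hone hik)
      (fun b => by rw [hentry, h0]; exact hdiag b hjk.symm)
      (fun b => by rw [hentry, h0]; exact hdiag b hik)
    simp only [hentry, h0, suIncl_apply, suLie_sum_entry_mul_lie hM _ hij hjk] at e2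
    have e3 := e2.symm.trans e1
    simpa using e3
  -- The torus part is diagonal, so now the whole of `su(n)` would have zero `(i, j)` entry, which
  -- `E_ij - E_ji` contradicts.
  have hall (x : suLie n) : (x : Matrix n n ℂ) i j = 0 := by
    have := congrFun (congrFun (hM.sum_smul_map (suIncl n) x) i) j
    rw [suIncl_apply] at this
    rw [← this, Matrix.sum_apply]
    refine Finset.sum_eq_zero fun a _ => ?_
    rcases a with b | p
    · simp [suIncl_apply, hdiag b hij]
    · simp [suIncl_apply, hz p]
  have hmem : single i j (1 : ℂ) - single j i 1 ∈ suLie n := by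
    refine ⟨?_, by simp [hij, hij.symm]⟩
    rw [conjTranspose_sub, conjTranspose_single, conjTranspose_single]
    simp
  have := hall ⟨_, hmem⟩
  simp [single_apply, hij, hij.symm] at this

end CoidealFailure
theorem mainTheorem1 :
    -- symmetric pairs: the coproduct exists, and the twisted Yangian is a left co-ideal
    (∀ (g : Type*) [LieRing g] [LieAlgebra ℝ g] [LieAlgebra.IsSimple ℝ g]
      (γ : LinearMap.BilinForm ℝ g) (_ : IsInvariantMetric γ)
      (h : LieSubalgebra ℝ g) (k : Submodule ℝ g) (_ : IsSymmetricPair h k)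
      (I P : Type*) [Fintype I] [Fintype P]
      (T : Module.Basis (I ⊕ P) ℝ g) (_ : IsAdaptedBasis γ h k T),
      ∃ Δ : Yangian (structureConst γ T) →ₐ[ℂ]
          Yangian (structureConst γ T) ⊗[ℂ] Yangian (structureConst γ T),
        Yangian.IsCoproduct (structureConst γ T) Δ ∧
        (∀ p : P, Δ (TwistedYangian.Qtilde (structureConst γ T) p) =
          TwistedYangian.Qtilde (structureConst γ T) p ⊗ₜ[ℂ] 1
            + 1 ⊗ₜ[ℂ] TwistedYangian.Qtilde (structureConst γ T) p
            + (1 / 2 : ℂ) • ⁅Δ (TwistedYangian.casimir (structureConst γ T))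
                - TwistedYangian.casimir (structureConst γ T) ⊗ₜ[ℂ] 1
                - 1 ⊗ₜ[ℂ] TwistedYangian.casimir (structureConst γ T),
              Yangian.Q0 (structureConst γ T) (Sum.inr p) ⊗ₜ[ℂ] 1⁆) ∧
        IsLeftCoideal Δ (twistedYangian (structureConst γ T))) ∧
    -- general subalgebras: the co-ideal property can fail
    (∃ (g : Type) (_ : LieRing g) (_ : LieAlgebra ℝ g) (_ : LieAlgebra.IsSimple ℝ g)
      (γ : LinearMap.BilinForm ℝ g) (_ : IsInvariantMetric γ)
      (h : LieSubalgebra ℝ g)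
      (I P : Type) (_ : Fintype I) (_ : Fintype P)
      (T : Module.Basis (I ⊕ P) ℝ g)
      (_ : IsAdaptedBasis γ h (γ.orthogonal h.toSubmodule) T)
      (Δ : Yangian (structureConst γ T) →ₐ[ℂ]
          Yangian (structureConst γ T) ⊗[ℂ] Yangian (structureConst γ T)),
        Yangian.IsCoproduct (structureConst γ T) Δ ∧
        ¬ IsLeftCoideal Δ (twistedYangian (structureConst γ T))) := by
  refine ⟨?_, ?_⟩
  · intro g _ _ _ γ hγ h k hs I P _ _ T hT
    exact exists_coproduct_coideal hγ hs hT
  -- The smallest `su(n)` with three distinct indices.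
  · have := suLie_isSimple (n := Fin 3)
    obtain ⟨I, P, _, _, T, hT⟩ := exists_adaptedBasis suMetric_isInvariant (suTorus (Fin 3))
    obtain ⟨Δ, hΔ⟩ := exists_isCoproduct (hT.isMetricBasis suMetric_isInvariant)
    exact ⟨suLie (Fin 3), inferInstance, inferInstance, this, suMetric (Fin 3),
      suMetric_isInvariant, suTorus (Fin 3), I, P, inferInstance, inferInstance, T, hT, Δ, hΔ,
      not_isLeftCoideal_suTorus (i := 0) (j := 1) (k := 2) (by decide) (by decide) (by decide)
        hT hΔ⟩
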